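/- Let $n\ge 0$, $[n+1]=\{1,\dots,n+1\}$, and let $\mathfrak S_{n+1}$ be the symmetric group on $[n+1]$, with simple transpositions $s_i=(i,i+1)$, $1\le i\le n$. Let $c$ be a standard Coxeter element, i.e. a product of all the $s_i$, each taken once, in some order; it is an $(n+1)$-cycle $c=(i_1,\dots,i_{n+1})$ with $i_1=1$, $i_k=n+1$ for some $k$. Put $R_c=\{i_1,\dots,i_k\}$ and $L_c=\{i_k,\dots,i_{n+1},i_1\}$. Let $\ell_{\mathcal T}(w)$ be the least number of transpositions whose product is $w$, and let $\mathsf{NC}(\mathfrak S_{n+1},c)$ be the set of $x$ with $\ell_{\mathcal T}(x)+\ell_{\mathcal T}(x^{-1}c)=\ell_{\mathcal T}(c)$. For such $x$, the polygons of $x$ are the supports $P$ of the nontrivial cycles of $x$, viewed as polygons on a circle labelled clockwise by $i_1,\dots,i_{n+1}$; conversely, pairwise disjoint (noncrossing) polygons represent the product of the cycles running clockwise along them. Let $\mathsf{supp}(x)$ be the union of the polygons. An index is initial (terminal) if it is the minimum (maximum) of a polygon of $x$; $k$ is nested in $P$ if $k\notin P$ and $\min P<k<\max P$. Let $D_x^c$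 ($U_x^c$) be $\mathsf{supp}(x)$ with the terminal (initial) indices removed. Define $\mathsf{inv}_c$ on $\mathsf{NC}(\mathfrak S_{n+1},c)$ as follows: let $M=D_x^c\cap U_x^c\cap L_c$, and let $N$ be the set of $k\in L_c\setminus\mathsf{supp}(x)$ that are nested in some polygon of $x$. Each $k\in N$ is added as a vertex to the unique polygon $P$ of $x$ in which it is nested and for which $P\cup\{k\}$ crosses no other polygon of $x$; then all vertices in $M$ are removed, and $\mathsf{inv}_c(x)$ is the permutation represented by the resulting polygons. Let $\psi_2(x)=(D^c_{\mathsf{inv}_c(x)},U^c_{\mathsf{inv}_c(x)})$. Let $\mathcal I(n)$ be the set of pairs $(D,U)$ of subsets $D=\{d_1<\dots<d_k\}$, $U=\{u_1<\dots<u_k\}$ of $[n+1]$, $0\le k\le n$, with $d_m<u_m$ for all $m$. Let $\mathsf{FC}(\mathfrak S_{n+1})$ be the set of fully commutative permutations, those for which any two reduced expressions in the $s_i$ are related by commutations of adjacent commuting letters. The normal form of such a $w$ is its reduced expression $$(s_{i_1}s_{i_1-1}\cdots s_{j_1})\cdots(s_{i_k}s_{i_k-1}\cdots s_{j_k}),\qquad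 i_1<\dots<i_k,\quad j_1<\dots<j_k,\quad j_m\le i_m,$$ and $I_w=\{i_1,\dots,i_k\}$, $J_w=\{j_1,\dots,j_k\}$. Let $g:\mathcal I(n)\to\mathsf{FC}(\mathfrak S_{n+1})$ send $(D,U)$ to the $w$ with $J_w=D$ and $I_w+1=U$, i.e. to $\prod_m (s_{u_m-1}\cdots s_{d_m})$. Then $\mathsf{inv}_c$ maps $\mathsf{NC}(\mathfrak S_{n+1},c)$ to itself, $\psi_2$ maps it to $\mathcal I(n)$, and $$\varphi:=g\circ\psi_2:\mathsf{NC}(\mathfrak S_{n+1},c)\longrightarrow\mathsf{FC}(\mathfrak S_{n+1})$$ is a bijection. Moreover, for all $x\in\mathsf{NC}(\mathfrak S_{n+1},c)$, the permutation $\varphi(x)$ has exactly one normal form, and for all $k\in[n+1]$: * $k\in J_{\varphi(x)}$ if and only if $k\in R_c\cap D_x^c$, or $k\in L_c$ and $k$ is an initial index of a polygon of $x$, or $k\in L_c\setminus\mathsf{supp}(x)$ and $k$ is nested in a polygon of $x$; * $k-1\in I_{\varphi(x)}$ if and only if $k\in R_c\cap U_x^c$, or $k\in L_c$ and $k$ is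 a terminal index of a polygon of $x$, or $k\in L_c\setminus\mathsf{supp}(x)$ and $k$ is nested in a polygon of $x$. -/

import Mathlib

/-! The symmetric group `𝔖_{n+1}` is `Equiv.Perm (Fin (n + 1))`: the point of `[n+1] = {1, …, n+1}`
with label `k` is the element of `Fin (n + 1)` with value `k - 1`, and the simple reflection `s_i`,
`1 ≤ i ≤ n`, is indexed by the element of `Fin n` with value `i - 1`.  Products of permutations are
composed from right to left. -/

namespace NCFC

open Equiv Equiv.Perm

/-! ### Words, reduced expressions, fully commutative permutations -/

/-- The simple reflection exchanging two consecutive points. -/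
def simpleRefl {n : ℕ} (i : Fin n) : Perm (Fin (n + 1)) := swap i.castSucc i.succ

/-- The product of a word in the simple reflections. -/
def wordProd {n : ℕ} (l : List (Fin n)) : Perm (Fin (n + 1)) := (l.map simpleRefl).prod

/-- `l` is a reduced expression of `w` in the simple reflections. -/
def IsReducedWord {n : ℕ} (w : Perm (Fin (n + 1))) (l : List (Fin n)) : Prop :=
  wordProd l = w ∧ ∀ l' : List (Fin n), wordProd l' = w → l.length ≤ l'.length

/-- One commutation of two adjacent commuting letters of a word. -/
def CommStep {n : ℕ} (l l' : List (Fin n)) : Prop :=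
  ∃ (a b : List (Fin n)) (i j : Fin n), Commute (simpleRefl i) (simpleRefl j) ∧
    l = a ++ i :: j :: b ∧ l' = a ++ j :: i :: b

/-- The set of fully commutative permutations. -/
def FC (n : ℕ) : Set (Perm (Fin (n + 1))) :=
  {w | ∀ l l' : List (Fin n), IsReducedWord w l → IsReducedWord w l' →
    Relation.ReflTransGen CommStep l l'}

/-- The decreasing word of the indices `m` with `a ≤ m < b`, that is `s_{b-1} s_{b-2} ⋯ s_a`. -/
def descRun (n a b : ℕ) : List (Fin n) :=
  ((List.finRange n).filter (fun m : Fin n => a ≤ (m : ℕ) ∧ (m : ℕ) < b)).reverse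

/-- `(s_{i_1} ⋯ s_{j_1}) (s_{i_2} ⋯ s_{j_2}) ⋯ (s_{i_k} ⋯ s_{j_k})` is the normal form of `w`,
where `is = [i_1, …, i_k]` and `js = [j_1, …, j_k]`. -/
structure IsNormalForm {n : ℕ} (w : Perm (Fin (n + 1))) (is js : List (Fin n)) : Prop where
  sorted_is : is.Pairwise (· < ·)
  sorted_js : js.Pairwise (· < ·)
  le : List.Forall₂ (fun j i => j ≤ i) js is
  reduced : IsReducedWord w
    (List.zipWith (fun i j : Fin n => descRun n (j : ℕ) ((i : ℕ) + 1)) is js).flatten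

/-- The set `I_w` of the first indices in the factors of the normal form of `w`. -/
def I {n : ℕ} (w : Perm (Fin (n + 1))) : Set (Fin n) :=
  {i | ∃ is js : List (Fin n), IsNormalForm w is js ∧ i ∈ is}

/-- The set `J_w` of the last indices in the factors of the normal form of `w`. -/
def J {n : ℕ} (w : Perm (Fin (n + 1))) : Set (Fin n) :=
  {j | ∃ is js : List (Fin n), IsNormalForm w is js ∧ j ∈ js}

/-! ### Pairs of integral sequences -/

/-- The set `𝓘(n)` of pairs `(D, U)` of subsets with `D = {d_1 < ⋯ < d_k}`,
`U = {u_1 < ⋯ < u_k}` and `d_m < u_m` for all `m`. -/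
def seqPairs (n : ℕ) : Set (Finset (Fin (n + 1)) × Finset (Fin (n + 1))) :=
  {p | List.Forall₂ (fun d u => d < u) p.1.sort p.2.sort}

/-- The map `g` sending `(D, U)` to the permutation `w` whose normal form satisfies `J_w = D` and
`I_w + 1 = U`, namely to the product over `m` of `s_{u_m - 1} ⋯ s_{d_m}`. -/
def g {n : ℕ} (p : Finset (Fin (n + 1)) × Finset (Fin (n + 1))) : Perm (Fin (n + 1)) :=
  wordProd (List.zipWith (fun d u : Fin (n + 1) => descRun n (d : ℕ) (u : ℕ))
    p.1.sort p.2.sort).flatten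

/-! ### Coxeter elements and noncrossing partitions -/

/-- `c` is a product of all the simple reflections, each taken once, in some order. -/
def IsStdCoxeter {n : ℕ} (c : Perm (Fin (n + 1))) : Prop :=
  ∃ l : List (Fin n), l.Nodup ∧ (∀ i, i ∈ l) ∧ c = wordProd l

/-- The reflection length: the least number of transpositions in a factorization of `w`. -/
noncomputable def reflLength {n : ℕ} (w : Perm (Fin (n + 1))) : ℕ :=
  sInf {k | ∃ l : List (Perm (Fin (n + 1))), l.length = k ∧ (∀ t ∈ l, t.IsSwap) ∧ l.prod = w}

/-- The absolute order. -/
def AbsLE {n : ℕ} (u v : Perm (Fin (n + 1))) : Prop :=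
  reflLength u + reflLength (u⁻¹ * v) = reflLength v

/-- The noncrossing partitions for `c`: the permutations below `c` in the absolute order. -/
def NC {n : ℕ} (c : Perm (Fin (n + 1))) : Set (Perm (Fin (n + 1))) := {u | AbsLE u c}

/-- The points met when moving along the cycle of `c` from `a` up to and including the first visit
of `b`. -/
def arc {n : ℕ} (c : Perm (Fin (n + 1))) (a b : Fin (n + 1)) : Finset (Fin (n + 1)) :=
  Finset.univ.filter (fun i => ∃ j : Fin (n + 1), i = (c ^ (j : ℕ)) a ∧
    ∀ m < j, (c ^ (m : ℕ)) a ≠ b)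

/-- For `c = (i_1, …, i_{n+1})` with `i_1 = 1` and `i_k = n+1`, the set `{i_1, …, i_k}`. -/
def R {n : ℕ} (c : Perm (Fin (n + 1))) : Finset (Fin (n + 1)) := arc c 0 (Fin.last n)

/-- For `c = (i_1, …, i_{n+1})` with `i_1 = 1` and `i_k = n+1`, the set
`{i_k, …, i_{n+1}, i_1}`. -/
def L {n : ℕ} (c : Perm (Fin (n + 1))) : Finset (Fin (n + 1)) := arc c (Fin.last n) 0

/-! ### Polygons -/

/-- The polygons of `x`, given by their vertex sets: the supports of the nontrivial cycles. -/
def Pol {n : ℕ} (x : Perm (Fin (n + 1))) : Finset (Finset (Fin (n + 1))) :=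
  x.cycleFactorsFinset.image support

/-- `k` is the least vertex of a polygon of `x`. -/
def IsInitial {n : ℕ} (x : Perm (Fin (n + 1))) (k : Fin (n + 1)) : Prop :=
  ∃ P ∈ Pol x, k ∈ P ∧ ∀ a ∈ P, k ≤ a

instance {n : ℕ} (x : Perm (Fin (n + 1))) : DecidablePred (IsInitial x) :=
  fun k => by unfold IsInitial; infer_instance

/-- `k` is the greatest vertex of a polygon of `x`. -/
def IsTerminal {n : ℕ} (x : Perm (Fin (n + 1))) (k : Fin (n + 1)) : Prop :=
  ∃ P ∈ Pol x, k ∈ P ∧ ∀ a ∈ P, a ≤ k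

instance {n : ℕ} (x : Perm (Fin (n + 1))) : DecidablePred (IsTerminal x) :=
  fun k => by unfold IsTerminal; infer_instance

/-- `k` is nested in the polygon with vertex set `P`: it is not a vertex and
`min P < k < max P`. -/
def Nested {n : ℕ} (k : Fin (n + 1)) (P : Finset (Fin (n + 1))) : Prop :=
  k ∉ P ∧ (∃ a ∈ P, a < k) ∧ (∃ b ∈ P, k < b)

instance {n : ℕ} (k : Fin (n + 1)) : DecidablePred (Nested k) :=
  fun P => by unfold Nested; infer_instance

/-- The non-terminal vertices of polygons of `x`. -/
def D {n : ℕ} (x : Perm (Fin (n + 1))) : Finset (Fin (n + 1)) :=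
  x.support.filter (fun k => ¬ IsTerminal x k)

/-- The non-initial vertices of polygons of `x`. -/
def U {n : ℕ} (x : Perm (Fin (n + 1))) : Finset (Fin (n + 1)) :=
  x.support.filter (fun k => ¬ IsInitial x k)

/-- The polygons with vertex sets `A` and `B` cross on the circle labelled clockwise by the cycle
`c`: there are `a, a' ∈ A` and `b, b' ∈ B` in clockwise order `a, b, a', b'`. -/
def Crossing {n : ℕ} (c : Perm (Fin (n + 1))) (A B : Finset (Fin (n + 1))) : Prop :=
  ∃ a ∈ A, ∃ p q r : Fin (n + 1), 0 < p ∧ p < q ∧ q < r ∧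
    (c ^ (p : ℕ)) a ∈ B ∧ (c ^ (q : ℕ)) a ∈ A ∧ (c ^ (r : ℕ)) a ∈ B

instance {n : ℕ} (c : Perm (Fin (n + 1))) (A : Finset (Fin (n + 1))) :
    DecidablePred (Crossing c A) :=
  fun B => by unfold Crossing; infer_instance

/-! ### The involution -/

/-- The vertices in `L c` that are neither initial nor terminal. -/
def M {n : ℕ} (c x : Perm (Fin (n + 1))) : Finset (Fin (n + 1)) := D x ∩ U x ∩ L c

/-- The points of `L c` that are not vertices but are nested in at least one polygon. -/
def N {n : ℕ} (c x : Perm (Fin (n + 1))) : Finset (Fin (n + 1)) :=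
  (L c).filter (fun k => k ∉ x.support ∧ ∃ P ∈ Pol x, Nested k P)

/-- `k` is nested in `P`, and `P` can be enlarged by the vertex `k` so that the diagram of `x`
stays noncrossing. -/
def Enlarges {n : ℕ} (c x : Perm (Fin (n + 1))) (P : Finset (Fin (n + 1))) (k : Fin (n + 1)) :
    Prop :=
  Nested k P ∧ ∀ Q ∈ Pol x, Q ≠ P → ¬ Crossing c (insert k P) Q

instance {n : ℕ} (c x : Perm (Fin (n + 1))) (P : Finset (Fin (n + 1))) :
    DecidablePred (Enlarges c x P) :=
  fun k => by unfold Enlarges; infer_instance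

/-- The polygons obtained from those of `x` by adding every point of `N c x` to the polygon that
it enlarges. -/
def enlargedPol {n : ℕ} (c x : Perm (Fin (n + 1))) : Finset (Finset (Fin (n + 1))) :=
  (Pol x).image (fun P => P ∪ (N c x).filter (fun k => Enlarges c x P k))

/-- The polygons obtained from the enlarged ones by removing the vertices in `M c x`. -/
def invPol {n : ℕ} (c x : Perm (Fin (n + 1))) : Finset (Finset (Fin (n + 1))) :=
  (enlargedPol c x).image (fun P => P \ M c x)

/-- The cycle running clockwise through the vertices of `P`, on the circle labelled by `c`. -/
def polygonCycle {n : ℕ} (c : Perm (Fin (n + 1))) (P : Finset (Fin (n + 1))) :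
    Perm (Fin (n + 1)) :=
  (((List.range (n + 1)).map (fun j => (c ^ j) 0)).filter (fun i => i ∈ P)).formPerm

/-- The permutation represented by a collection of pairwise disjoint polygons: the product of the
(commuting) cycles running clockwise along them. -/
noncomputable def diagramPerm {n : ℕ} (c : Perm (Fin (n + 1)))
    (Ps : Finset (Finset (Fin (n + 1)))) : Perm (Fin (n + 1)) :=
  (Ps.toList.map (polygonCycle c)).prod

/-- The map `inv_c` on noncrossing partitions. -/
noncomputable def invol {n : ℕ} (c x : Perm (Fin (n + 1))) : Perm (Fin (n + 1)) :=
  diagramPerm c (invPol c x)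

/-! ### The bijections -/

/-- The map `ψ₁ : x ↦ (D_x, U_x)`. -/
def psi1 {n : ℕ} (x : Perm (Fin (n + 1))) : Finset (Fin (n + 1)) × Finset (Fin (n + 1)) :=
  (D x, U x)

/-- The map `ψ₂ = ψ₁ ∘ inv_c`. -/
noncomputable def psi2 {n : ℕ} (c x : Perm (Fin (n + 1))) :
    Finset (Fin (n + 1)) × Finset (Fin (n + 1)) :=
  psi1 (invol c x)

/-- The map `φ = g ∘ ψ₂`. -/
noncomputable def phi {n : ℕ} (c x : Perm (Fin (n + 1))) : Perm (Fin (n + 1)) := g (psi2 c x)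

end NCFC

namespace NCFC

open Equiv Equiv.Perm

/-! ### Commutation classes of words -/

variable {n : ℕ}

/-! By definition φ is `g` ∘ `psi1` ∘ `invol c`, and each of the three maps is a bijection.

The map `g`. A pair of `seqPairs n` is a chain of pairs (d, u), and `g` turns it into a product w of
runs s_{u-1}⋯s_d. Such a w sends every d to its u and raises no other point, so the chain consists
of the exceedances of w, and the total excedance, a lower bound for the length of any word, is
attained. Prepending a letter to a chain word gives, up to commutations, a chain word, a repeated
letter or a braid (`cons_runWord_cases`). Repetitions and braids waste length, so every reduced word
of w is commutation-equivalent to its chain word. Conversely, a reduced word of a fully commutative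
permutation has no repetition, and no braid either, since a braid move changes the multiset of
letters. This gives `mem_FC_iff`, and chains are the same thing as normal forms.

The map `psi1`. A Coxeter element labels the circle by 1, …, n+1 in a unimodal order, and `NC c`
consists of the permutations that are noncrossing for the positions t on this circle (`mem_NC_iff`).
Let u be the least element of U. Its polygon has exactly one vertex d below u, and d is the element
of D below u that is nearest to u on the circle, in the direction dictated by the side of u. Cutting
d off removes d from D and u from U and nothing else. Induction on the size of U gives injectivity,
the image and surjectivity (`NonCrossing.ext_D_U`, `NonCrossing.psi1_mem`,
`exists_nonCrossing_of_mem_seqPairs`).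

The map `invol c`. It keeps the minimum and maximum of every polygon, and on L_c it exchanges the
interior vertices with the nested non-vertices. Hence D and U of x can be recovered from the image,
so `invol c` is injective on the finite set `NC c`, and therefore bijective. The same rules yield
the description of J and I. -/

theorem wordProd_nil : wordProd ([] : List (Fin n)) = 1 := rfl

theorem wordProd_cons (i : Fin n) (l : List (Fin n)) :
    wordProd (i :: l) = simpleRefl i * wordProd l := by
  simp [wordProd]

theorem wordProd_append (l l' : List (Fin n)) :
    wordProd (l ++ l') = wordProd l * wordProd l' := by
  simp [wordProd]

theorem simpleRefl_mul_self (i : Fin n) : simpleRefl i * simpleRefl i = 1 := by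
  simp [simpleRefl]

/-- Commutation equivalence of words. -/
abbrev CommEquiv (l l' : List (Fin n)) : Prop := Relation.ReflTransGen CommStep l l'

theorem CommStep.symm {l l' : List (Fin n)} (h : CommStep l l') : CommStep l' l := by
  obtain ⟨a, b, i, j, hij, rfl, rfl⟩ := h
  exact ⟨a, b, j, i, hij.symm, rfl, rfl⟩

theorem CommEquiv.symm {l l' : List (Fin n)} (h : CommEquiv l l') : CommEquiv l' l :=
  have : Std.Symm (CommStep (n := n)) := ⟨fun _ _ => CommStep.symm⟩
  (Relation.ReflTransGen.stdSymm (r := CommStep)).symm _ _ h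

theorem CommStep.perm {l l' : List (Fin n)} (h : CommStep l l') : l.Perm l' := by
  obtain ⟨a, b, i, j, hij, rfl, rfl⟩ := h
  exact List.Perm.append_left a (List.Perm.swap j i b)

theorem CommEquiv.perm {l l' : List (Fin n)} (h : CommEquiv l l') : l.Perm l' := by
  induction h with
  | refl => exact List.Perm.refl _
  | tail _ h ih => exact ih.trans h.perm

theorem CommStep.wordProd_eq {l l' : List (Fin n)} (h : CommStep l l') :
    wordProd l = wordProd l' := by
  obtain ⟨a, b, i, j, hij, rfl, rfl⟩ := h
  simp only [wordProd_append, wordProd_cons]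
  rw [← mul_assoc (simpleRefl i), hij.eq, mul_assoc]

theorem CommEquiv.wordProd_eq {l l' : List (Fin n)} (h : CommEquiv l l') :
    wordProd l = wordProd l' := by
  induction h with
  | refl => rfl
  | tail _ h ih => exact ih.trans h.wordProd_eq

theorem CommEquiv.append_left (a : List (Fin n)) {l l' : List (Fin n)} (h : CommEquiv l l') :
    CommEquiv (a ++ l) (a ++ l') := by
  refine Relation.ReflTransGen.lift (a ++ ·) ?_ _ _ h
  rintro _ _ ⟨p, q, i, j, hij, rfl, rfl⟩
  exact ⟨a ++ p, q, i, j, hij, by simp, by simp⟩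

theorem CommEquiv.cons (i : Fin n) {l l' : List (Fin n)} (h : CommEquiv l l') :
    CommEquiv (i :: l) (i :: l') :=
  CommEquiv.append_left [i] h

/-- This makes commutation equivalence left-cancellative, which is how full commutativity passes
from a word to its tail. -/
theorem CommEquiv.erase (i : Fin n) {l l' : List (Fin n)} (h : CommEquiv l l') :
    CommEquiv (l.erase i) (l'.erase i) := by
  induction h with
  | refl => exact .refl
  | tail _ h ih =>
    refine ih.trans ?_
    obtain ⟨a, b, p, q, hpq, rfl, rfl⟩ := h
    by_cases ha : i ∈ a
    · rw [List.erase_append_left _ ha, List.erase_append_left _ ha]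
      exact .single ⟨_, b, p, q, hpq, rfl, rfl⟩
    · rw [List.erase_append_right _ ha, List.erase_append_right _ ha]
      refine CommEquiv.append_left a ?_
      by_cases hp : p = i <;> by_cases hq : q = i
      · subst hp; subst hq; exact .refl
      · subst hp; simp [hq]; exact .refl
      · subst hq; simp [hp]; exact .refl
      · simp only [List.erase_cons, beq_iff_eq, hp, hq, if_false]
        exact .single ⟨[], _, p, q, hpq, rfl, rfl⟩

theorem CommEquiv.of_cons {i : Fin n} {l l' : List (Fin n)} (h : CommEquiv (i :: l) (i :: l')) :
    CommEquiv l l' := by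
  simpa using CommEquiv.erase i h

theorem simpleRefl_apply_val (i : Fin n) (v : Fin (n + 1)) :
    (simpleRefl i v : ℕ) = if (v : ℕ) = i then (i : ℕ) + 1 else if (v : ℕ) = i + 1 then (i : ℕ)
      else v := by
  unfold simpleRefl
  rw [swap_apply_def]
  simp only [Fin.ext_iff, Fin.val_castSucc, Fin.val_succ]
  split_ifs <;> simp

theorem commute_simpleRefl {i j : Fin n} (h : (i : ℕ) + 2 ≤ j ∨ (j : ℕ) + 2 ≤ i) :
    Commute (simpleRefl i) (simpleRefl j) := by
  ext v
  simp only [mul_apply, simpleRefl_apply_val]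
  split_ifs <;> omega

theorem CommEquiv.cons_append {i : Fin n} {l : List (Fin n)}
    (h : ∀ j ∈ l, (i : ℕ) + 2 ≤ j ∨ (j : ℕ) + 2 ≤ i) (b : List (Fin n)) :
    CommEquiv (i :: (l ++ b)) (l ++ i :: b) := by
  induction l with
  | nil => exact .refl
  | cons j l ih =>
    refine .trans (.single ⟨[], l ++ b, i, j, commute_simpleRefl (h j (by simp)), rfl, rfl⟩) ?_
    exact CommEquiv.cons j (ih fun k hk => h k (by simp [hk]))

/-! ### Decreasing runs -/

theorem mem_descRun {a b : ℕ} {i : Fin n} : i ∈ descRun n a b ↔ a ≤ (i : ℕ) ∧ (i : ℕ) < b := by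
  simp [descRun]

theorem pairwise_descRun (a b : ℕ) : (descRun n a b).Pairwise (· > ·) := by
  unfold descRun
  rw [List.pairwise_reverse]
  exact (List.pairwise_lt_finRange n).filter _

theorem eq_of_pairwise_of_mem_iff {α : Type*} {r : α → α → Prop} [Std.Irrefl r] [Std.Antisymm r]
    {l l' : List α} (h : l.Pairwise r) (h' : l'.Pairwise r) (hm : ∀ a, a ∈ l ↔ a ∈ l') :
    l = l' := by
  refine List.Perm.eq_of_pairwise' h h' ?_
  refine (List.perm_ext_iff_of_nodup ?_ ?_).2 hm
  · exact h.imp (S := (· ≠ ·)) fun {a b} hab e => irrefl_of r a (by rwa [← e] at hab)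
  · exact h'.imp (S := (· ≠ ·)) fun {a b} hab e => irrefl_of r a (by rwa [← e] at hab)

theorem descRun_eq_nil {a b : ℕ} (h : b ≤ a) : descRun n a b = [] := by
  rw [List.eq_nil_iff_forall_not_mem]
  intro i hi
  rw [mem_descRun] at hi
  omega

theorem descRun_succ {a b : ℕ} (h : a ≤ b) (hb : b < n) :
    descRun n a (b + 1) = ⟨b, hb⟩ :: descRun n a b := by
  refine eq_of_pairwise_of_mem_iff (pairwise_descRun _ _) ?_ ?_
  · refine List.pairwise_cons.2 ⟨fun j hj => ?_, pairwise_descRun _ _⟩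
    rw [mem_descRun] at hj
    exact Fin.lt_def.2 hj.2
  · intro i
    simp only [List.mem_cons, mem_descRun, Fin.ext_iff]
    omega

theorem descRun_append {a b m : ℕ} (h : a ≤ m) (h' : m ≤ b) :
    descRun n a b = descRun n m b ++ descRun n a m := by
  refine eq_of_pairwise_of_mem_iff (pairwise_descRun _ _) ?_ ?_
  · refine List.pairwise_append.2 ⟨pairwise_descRun _ _, pairwise_descRun _ _, fun i hi j hj => ?_⟩
    rw [mem_descRun] at hi hj
    exact Fin.lt_def.2 (by omega)
  · intro i
    simp only [List.mem_append, mem_descRun]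
    omega

theorem length_descRun {a b : ℕ} (h : a ≤ b) (hb : b ≤ n) : (descRun n a b).length = b - a := by
  induction b, h using Nat.le_induction with
  | base => rw [descRun_eq_nil le_rfl]; simp
  | succ b h ih => rw [descRun_succ h (by omega), List.length_cons, ih (by omega)]; omega

theorem wordProd_descRun_apply {a b : ℕ} (h : a ≤ b) (hb : b ≤ n) (v : Fin (n + 1)) :
    (wordProd (descRun n a b) v : ℕ) =
      if (v : ℕ) = a then b else if a < (v : ℕ) ∧ (v : ℕ) ≤ b then (v : ℕ) - 1 else v := by
  induction b, h using Nat.le_induction with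
  | base =>
    rw [descRun_eq_nil le_rfl, wordProd_nil, one_apply]
    split_ifs <;> omega
  | succ b h ih =>
    rw [descRun_succ h (by omega), wordProd_cons, mul_apply, simpleRefl_apply_val,
      ih (by omega)]
    simp only
    split_ifs <;> omega

/-! ### Words of chains of pairs -/

/-- The word `∏ (s_{u-1} ⋯ s_d)` over the pairs `(d, u)` of a list. -/
def runWord (ps : List (Fin (n + 1) × Fin (n + 1))) : List (Fin n) :=
  (ps.map fun p => descRun n (p.1 : ℕ) (p.2 : ℕ)).flatten

/-- The pairs `(d, u)` satisfy `d < u` and increase strictly in both components. -/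
def IsChain (ps : List (Fin (n + 1) × Fin (n + 1))) : Prop :=
  ps.Pairwise (fun p q => p.1 < q.1 ∧ p.2 < q.2) ∧ ∀ p ∈ ps, p.1 < p.2

theorem runWord_nil : runWord ([] : List (Fin (n + 1) × Fin (n + 1))) = [] := rfl

theorem runWord_cons (p : Fin (n + 1) × Fin (n + 1)) (ps : List (Fin (n + 1) × Fin (n + 1))) :
    runWord (p :: ps) = descRun n (p.1 : ℕ) (p.2 : ℕ) ++ runWord ps := rfl

theorem isChain_cons {p : Fin (n + 1) × Fin (n + 1)} {ps : List (Fin (n + 1) × Fin (n + 1))} :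
    IsChain (p :: ps) ↔ (p.1 < p.2 ∧ ∀ q ∈ ps, p.1 < q.1 ∧ p.2 < q.2) ∧ IsChain ps := by
  simp only [IsChain, List.pairwise_cons, List.mem_cons, forall_eq_or_imp]
  tauto

/-- Multiplying the word of a chain on the left by a letter gives, up to commutations, the word
of a chain, a word with a repeated letter, or a word with a braid. -/
theorem cons_runWord_cases (i : Fin n) (ps : List (Fin (n + 1) × Fin (n + 1))) (h : IsChain ps) :
    (∃ ps', IsChain ps' ∧ CommEquiv (i :: runWord ps) (runWord ps') ∧
      ∀ q ∈ ps', (i.castSucc ≤ q.1 ∨ ∃ p ∈ ps, p.1 ≤ q.1) ∧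
        (i.succ ≤ q.2 ∨ ∃ p ∈ ps, p.2 ≤ q.2)) ∨
    (∃ a b j, CommEquiv (i :: runWord ps) (a ++ j :: j :: b)) ∨
    (∃ (a b : List (Fin n)) (j k : Fin n), ((j : ℕ) + 1 = k ∨ (k : ℕ) + 1 = j) ∧
      CommEquiv (i :: runWord ps) (a ++ j :: k :: j :: b)) := by
  induction ps with
  | nil =>
    refine .inl ⟨[(i.castSucc, i.succ)], ?_, ?_, ?_⟩
    · simp [IsChain]
    · rw [runWord_cons, runWord_nil, Fin.val_castSucc, Fin.val_succ, descRun_succ le_rfl i.2,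
        descRun_eq_nil le_rfl]
      exact .refl
    · simp
  | cons p ps ih =>
    obtain ⟨⟨hp, hlt⟩, hps⟩ := isChain_cons.1 h
    obtain ⟨d, u⟩ := p
    simp only [Fin.lt_def] at hp hlt
    have hu : (u : ℕ) < n + 1 := u.2
    rw [runWord_cons]
    simp only
    rcases lt_trichotomy (u : ℕ) (i : ℕ) with hui | hui | hui
    -- All letters of the first run are at most i - 2, so s_i slides past the whole run.
    · have hc : CommEquiv (i :: (descRun n d u ++ runWord ps))
          (descRun n d u ++ i :: runWord ps) := by
        refine CommEquiv.cons_append (fun j hj => ?_) _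
        rw [mem_descRun] at hj
        omega
      rcases ih hps with ⟨ps', hps', he, hb⟩ | ⟨a, b, j, he⟩ | ⟨a, b, j, k, hjk, he⟩
      -- The lower bounds on the pairs of `ps'`, carried in the induction, are what keeps (d, u)
      -- below all of them.
      · refine .inl ⟨(d, u) :: ps', isChain_cons.2 ⟨⟨hp, fun q hq => ?_⟩, hps'⟩,
          hc.trans (he.append_left _), ?_⟩
        · obtain ⟨h1, h2⟩ := hb q hq
          simp only [Fin.lt_def, Fin.le_def, Fin.val_castSucc, Fin.val_succ] at h1 h2 ⊢
          refine ⟨?_, ?_⟩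
          · rcases h1 with h1 | ⟨p, hp', h1⟩
            · omega
            · have := hlt p hp'; omega
          · rcases h2 with h1 | ⟨p, hp', h1⟩
            · omega
            · have := hlt p hp'; omega
        · intro q hq
          rcases List.mem_cons.1 hq with rfl | hq
          · exact ⟨.inr ⟨_, List.mem_cons_self, le_rfl⟩, .inr ⟨_, List.mem_cons_self, le_rfl⟩⟩
          · obtain ⟨h1, h2⟩ := hb q hq
            refine ⟨h1.imp_right ?_, h2.imp_right ?_⟩ <;>
            exact fun ⟨p, hp, h⟩ => ⟨p, List.mem_cons_of_mem _ hp, h⟩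
      · refine .inr (.inl ⟨descRun n d u ++ a, b, j, ?_⟩)
        rw [List.append_assoc]
        exact hc.trans (he.append_left _)
      · refine .inr (.inr ⟨descRun n d u ++ a, b, j, k, hjk, ?_⟩)
        rw [List.append_assoc]
        exact hc.trans (he.append_left _)
    -- Here s_i extends the first run at its top. This breaks the chain only if the next run also
    -- starts with s_i.
    · have hrun : i :: (descRun n d u ++ runWord ps) = descRun n d (i.succ : Fin (n + 1)) ++
          runWord ps := by
        rw [Fin.val_succ, descRun_succ (by omega) i.2, hui]; rfl
      by_cases hnext : ∀ q ∈ ps, (i : ℕ) + 1 < q.2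
      · refine .inl ⟨(d, i.succ) :: ps, isChain_cons.2 ⟨⟨?_, fun q hq => ⟨?_, ?_⟩⟩, hps⟩, ?_, ?_⟩
        · simp only [Fin.lt_def, Fin.val_succ]; omega
        · exact Fin.lt_def.2 (hlt q hq).1
        · simp only [Fin.lt_def, Fin.val_succ]; exact hnext q hq
        · rw [hrun]; exact .refl
        · intro q hq
          rcases List.mem_cons.1 hq with rfl | hq
          · exact ⟨.inr ⟨_, List.mem_cons_self, le_rfl⟩, .inl le_rfl⟩
          · exact ⟨.inr ⟨q, by simp [hq], le_rfl⟩, .inr ⟨q, by simp [hq], le_rfl⟩⟩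
      · push Not at hnext
        obtain ⟨q, hq, hqi⟩ := hnext
        obtain _ | ⟨q', ps⟩ := ps
        · simp at hq
        have hq' : (q'.2 : ℕ) = i + 1 ∧ q'.1 < q'.2 := by
          have h1 := (isChain_cons.1 hps).1
          have h2 := hlt q' (by simp)
          rcases List.mem_cons.1 hq with rfl | hq
          · exact ⟨by omega, h1.1⟩
          · have := h1.2 q hq
            simp only [Fin.lt_def] at this
            exact ⟨by omega, h1.1⟩
        obtain ⟨hq2, hq1⟩ := hq'
        have h2 := hlt q' (by simp)
        rw [Fin.lt_def] at hq1
        have hi1 : (i : ℕ) - 1 < n := by omega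
        -- The s_i at the head of the next run moves left past the letters below i - 1, which
        -- produces i, i - 1, i.
        refine .inr (.inr ⟨[], descRun n d (i - 1) ++ (descRun n q'.1 i ++ runWord ps), i,
          ⟨(i : ℕ) - 1, hi1⟩, .inr (by simp only; omega), ?_⟩)
        have e1 : descRun n (d : ℕ) u = ⟨(i : ℕ) - 1, hi1⟩ :: descRun n d (i - 1) := by
          rw [← descRun_succ (by omega)]
          congr 1; omega
        have e2 : descRun n (q'.1 : ℕ) q'.2 = i :: descRun n q'.1 i := by
          rw [hq2, descRun_succ (by omega) i.2]
        rw [runWord_cons, e1, e2, List.nil_append]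
        refine CommEquiv.cons i (CommEquiv.cons _ ?_)
        refine CommEquiv.symm (CommEquiv.cons_append (fun j hj => ?_) _)
        rw [mem_descRun] at hj
        omega
    · rcases Nat.lt_or_ge ((i : ℕ) + 1) u with hui' | hui'
      · rcases Nat.lt_or_ge (i : ℕ) d with hd | hd
        · refine .inl ⟨(i.castSucc, i.succ) :: (d, u) :: ps,
            isChain_cons.2 ⟨⟨Fin.castSucc_lt_succ, ?_⟩, h⟩, ?_, ?_⟩
          · intro q hq
            simp only [Fin.lt_def, Fin.val_castSucc, Fin.val_succ]
            rcases List.mem_cons.1 hq with rfl | hq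
            · exact ⟨hd, hui'⟩
            · have := hlt q hq; omega
          · rw [runWord_cons, runWord_cons, Fin.val_castSucc, Fin.val_succ,
              descRun_succ le_rfl i.2, descRun_eq_nil le_rfl]
            exact .refl
          · intro q hq
            rcases List.mem_cons.1 hq with rfl | hq
            · exact ⟨.inl le_rfl, .inl le_rfl⟩
            · exact ⟨.inr ⟨q, hq, le_rfl⟩, .inr ⟨q, hq, le_rfl⟩⟩
        -- Now d ≤ i < u - 1: s_i slides past the letters above i + 1 and meets i + 1, i inside the
        -- run.
        · have hi1 : (i : ℕ) + 1 < n := by omega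
          refine .inr (.inr ⟨descRun n (i + 2) u, descRun n d i ++ runWord ps, i,
            ⟨(i : ℕ) + 1, hi1⟩, .inl rfl, ?_⟩)
          have e : descRun n (d : ℕ) u = descRun n (i + 2) u ++
              (⟨(i : ℕ) + 1, hi1⟩ :: i :: descRun n d i) := by
            rw [descRun_append (m := i + 2) (by omega) (by omega),
              descRun_succ (b := i + 1) (by omega) hi1, descRun_succ (by omega) i.2]
          rw [e, List.append_assoc]
          refine CommEquiv.cons_append (fun j hj => ?_) _
          rw [mem_descRun] at hj
          omega
      · refine .inr (.inl ⟨[], descRun n d i ++ runWord ps, i, ?_⟩)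
        have e : (u : ℕ) = i + 1 := by omega
        rw [e, descRun_succ (by omega) i.2]
        exact .refl

/-! ### Total excedance -/

/-- The total excedance, a lower bound for the length of any word. -/
def excedance (w : Perm (Fin (n + 1))) : ℕ := ∑ j, ((w j : ℕ) - j)

/-- Only the summand at the preimage of `v₀` can grow, because `t` raises no other point. -/
theorem excedance_mul_le (t w : Perm (Fin (n + 1))) (v₀ : Fin (n + 1)) (m : ℕ)
    (h : ∀ v, (t v : ℕ) ≤ v + if v = v₀ then m else 0) :
    excedance (t * w) ≤ excedance w + m := by
  have : ∑ j, (if j = w.symm v₀ then m else 0) = m := by simp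
  unfold excedance
  conv_rhs => rw [← this, ← Finset.sum_add_distrib]
  refine Finset.sum_le_sum fun j _ => ?_
  have := h (w j)
  rw [mul_apply]
  by_cases hj : w j = v₀
  · have : j = w.symm v₀ := by rw [← hj]; simp
    rw [if_pos hj] at *
    rw [if_pos this]; omega
  · rw [if_neg hj] at this
    omega

theorem excedance_simpleRefl_mul_le (i : Fin n) (w : Perm (Fin (n + 1))) :
    excedance (simpleRefl i * w) ≤ excedance w + 1 := by
  refine excedance_mul_le _ _ i.castSucc 1 fun v => ?_
  rw [simpleRefl_apply_val]
  simp only [Fin.ext_iff, Fin.val_castSucc]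
  split_ifs <;> omega

theorem excedance_wordProd_append_le (a : List (Fin n)) (w : Perm (Fin (n + 1))) :
    excedance (wordProd a * w) ≤ a.length + excedance w := by
  induction a with
  | nil => simp [wordProd_nil]
  | cons i a ih =>
    rw [wordProd_cons, mul_assoc, List.length_cons]
    have := excedance_simpleRefl_mul_le i (wordProd a * w)
    omega

theorem excedance_wordProd_le (a : List (Fin n)) : excedance (wordProd a) ≤ a.length := by
  have := excedance_wordProd_append_le a 1
  have h1 : excedance (1 : Perm (Fin (n + 1))) = 0 := by simp [excedance]
  rw [mul_one] at this
  omega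

/-- The product of the braid exchanges two points at distance 2, so its three letters add at most 2
to the excedance. -/
theorem excedance_braid_lt (a b : List (Fin n)) {j k : Fin n}
    (h : (j : ℕ) + 1 = k ∨ (k : ℕ) + 1 = j) :
    excedance (wordProd (a ++ j :: k :: j :: b)) < (a ++ j :: k :: j :: b).length := by
  rw [wordProd_append]
  refine (excedance_wordProd_append_le _ _).trans_lt ?_
  have : wordProd (j :: k :: j :: b) =
      (simpleRefl j * simpleRefl k * simpleRefl j) * wordProd b := by
    simp only [wordProd_cons, mul_assoc]
  rw [this]
  have h2 : excedance ((simpleRefl j * simpleRefl k * simpleRefl j) * wordProd b) ≤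
      excedance (wordProd b) + 2 := by
    refine excedance_mul_le _ _ (min j k).castSucc 2 fun v => ?_
    simp only [mul_apply, simpleRefl_apply_val, Fin.ext_iff, Fin.val_castSucc]
    have : ((min j k : Fin n) : ℕ) = min (j : ℕ) k := by
      rcases le_total j k with h | h <;> simp [h]
    rw [this]
    split_ifs <;> omega
  have h3 := excedance_wordProd_le b
  simp only [List.length_append, List.length_cons]
  omega

/-! ### Chain words as permutations: exceedances, length and uniqueness of the chain. -/

/-- The first run acts last. It sends d to u and lowers the points of (d, u] by one; the other runs
only involve letters above d, and they send their own d's above u, out of its reach. -/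
theorem wordProd_runWord_apply {ps : List (Fin (n + 1) × Fin (n + 1))} (h : IsChain ps) :
    (∀ p ∈ ps, wordProd (runWord ps) p.1 = p.2) ∧
      ∀ v, (∀ p ∈ ps, p.1 ≠ v) → wordProd (runWord ps) v ≤ v := by
  induction ps with
  | nil => simp [runWord_nil, wordProd_nil]
  | cons p ps ih =>
    obtain ⟨⟨hp, hlt⟩, hps⟩ := isChain_cons.1 h
    obtain ⟨ih1, ih2⟩ := ih hps
    have hu : (p.2 : ℕ) < n + 1 := p.2.2
    rw [Fin.lt_def] at hp
    have key := wordProd_descRun_apply (n := n) (a := p.1) (b := p.2) (by omega) (by omega)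
    have hp1 : ∀ q ∈ ps, q.1 ≠ p.1 := fun q hq => (hlt q hq).1.ne'
    have hfix : wordProd (runWord ps) p.1 = p.1 := by
      have hfixall : ∀ v : Fin (n + 1), (∀ q ∈ ps, v < q.1) → wordProd (runWord ps) v = v := by
        intro v hv
        by_contra hne
        have hmem : ∀ l : List (Fin n), (∀ i ∈ l, v < i.castSucc) → wordProd l v = v := by
          intro l
          induction l with
          | nil => simp [wordProd_nil]
          | cons i l ih =>
            intro hl
            rw [wordProd_cons, mul_apply, ih fun i hi => hl i (by simp [hi])]
            have := hl i (by simp)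
            rw [Fin.lt_def, Fin.val_castSucc] at this
            ext
            rw [simpleRefl_apply_val]
            split_ifs <;> omega
        refine hne (hmem _ fun i hi => ?_)
        simp only [runWord, List.mem_flatten, List.mem_map] at hi
        obtain ⟨_, ⟨q, hq, rfl⟩, hi⟩ := hi
        rw [mem_descRun] at hi
        have := hv q hq
        rw [Fin.lt_def] at *
        rw [Fin.val_castSucc]
        omega
      exact hfixall p.1 fun q hq => (hlt q hq).1
    refine ⟨fun q hq => ?_, fun v hv => ?_⟩
    · rw [runWord_cons, wordProd_append, mul_apply]
      ext
      rcases List.mem_cons.1 hq with rfl | hq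
      · rw [hfix, key, if_pos rfl]
      · have h1 := hlt q hq
        simp only [Fin.lt_def] at h1
        rw [ih1 q hq, key]
        split_ifs <;> omega
    · rw [runWord_cons, wordProd_append, mul_apply, Fin.le_def, key]
      have h1 := ih2 v fun q hq => hv q (List.mem_cons_of_mem _ hq)
      rw [Fin.le_def] at h1
      have h2 : wordProd (runWord ps) v ≠ p.1 := by
        rw [← hfix]
        exact fun e => hv p (by simp) ((wordProd (runWord ps)).injective e).symm
      rw [ne_eq, Fin.ext_iff] at h2
      split_ifs <;> omega

/-- The chain is the set of strict exceedances of the permutation, hence determined by it. -/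
theorem mem_chain_iff {ps : List (Fin (n + 1) × Fin (n + 1))} (h : IsChain ps)
    (p : Fin (n + 1) × Fin (n + 1)) :
    p ∈ ps ↔ p.1 < p.2 ∧ wordProd (runWord ps) p.1 = p.2 := by
  obtain ⟨h1, h2⟩ := wordProd_runWord_apply h
  refine ⟨fun hp => ⟨h.2 p hp, h1 p hp⟩, fun ⟨hp, hw⟩ => ?_⟩
  by_contra hmem
  by_cases hex : ∃ q ∈ ps, q.1 = p.1
  · obtain ⟨q, hq, e⟩ := hex
    have := h1 q hq
    rw [e, hw] at this
    exact hmem (by rw [show p = q from Prod.ext e.symm this]; exact hq)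
  · push Not at hex
    have := h2 p.1 hex
    rw [hw] at this
    exact absurd hp (not_lt.2 this)

theorem runWord_injective {ps ps' : List (Fin (n + 1) × Fin (n + 1))} (h : IsChain ps)
    (h' : IsChain ps') (e : wordProd (runWord ps) = wordProd (runWord ps')) : ps = ps' := by
  have : Std.Irrefl (fun p q : Fin (n + 1) × Fin (n + 1) => p.1 < q.1 ∧ p.2 < q.2) :=
    ⟨fun p hp => lt_irrefl _ hp.1⟩
  have : Std.Antisymm (fun p q : Fin (n + 1) × Fin (n + 1) => p.1 < q.1 ∧ p.2 < q.2) :=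
    ⟨fun p q hp hq => absurd hp.1 (not_lt.2 hq.1.le)⟩
  refine eq_of_pairwise_of_mem_iff h.1 h'.1 fun p => ?_
  rw [mem_chain_iff h, mem_chain_iff h', e]

theorem length_runWord {ps : List (Fin (n + 1) × Fin (n + 1))} (h : IsChain ps) :
    (runWord ps).length = (ps.map fun p => (p.2 : ℕ) - p.1).sum := by
  rw [runWord, List.length_flatten, List.map_map]
  congr 1
  refine List.map_congr_left fun p hp => ?_
  have := h.2 p hp
  rw [Fin.lt_def] at this
  exact length_descRun (by omega) (by omega)

/-- The length is the sum of the differences u - d, and these already occur as summands of the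
excedance at the points d. -/
theorem excedance_runWord {ps : List (Fin (n + 1) × Fin (n + 1))} (h : IsChain ps) :
    excedance (wordProd (runWord ps)) = (runWord ps).length := by
  refine le_antisymm (excedance_wordProd_le _) ?_
  have hnd : (ps.map Prod.fst).Nodup :=
    List.pairwise_map.2 (h.1.imp fun {a b} hab => hab.1.ne)
  have h1 : (runWord ps).length =
      ((ps.map Prod.fst).map fun j => (wordProd (runWord ps) j : ℕ) - j).sum := by
    rw [length_runWord h, List.map_map]
    congr 1
    refine List.map_congr_left fun p hp => ?_
    simp [(wordProd_runWord_apply h).1 p hp]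
  rw [h1, ← List.sum_toFinset _ hnd]
  exact Finset.sum_le_sum_of_subset (Finset.subset_univ _)

theorem isReducedWord_of_excedance {l : List (Fin n)} (h : excedance (wordProd l) = l.length) :
    IsReducedWord (wordProd l) l :=
  ⟨rfl, fun l' hl' => by rw [← h, ← hl']; exact excedance_wordProd_le l'⟩

theorem wordProd_cancel (a b : List (Fin n)) (j : Fin n) :
    wordProd (a ++ j :: j :: b) = wordProd (a ++ b) := by
  simp only [wordProd_append, wordProd_cons]
  rw [← mul_assoc (simpleRefl j), simpleRefl_mul_self, one_mul]

/-- The tail of such a word is again as long as its excedance. A repeated letter or a braid cannot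
appear, since either would push the excedance strictly below the length. -/
theorem exists_chain_of_excedance (l : List (Fin n)) (h : excedance (wordProd l) = l.length) :
    ∃ ps, IsChain ps ∧ CommEquiv l (runWord ps) := by
  induction l with
  | nil => exact ⟨[], by simp [IsChain], .refl⟩
  | cons i l ih =>
    have h1 := excedance_simpleRefl_mul_le i (wordProd l)
    have h2 := excedance_wordProd_le l
    rw [← wordProd_cons, h, List.length_cons] at h1
    obtain ⟨ps, hps, he⟩ := ih (by omega)
    have he' := he.cons i
    rcases cons_runWord_cases i ps hps with ⟨ps', hps', hc, -⟩ | ⟨a, b, j, hc⟩ |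
      ⟨a, b, j, k, hjk, hc⟩
    · exact ⟨ps', hps', he'.trans hc⟩
    · have hc : CommEquiv _ _ := he'.trans hc
      have hl := hc.perm.length_eq
      rw [hc.wordProd_eq, wordProd_cancel, hl] at h
      have := excedance_wordProd_le (a ++ b)
      simp only [List.length_append, List.length_cons] at h this
      omega
    · have hc : CommEquiv _ _ := he'.trans hc
      have hl := hc.perm.length_eq
      have := excedance_braid_lt a b hjk
      rw [← hc.wordProd_eq, h, hl] at this
      exact absurd this (lt_irrefl _)

/-! ### The fully commutative permutations are the products of chain words. -/

/-- Every reduced word attains the excedance bound, so it is equivalent to some chain word, and the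
permutation determines the chain. -/
theorem runWord_mem_FC {ps : List (Fin (n + 1) × Fin (n + 1))} (h : IsChain ps) :
    wordProd (runWord ps) ∈ FC n := by
  have key : ∀ l, IsReducedWord (wordProd (runWord ps)) l → CommEquiv l (runWord ps) := by
    intro l hl
    have h2 : l.length ≤ (runWord ps).length := hl.2 (runWord ps) rfl
    have h1 : excedance (wordProd l) = l.length := by
      refine le_antisymm (excedance_wordProd_le l) (h2.trans ?_)
      rw [hl.1, excedance_runWord h]
    obtain ⟨ps', hps', he⟩ := exists_chain_of_excedance l h1
    have := runWord_injective h hps' (by rw [← he.wordProd_eq, hl.1])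
    rwa [this]
  exact fun l l' hl hl' => (key l hl).trans (key l' hl').symm

theorem IsReducedWord.of_commEquiv {w : Perm (Fin (n + 1))} {l l' : List (Fin n)}
    (h : IsReducedWord w l) (he : CommEquiv l l') : IsReducedWord w l' :=
  ⟨he.wordProd_eq ▸ h.1, fun m hm => he.perm.length_eq ▸ h.2 m hm⟩

theorem simpleRefl_braid {j k : Fin n} (h : (j : ℕ) + 1 = k) :
    simpleRefl j * (simpleRefl k * simpleRefl j) =
      simpleRefl k * (simpleRefl j * simpleRefl k) := by
  ext v
  have e1 : (j : ℕ) + 1 + 1 ≠ j := by omega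
  have e2 := e1.symm
  by_cases h1 : (v : ℕ) = j
  · simp [simpleRefl_apply_val, ← h, h1, e1, e2]
  by_cases h2 : (v : ℕ) = j + 1
  · simp [simpleRefl_apply_val, ← h, h2, e1, e2]
  by_cases h3 : (v : ℕ) = j + 1 + 1
  · simp [simpleRefl_apply_val, ← h, h3, e1, e2]
  simp [simpleRefl_apply_val, ← h, h1, h2, h3]

theorem wordProd_braid (a b : List (Fin n)) {j k : Fin n}
    (h : (j : ℕ) + 1 = k ∨ (k : ℕ) + 1 = j) :
    wordProd (a ++ j :: k :: j :: b) = wordProd (a ++ k :: j :: k :: b) := by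
  simp only [wordProd_append, wordProd_cons]
  congr 1
  have : simpleRefl j * (simpleRefl k * simpleRefl j) =
      simpleRefl k * (simpleRefl j * simpleRefl k) :=
    h.elim simpleRefl_braid fun h => (simpleRefl_braid h).symm
  simp only [← mul_assoc] at this ⊢
  rw [this]

theorem exists_chain_of_mem_FC (l : List (Fin n)) (hw : wordProd l ∈ FC n)
    (hl : IsReducedWord (wordProd l) l) : ∃ ps, IsChain ps ∧ CommEquiv l (runWord ps) := by
  induction l with
  | nil => exact ⟨[], by simp [IsChain], .refl⟩
  | cons i l ih =>
    have hred : ∀ m, IsReducedWord (wordProd l) m → IsReducedWord (wordProd (i :: l)) (i :: m) := by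
      intro m hm
      refine ⟨by rw [wordProd_cons, wordProd_cons, hm.1], fun l' hl' => ?_⟩
      have h1 := hm.2 l rfl
      have h2 := hl.2 l' hl'
      simp only [List.length_cons] at *
      omega
    have hl1 : IsReducedWord (wordProd l) l := by
      refine ⟨rfl, fun l' hl' => ?_⟩
      have := hl.2 (i :: l') (by rw [wordProd_cons, wordProd_cons, hl'])
      simp only [List.length_cons] at this
      omega
    obtain ⟨ps, hps, he⟩ := ih (fun m m' hm hm' =>
      CommEquiv.of_cons (hw _ _ (hred m hm) (hred m' hm'))) hl1
    have he' := he.cons i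
    rcases cons_runWord_cases i ps hps with ⟨ps', hps', hc, -⟩ | ⟨a, b, j, hc⟩ |
      ⟨a, b, j, k, hjk, hc⟩
    · exact ⟨ps', hps', he'.trans hc⟩
    · have hr := hl.of_commEquiv (he'.trans hc)
      have := hr.2 (a ++ b) (by rw [← wordProd_cancel a b j, hr.1])
      simp only [List.length_append, List.length_cons] at this
      omega
    · have hr := hl.of_commEquiv (he'.trans hc)
      have hr' : IsReducedWord (wordProd (i :: l)) (a ++ k :: j :: k :: b) := by
        refine ⟨by rw [← wordProd_braid a b hjk, hr.1], fun m hm => ?_⟩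
        have := hr.2 m hm
        simpa using this
      -- The braid move yields a second reduced word with one letter j fewer, while commutations
      -- preserve the number of j's.
      have hperm := CommEquiv.perm (hw _ _ hr hr')
      have hjk' : j ≠ k := by rintro rfl; omega
      have := hperm.count_eq j
      simp [List.count_append, hjk'.symm] at this

theorem exists_reducedWord (w : Perm (Fin (n + 1))) (hw : ∃ l, wordProd l = w) :
    ∃ l, IsReducedWord w l := by
  classical
  have hex : ∃ k, ∃ l : List (Fin n), wordProd l = w ∧ l.length = k :=
    hw.elim fun l hl => ⟨_, l, hl, rfl⟩
  obtain ⟨l, hl, hk⟩ := Nat.find_spec hex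
  exact ⟨l, hl, fun l' hl' => hk ▸ Nat.find_min' hex ⟨l', hl', rfl⟩⟩

theorem exists_wordProd_eq (w : Perm (Fin (n + 1))) : ∃ l : List (Fin n), wordProd l = w := by
  have hw : w ∈ Submonoid.closure (Set.range fun i : Fin n => swap i.castSucc i.succ) := by
    rw [Equiv.Perm.mclosure_swap_castSucc_succ]; trivial
  induction hw using Submonoid.closure_induction with
  | mem x hx =>
    obtain ⟨i, rfl⟩ := hx
    exact ⟨[i], by simp [wordProd, simpleRefl]⟩
  | one => exact ⟨[], rfl⟩
  | mul x y _ _ hx hy =>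
    obtain ⟨a, rfl⟩ := hx
    obtain ⟨b, rfl⟩ := hy
    exact ⟨a ++ b, wordProd_append a b⟩

theorem mem_FC_iff (w : Perm (Fin (n + 1))) :
    w ∈ FC n ↔ ∃ ps, IsChain ps ∧ wordProd (runWord ps) = w := by
  constructor
  · intro hw
    obtain ⟨l, hl⟩ := exists_reducedWord w (exists_wordProd_eq w)
    obtain ⟨rfl, -⟩ := id hl
    obtain ⟨ps, hps, he⟩ := exists_chain_of_mem_FC l hw hl
    exact ⟨ps, hps, he.wordProd_eq.symm⟩
  · rintro ⟨ps, hps, rfl⟩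
    exact runWord_mem_FC hps

/-! ### Normal forms -/

theorem isChain_zip_iff {a b : List (Fin (n + 1))} (h : a.length = b.length) :
    IsChain (a.zip b) ↔ a.Pairwise (· < ·) ∧ b.Pairwise (· < ·) ∧ List.Forall₂ (· < ·) a b := by
  constructor
  · intro hc
    have ha : (a.zip b).map Prod.fst = a := List.map_fst_zip h.le
    have hb : (a.zip b).map Prod.snd = b := List.map_snd_zip h.ge
    refine ⟨?_, ?_, List.forall₂_iff_zip.2 ⟨h, fun hab => hc.2 _ hab⟩⟩
    · rw [← ha, List.pairwise_map]; exact hc.1.imp fun h => h.1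
    · rw [← hb, List.pairwise_map]; exact hc.1.imp fun h => h.2
  · rintro ⟨ha, hb, hab⟩
    refine ⟨?_, fun p hp => List.forall₂_zip hab (a := p.1) (b := p.2) hp⟩
    clear hab
    induction a generalizing b with
    | nil => simp
    | cons x a ih =>
      obtain _ | ⟨y, b⟩ := b
      · simp
      rw [List.zip_cons_cons, List.pairwise_cons]
      rw [List.pairwise_cons] at ha hb
      refine ⟨fun q hq => ?_, ih (by simpa using h) ha.2 hb.2⟩
      have := List.of_mem_zip (a := q.1) (b := q.2) hq
      exact ⟨ha.1 _ this.1, hb.1 _ this.2⟩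

theorem runWord_zip (a b : List (Fin (n + 1))) :
    runWord (a.zip b) =
      (List.zipWith (fun d u : Fin (n + 1) => descRun n (d : ℕ) (u : ℕ)) a b).flatten := by
  rw [runWord, List.zip, List.map_zipWith]

/-- The factor from i down to j is the run of the pair (j, i + 1). Reducedness comes for free, as
chain words attain the excedance bound. -/
theorem isNormalForm_iff {w : Perm (Fin (n + 1))} {is js : List (Fin n)} :
    IsNormalForm w is js ↔ js.length = is.length ∧
      IsChain ((js.map Fin.castSucc).zip (is.map Fin.succ)) ∧
      wordProd (runWord ((js.map Fin.castSucc).zip (is.map Fin.succ))) = w := by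
  have hw : (List.zipWith (fun i j : Fin n => descRun n (j : ℕ) ((i : ℕ) + 1)) is js).flatten =
      runWord ((js.map Fin.castSucc).zip (is.map Fin.succ)) := by
    rw [runWord_zip, List.zipWith_map, List.zipWith_comm]
    rfl
  have hle : List.Forall₂ (fun j i : Fin n => j ≤ i) js is ↔
      List.Forall₂ (· < ·) (js.map Fin.castSucc) (is.map Fin.succ) := by
    rw [List.forall₂_map_left_iff, List.forall₂_map_right_iff]
    simp only [Fin.castSucc_lt_succ_iff]
  have hp : ∀ hl : js.length = is.length,
      IsChain ((js.map Fin.castSucc).zip (is.map Fin.succ)) ↔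
      js.Pairwise (· < ·) ∧ is.Pairwise (· < ·) ∧
        List.Forall₂ (fun j i : Fin n => j ≤ i) js is := by
    intro hl
    rw [isChain_zip_iff (by simpa using hl), ← hle, List.pairwise_map, List.pairwise_map]
    simp only [Fin.castSucc_lt_castSucc_iff, Fin.succ_lt_succ_iff]
  constructor
  · rintro ⟨h1, h2, h3, h4⟩
    rw [hw] at h4
    exact ⟨h3.length_eq, (hp h3.length_eq).2 ⟨h2, h1, h3⟩, h4.1⟩
  · rintro ⟨hl, hc, rfl⟩
    obtain ⟨h2, h1, h3⟩ := (hp hl).1 hc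
    refine ⟨h1, h2, h3, ?_⟩
    rw [hw]
    exact isReducedWord_of_excedance (excedance_runWord hc)

theorem IsChain.exists_lists {ps : List (Fin (n + 1) × Fin (n + 1))} (h : IsChain ps) :
    ∃ is js : List (Fin n), js.length = is.length ∧
      (js.map Fin.castSucc).zip (is.map Fin.succ) = ps := by
  induction ps with
  | nil => exact ⟨[], [], rfl, rfl⟩
  | cons p ps ih =>
    obtain ⟨⟨hp, -⟩, hps⟩ := isChain_cons.1 h
    obtain ⟨is, js, hl, e⟩ := ih hps
    obtain ⟨j, hj⟩ := Fin.exists_castSucc_eq.2 (hp.trans_le (Fin.le_last _)).ne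
    obtain ⟨i, hi⟩ := Fin.exists_succ_eq.2 ((Fin.zero_le _).trans_lt hp).ne'
    exact ⟨i :: is, j :: js, by simp [hl], by simp [hi, hj, e]⟩

/-- The chain of pairs matching two sets in increasing order. -/
def chainOf (p : Finset (Fin (n + 1)) × Finset (Fin (n + 1))) :
    List (Fin (n + 1) × Fin (n + 1)) :=
  p.1.sort.zip p.2.sort

theorem g_eq (p : Finset (Fin (n + 1)) × Finset (Fin (n + 1))) :
    g p = wordProd (runWord (chainOf p)) := by
  rw [chainOf, runWord_zip, g]

theorem isChain_chainOf {p : Finset (Fin (n + 1)) × Finset (Fin (n + 1))} (h : p ∈ seqPairs n) :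
    IsChain (chainOf p) :=
  (isChain_zip_iff (List.Forall₂.length_eq h)).2
    ⟨(Finset.sortedLT_sort _).pairwise, (Finset.sortedLT_sort _).pairwise, h⟩

theorem map_fst_chainOf {p : Finset (Fin (n + 1)) × Finset (Fin (n + 1))} (h : p ∈ seqPairs n) :
    (chainOf p).map Prod.fst = p.1.sort :=
  List.map_fst_zip (List.Forall₂.length_eq h).le

theorem map_snd_chainOf {p : Finset (Fin (n + 1)) × Finset (Fin (n + 1))} (h : p ∈ seqPairs n) :
    (chainOf p).map Prod.snd = p.2.sort :=
  List.map_snd_zip (List.Forall₂.length_eq h).ge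

theorem exists_chainOf_eq {ps : List (Fin (n + 1) × Fin (n + 1))} (h : IsChain ps) :
    ∃ p ∈ seqPairs n, chainOf p = ps := by
  have key : ∀ l : List (Fin (n + 1)), l.Pairwise (· < ·) → l.toFinset.sort = l := by
    intro l hl
    refine eq_of_pairwise_of_mem_iff (Finset.sortedLT_sort _).pairwise hl fun a => ?_
    simp
  have h1 := key (ps.map Prod.fst) (List.pairwise_map.2 (h.1.imp fun h => h.1))
  have h2 := key (ps.map Prod.snd) (List.pairwise_map.2 (h.1.imp fun h => h.2))
  refine ⟨((ps.map Prod.fst).toFinset, (ps.map Prod.snd).toFinset), ?_, ?_⟩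
  · simp only [seqPairs, Set.mem_ofPred_eq, h1, h2]
    rw [List.forall₂_map_left_iff, List.forall₂_map_right_iff, List.forall₂_same]
    exact h.2
  · simp only [chainOf, h1, h2]
    rw [List.zip_map', List.map_id'']
    intro p; rfl

theorem bijOn_g : Set.BijOn (g (n := n)) (seqPairs n) (FC n) := by
  refine ⟨fun p hp => ?_, fun p hp q hq e => ?_, fun w hw => ?_⟩
  · rw [g_eq]; exact runWord_mem_FC (isChain_chainOf hp)
  · rw [g_eq, g_eq] at e
    have e' := runWord_injective (isChain_chainOf hp) (isChain_chainOf hq) e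
    have h1 : p.1.sort = q.1.sort := by rw [← map_fst_chainOf hp, e', map_fst_chainOf hq]
    have h2 : p.2.sort = q.2.sort := by rw [← map_snd_chainOf hp, e', map_snd_chainOf hq]
    refine Prod.ext ?_ ?_
    · rw [← Finset.sort_toFinset p.1 (· ≤ ·), h1, Finset.sort_toFinset]
    · rw [← Finset.sort_toFinset p.2 (· ≤ ·), h2, Finset.sort_toFinset]
  · obtain ⟨ps, hps, rfl⟩ := (mem_FC_iff w).1 hw
    obtain ⟨p, hp, rfl⟩ := exists_chainOf_eq hps
    exact ⟨p, hp, g_eq p⟩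

theorem isNormalForm_g_iff {p : Finset (Fin (n + 1)) × Finset (Fin (n + 1))}
    (h : p ∈ seqPairs n) {is js : List (Fin n)} :
    IsNormalForm (g p) is js ↔ js.map Fin.castSucc = p.1.sort ∧ is.map Fin.succ = p.2.sort := by
  rw [isNormalForm_iff]
  constructor
  · rintro ⟨hl, hc, e⟩
    rw [g_eq] at e
    have e' := runWord_injective hc (isChain_chainOf h) e
    rw [← map_fst_chainOf h, ← map_snd_chainOf h, ← e', List.map_fst_zip (by simp [hl]),
      List.map_snd_zip (by simp [hl])]
    exact ⟨rfl, rfl⟩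
  · rintro ⟨h1, h2⟩
    have hl := List.Forall₂.length_eq h
    rw [← h1, ← h2] at hl
    refine ⟨by simpa using hl, ?_, ?_⟩
    · rw [h1, h2]; exact isChain_chainOf h
    · rw [h1, h2, g_eq]; rfl

theorem existsUnique_normalForm {p : Finset (Fin (n + 1)) × Finset (Fin (n + 1))}
    (h : p ∈ seqPairs n) :
    ∃! q : List (Fin n) × List (Fin n), IsNormalForm (g p) q.1 q.2 := by
  obtain ⟨is, js, hl, e⟩ := (isChain_chainOf h).exists_lists
  refine ⟨(is, js), ?_, ?_⟩
  · refine (isNormalForm_g_iff h).2 ?_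
    rw [← map_fst_chainOf h, ← map_snd_chainOf h, ← e, List.map_fst_zip (by simp [hl]),
      List.map_snd_zip (by simp [hl])]
    exact ⟨rfl, rfl⟩
  · intro q hq
    obtain ⟨h1, h2⟩ := (isNormalForm_g_iff h).1 hq
    have h3 : js.map Fin.castSucc = p.1.sort := by
      rw [← map_fst_chainOf h, ← e, List.map_fst_zip (by simp [hl])]
    have h4 : is.map Fin.succ = p.2.sort := by
      rw [← map_snd_chainOf h, ← e, List.map_snd_zip (by simp [hl])]
    refine Prod.ext ?_ ?_
    · exact List.map_injective_iff.2 (Fin.succ_injective n) (h2.trans h4.symm)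
    · exact List.map_injective_iff.2 (Fin.castSucc_injective n) (h1.trans h3.symm)

theorem exists_mem_J_g_iff {p : Finset (Fin (n + 1)) × Finset (Fin (n + 1))}
    (h : p ∈ seqPairs n) (k : Fin (n + 1)) :
    (∃ j ∈ J (g p), j.castSucc = k) ↔ k ∈ p.1 := by
  obtain ⟨⟨is, js⟩, hq, -⟩ := existsUnique_normalForm h
  rw [← Finset.mem_sort (s := p.1) (· ≤ ·), ← ((isNormalForm_g_iff h).1 hq).1, List.mem_map]
  constructor
  · rintro ⟨j, ⟨is', js', h', hj⟩, rfl⟩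
    refine ⟨j, ?_, rfl⟩
    have := ((isNormalForm_g_iff h).1 hq).1.trans ((isNormalForm_g_iff h).1 h').1.symm
    rwa [List.map_injective_iff.2 (Fin.castSucc_injective n) this]
  · rintro ⟨j, hj, rfl⟩
    exact ⟨j, ⟨is, js, hq, hj⟩, rfl⟩

theorem exists_mem_I_g_iff {p : Finset (Fin (n + 1)) × Finset (Fin (n + 1))}
    (h : p ∈ seqPairs n) (k : Fin (n + 1)) :
    (∃ i ∈ I (g p), i.succ = k) ↔ k ∈ p.2 := by
  obtain ⟨⟨is, js⟩, hq, -⟩ := existsUnique_normalForm h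
  rw [← Finset.mem_sort (s := p.2) (· ≤ ·), ← ((isNormalForm_g_iff h).1 hq).2, List.mem_map]
  constructor
  · rintro ⟨i, ⟨is', js', h', hi⟩, rfl⟩
    refine ⟨i, ?_, rfl⟩
    have := ((isNormalForm_g_iff h).1 hq).2.trans ((isNormalForm_g_iff h).1 h').2.symm
    rwa [List.map_injective_iff.2 (Fin.succ_injective n) this]
  · rintro ⟨i, hi, rfl⟩
    exact ⟨i, ⟨is, js, hq, hi⟩, rfl⟩

/-! ### Counting criterion for membership in `seqPairs` -/

/-- A ballot condition replaces the matching of sorted lists, so that elements can be erased without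
tracking indices. -/
theorem mem_seqPairs_iff_card (p : Finset (Fin (n + 1)) × Finset (Fin (n + 1))) :
    p ∈ seqPairs n ↔ p.1.card = p.2.card ∧
      ∀ t, (p.2.filter (· ≤ t)).card ≤ (p.1.filter (· < t)).card := by
  have key : ∀ a b : List (Fin (n + 1)), a.Pairwise (· < ·) → b.Pairwise (· < ·) →
      (List.Forall₂ (· < ·) a b ↔ a.length = b.length ∧
        ∀ t, (b.filter (· ≤ t)).length ≤ (a.filter (· < t)).length) := by
    intro a b ha hb
    induction a generalizing b with
    | nil =>
      constructor
      · intro h; obtain rfl := List.forall₂_nil_left_iff.1 h; simp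
      · rintro ⟨h, -⟩; obtain rfl := List.length_eq_zero_iff.1 h.symm; exact .nil
    | cons x a ih =>
      obtain _ | ⟨y, b⟩ := b
      · simp
      rw [List.pairwise_cons] at ha hb
      rw [List.forall₂_cons, ih b ha.2 hb.2]
      constructor
      · rintro ⟨hxy, hl, h⟩
        refine ⟨by simp [hl], fun t => ?_⟩
        have := h t
        by_cases hyt : y ≤ t
        · rw [List.filter_cons_of_pos (by simpa using hyt),
            List.filter_cons_of_pos (by simpa using hxy.trans_le hyt)]
          simpa using this
        · have : (y :: b).filter (· ≤ t) = [] := by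
            rw [List.filter_eq_nil_iff]
            intro z hz
            rcases List.mem_cons.1 hz with rfl | hz
            · simpa using hyt
            · have := hb.1 z hz
              simp only [decide_eq_true_eq]
              exact fun h => hyt (this.le.trans h)
          simp [this]
      · rintro ⟨hl, h⟩
        -- At the threshold y, the element y is counted on the right, so some element of the left
        -- list, and then its least element x, lies below y.
        have hxy : x < y := by
          by_contra hxy
          have h1 := h y
          have : (x :: a).filter (· < y) = [] := by
            rw [List.filter_eq_nil_iff]
            intro z hz
            rcases List.mem_cons.1 hz with rfl | hz
            · simpa using hxy
            · have := ha.1 z hz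
              simp only [decide_eq_true_eq]
              exact fun h => hxy (this.trans h)
          rw [this] at h1
          simp at h1
        refine ⟨hxy, by simpa using hl, fun t => ?_⟩
        by_cases hyt : y ≤ t
        · have := h t
          rw [List.filter_cons_of_pos (by simpa using hyt),
            List.filter_cons_of_pos (by simpa using hxy.trans_le hyt)] at this
          simpa using this
        · have : b.filter (· ≤ t) = [] := by
            rw [List.filter_eq_nil_iff]
            intro z hz
            have := hb.1 z hz
            simp only [decide_eq_true_eq]
            exact fun h => hyt (this.le.trans h)
          simp [this]
  have hc : ∀ (s : Finset (Fin (n + 1))) (P : Fin (n + 1) → Prop) [DecidablePred P],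
      (s.filter P).card = (s.sort.filter P).length := by
    intro s P _
    have : s.filter P = (s.sort.filter P).toFinset := by ext; simp
    rw [this]
    exact List.toFinset_card_of_nodup ((Finset.sort_nodup s (· ≤ ·)).filter _)
  have := key p.1.sort p.2.sort (Finset.sortedLT_sort _).pairwise
    (Finset.sortedLT_sort _).pairwise
  simp only [seqPairs, Set.mem_ofPred_eq, this, Finset.length_sort, hc]

/-- For thresholds at or above u both counts drop by one, and below u there is nothing of U to
count. The element d need not be the least of D, which leaves the circle free to choose it. -/
theorem mem_seqPairs_erase_iff {D U : Finset (Fin (n + 1))} {d u : Fin (n + 1)} (hd : d ∈ D)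
    (hu : u ∈ U) (hdu : d < u) (hmin : ∀ v ∈ U, u ≤ v) :
    (D, U) ∈ seqPairs n ↔ (D.erase d, U.erase u) ∈ seqPairs n := by
  rw [mem_seqPairs_iff_card, mem_seqPairs_iff_card]
  simp only
  have h1 := Finset.card_erase_add_one hd
  have h2 := Finset.card_erase_add_one hu
  refine and_congr (by omega) (forall_congr' fun t => ?_)
  by_cases ht : u ≤ t
  · have h3 : d ∈ D.filter (· < t) := Finset.mem_filter.2 ⟨hd, hdu.trans_le ht⟩
    have h4 : u ∈ U.filter (· ≤ t) := Finset.mem_filter.2 ⟨hu, ht⟩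
    have h5 := Finset.card_erase_add_one h3
    have h6 := Finset.card_erase_add_one h4
    rw [← Finset.filter_erase] at h5 h6
    omega
  · have : U.filter (· ≤ t) = ∅ :=
      Finset.filter_false_of_mem fun v hv h => ht ((hmin v hv).trans h)
    have h' : (U.erase u).filter (· ≤ t) = ∅ :=
      Finset.filter_false_of_mem fun v hv h => ht ((hmin v (Finset.mem_of_mem_erase hv)).trans h)
    simp [this, h']

theorem mem_seqPairs_empty {D : Finset (Fin (n + 1))} : (D, ∅) ∈ seqPairs n ↔ D = ∅ := by
  rw [mem_seqPairs_iff_card]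
  simp

theorem exists_lt_of_mem_seqPairs {D U : Finset (Fin (n + 1))} (h : (D, U) ∈ seqPairs n)
    {u : Fin (n + 1)} (hu : u ∈ U) : ∃ d ∈ D, d < u := by
  have h1 := ((mem_seqPairs_iff_card _).1 h).2 u
  have h2 : 0 < (U.filter (· ≤ u)).card :=
    Finset.card_pos.2 ⟨u, Finset.mem_filter.2 ⟨hu, le_rfl⟩⟩
  obtain ⟨d, hd⟩ := Finset.card_pos.1 (h2.trans_le h1)
  exact ⟨d, (Finset.mem_filter.1 hd).1, (Finset.mem_filter.1 hd).2⟩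

/-! ### Arcs and noncrossing permutations on a labelled circle -/

/-- `t` gives the positions of the points on the circle run through by `c`, starting from `0`. -/
structure IsCircular (c : Perm (Fin (n + 1))) (t : Fin (n + 1) → ℕ) : Prop where
  injective : Function.Injective t
  zero : t 0 = 0
  le : ∀ a, t a ≤ n
  step : ∀ a, t (c a) = if t a = n then 0 else t a + 1

/-- `b` lies strictly between `a` and `q` when moving clockwise from `a` to `q`; for `a = q` this
is the whole circle without `a`. -/
def InArc (t : Fin (n + 1) → ℕ) (a b q : Fin (n + 1)) : Prop :=
  (t a < t b ∧ t b < t q) ∨ (t b < t q ∧ t q ≤ t a) ∨ (t q ≤ t a ∧ t a < t b)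

/-- Every open arc from a point to its image is invariant. -/
def NonCrossing (t : Fin (n + 1) → ℕ) (x : Perm (Fin (n + 1))) : Prop :=
  ∀ a b, InArc t a b (x a) → InArc t a (x b) (x a)

theorem NonCrossing.sameCycle {t : Fin (n + 1) → ℕ} {x : Perm (Fin (n + 1))}
    (h : NonCrossing t x) {a b b' : Fin (n + 1)} (hb : InArc t a b (x a))
    (hs : SameCycle x b b') : InArc t a b' (x a) := by
  obtain ⟨k, rfl⟩ := hs.exists_nat_pow_eq
  induction k with
  | zero => exact hb
  | succ k ih =>
    rw [pow_succ', mul_apply]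
    exact h _ _ (ih ⟨k, by simp⟩)

/-- The definition therefore also forces cycles to run clockwise: a point of the cycle inside the
arc would drag `a` itself into its own open arc. -/
theorem NonCrossing.not_inArc {t : Fin (n + 1) → ℕ} {x : Perm (Fin (n + 1))}
    (h : NonCrossing t x) {a b : Fin (n + 1)} (hs : SameCycle x a b) : ¬ InArc t a b (x a) := by
  intro hb
  have := h.sameCycle hb hs.symm
  unfold InArc at this
  omega

theorem nonCrossing_of_isCircular {c : Perm (Fin (n + 1))} {t : Fin (n + 1) → ℕ}
    (h : IsCircular c t) : NonCrossing t c := by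
  intro a b hab
  exfalso
  have h1 := h.step a
  have h2 := h.le b
  have h3 := h.le a
  unfold InArc at hab
  split_ifs at h1 <;> omega

/-- Inverting the permutation while reversing the circle is the symmetry that lets later arguments
treat only one side of the circle. -/
theorem NonCrossing.inv {t : Fin (n + 1) → ℕ} (ht : ∀ a, t a ≤ n) {x : Perm (Fin (n + 1))}
    (h : NonCrossing t x) : NonCrossing (fun a => n - t a) x⁻¹ := by
  have key : ∀ a b q, InArc (fun a => n - t a) a b q ↔ InArc t q b a := by
    intro a b q
    have := ht a; have := ht b; have := ht q
    simp only [InArc]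
    omega
  intro a b hab
  rw [key] at hab ⊢
  have := h.sameCycle (a := x⁻¹ a) (b := b) (b' := x⁻¹ b) (by simpa using hab)
    (by simpa using SameCycle.refl x b)
  simpa using this

/-- This handles the new edge from `a` to `x b` of the split cycle. The other new edge follows by
exchanging `a` and `b`. -/
theorem NonCrossing.mul_swap_aux {t : Fin (n + 1) → ℕ} (ht : Function.Injective t)
    {x : Perm (Fin (n + 1))} (h : NonCrossing t x) {a b : Fin (n + 1)} (hab : a ≠ b)
    (hs : SameCycle x a b) (q : Fin (n + 1)) (hq : InArc t a q (x b)) :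
    InArc t a ((x * swap a b) q) (x b) := by
  have hne : ∀ {p q : Fin (n + 1)}, p ≠ q → t p ≠ t q := fun h e => h (ht e)
  have e1 := h.not_inArc (a := a) (b := x b) (sameCycle_apply_right.2 hs)
  have n1 := hne hab
  have n2 := hne (x.injective.ne hab)
  have n3 : t (x a) ≠ t a := hne fun e => hab (hs.eq_of_left e)
  by_cases hqa : q = a
  · subst hqa
    unfold InArc at hq
    omega
  by_cases hqb : q = b
  · subst hqb
    rw [mul_apply, swap_apply_right]
    unfold InArc at *
    omega
  rw [mul_apply, swap_apply_of_ne_of_ne hqa hqb]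
  have n4 := hne hqa
  have n5 := hne hqb
  have n7 := hne (x.injective.ne hqb)
  have e3 := h b q
  have e2 := h.not_inArc (a := b) (b := a) hs.symm
  have e4 : InArc t q b (x q) → InArc t q a (x q) ∧ InArc t q (x b) (x q) := fun hb =>
    ⟨h.sameCycle hb hs.symm, h _ _ hb⟩
  unfold InArc at *
  omega

/-- Splitting a cycle of a noncrossing permutation leaves it noncrossing. -/
theorem NonCrossing.mul_swap {t : Fin (n + 1) → ℕ} (ht : Function.Injective t)
    {x : Perm (Fin (n + 1))} (h : NonCrossing t x) {a b : Fin (n + 1)} (hab : a ≠ b)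
    (hs : SameCycle x a b) : NonCrossing t (x * swap a b) := by
  intro p q hpq
  by_cases hpa : p = a
  · subst hpa
    have hp : (x * swap p b) p = x b := by rw [mul_apply, swap_apply_left]
    rw [hp] at hpq ⊢
    exact h.mul_swap_aux ht hab hs q hpq
  by_cases hpb : p = b
  · subst hpb
    have hp : (x * swap a p) p = x a := by rw [mul_apply, swap_apply_right]
    rw [hp] at hpq ⊢
    rw [swap_comm]
    exact h.mul_swap_aux ht hab.symm hs.symm q hpq
  have hp : (x * swap a b) p = x p := by rw [mul_apply, swap_apply_of_ne_of_ne hpa hpb]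
  rw [hp] at hpq ⊢
  refine h.sameCycle hpq ?_
  rw [mul_apply, sameCycle_apply_right]
  by_cases hqa : q = a
  · subst hqa; rwa [swap_apply_left]
  by_cases hqb : q = b
  · subst hqb; rw [swap_apply_right]; exact hs.symm
  rw [swap_apply_of_ne_of_ne hqa hqb]

set_option maxHeartbeats 1000000 in
/-- Merging the cycle of `a` with the cycle of a point `q` which is visible from `a` along the
circle leaves a noncrossing permutation noncrossing. -/
theorem NonCrossing.swap_mul {t : Fin (n + 1) → ℕ} (ht : Function.Injective t)
    {x : Perm (Fin (n + 1))} (h : NonCrossing t x) {a q : Fin (n + 1)} (haq : a ≠ q)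
    (hfix : ∀ v, InArc t a v q → x v = v) (hxa : x a ≠ q) :
    NonCrossing t (swap (x a) q * x) := by
  have hne : ∀ {p q : Fin (n + 1)}, p ≠ q → t p ≠ t q := fun h e => h (ht e)
  obtain ⟨p, rfl⟩ := x.surjective q
  have hap : a ≠ p := fun e => hxa (by rw [e])
  have n1 := hne haq
  have n2 := hne hap
  have n3 := hne hxa
  have f1 : InArc t a (x a) (x p) → t (x a) = t a := fun hv => by
    rw [x.injective (hfix _ hv)]
  -- Otherwise `x a` would lie among the fixed points between `a` and `x p`, and `f1` would give `x
  -- a = a`, which is not in that open arc. So the cycle being merged sits entirely under the edge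
  -- from `a` to `x a`.
  have g1 : InArc t a (x p) (x a) := by
    unfold InArc at *
    omega
  have g2 : InArc t a p (x a) := h.sameCycle g1 (by simp [SameCycle.refl])
  have g3 : ¬ InArc t a p (x p) := fun hv => by
    have := hfix _ hv
    rw [this] at hv
    unfold InArc at hv
    omega
  intro r v hv
  by_cases hra : r = a
  · subst hra
    have hr : (swap (x r) (x p) * x) r = x p := by rw [mul_apply, swap_apply_left]
    rw [hr] at hv ⊢
    have hxv := hfix v hv
    have hv1 : v ≠ r := by rintro rfl; unfold InArc at hv; omega
    have hv2 : v ≠ p := by rintro rfl; exact g3 hv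
    rw [mul_apply, swap_apply_of_ne_of_ne (x.injective.ne hv1) (x.injective.ne hv2), hxv]
    exact hv
  by_cases hrp : r = p
  · subst hrp
    have hr : (swap (x a) (x r) * x) r = x a := by rw [mul_apply, swap_apply_right]
    rw [hr] at hv ⊢
    by_cases hva : v = a
    · subst hva
      rw [mul_apply, swap_apply_left]
      unfold InArc at *
      omega
    by_cases hvr : v = r
    · subst hvr; unfold InArc at hv; omega
    rw [mul_apply, swap_apply_of_ne_of_ne (x.injective.ne hva) (x.injective.ne hvr)]
    have n6 := hne (x.injective.ne hva)
    have f3 : InArc t a (x v) (x r) → t (x v) = t v := fun hv => by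
      rw [x.injective (hfix _ hv)]
    clear hfix f1
    have e1 : InArc t r v (x r) := by
      unfold InArc at *
      omega
    have e2 : InArc t a v (x a) := by
      unfold InArc at *
      omega
    have e3 := h r v e1
    have e4 := h a v e2
    unfold InArc at *
    omega
  have hr : (swap (x a) (x p) * x) r = x r := by
    rw [mul_apply, swap_apply_of_ne_of_ne (x.injective.ne hra) (x.injective.ne hrp)]
  rw [hr] at hv ⊢
  have hxv := h r v hv
  by_cases hva : v = a
  · subst hva
    rw [mul_apply, swap_apply_left]
    have n4 := hne hra
    have n7 := hne (x.injective.ne hrp)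
    have f3 : InArc t v (x r) (x p) → t (x r) = t r := fun hv => by
      rw [x.injective (hfix _ hv)]
    clear hfix f1 g1 g2 g3 n1 n2 n3 hxv
    unfold InArc at *
    omega
  by_cases hvp : v = p
  · subst hvp
    rw [mul_apply, swap_apply_right]
    have n4 := hne hra
    have f3 : InArc t a r (x v) → t (x r) = t r := fun hv => by rw [hfix _ hv]
    refine h r a ?_
    clear hfix f1 g1 g2 g3 n1 n2 n3 hv
    unfold InArc at *
    omega
  rwa [mul_apply, swap_apply_of_ne_of_ne (x.injective.ne hva) (x.injective.ne hvp)]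

/-! ### Cycles and multiplication by a transposition -/

theorem sameCycle_of_forall_apply {α : Type*} [Finite α] {x y : Perm α}
    (h : ∀ a, SameCycle x a (y a)) {a b : α} (hab : SameCycle y a b) : SameCycle x a b := by
  obtain ⟨k, rfl⟩ := hab.exists_nat_pow_eq
  clear hab
  induction k with
  | zero => exact .refl _ _
  | succ k ih => rw [pow_succ', mul_apply]; exact ih.trans (h _)

/-- The new permutation sends `a` to `x b` and then follows the old cycle of `b`, which avoids `a`,
until it returns to `b`. -/
theorem sameCycle_mul_swap {α : Type*} [Finite α] [DecidableEq α] {x : Perm α} {a b : α}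
    (h : ¬ SameCycle x a b) : SameCycle (x * swap a b) a b := by
  have key : ∀ k : ℕ, SameCycle (x * swap a b) a b ∨
      SameCycle (x * swap a b) a ((x ^ (k + 1)) b) := by
    intro k
    induction k with
    | zero => exact .inr ⟨1, by simp⟩
    | succ k ih =>
      rcases ih with ih | ih
      · exact .inl ih
      by_cases hb : (x ^ (k + 1)) b = b
      · exact .inl (by rwa [hb] at ih)
      refine .inr (ih.trans ⟨1, ?_⟩)
      have ha : (x ^ (k + 1)) b ≠ a := fun e => h (SameCycle.symm ⟨(k + 1 : ℕ), by rw [zpow_natCast]; exact e⟩)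
      rw [zpow_one, mul_apply, swap_apply_of_ne_of_ne ha hb, ← mul_apply, ← pow_succ']
  have hpos := orderOf_pos x
  rcases key (orderOf x - 1) with h' | h'
  · exact h'
  · rwa [Nat.sub_add_cancel hpos, pow_orderOf_eq_one] at h'

theorem sameCycle_mul_swap_of_sameCycle {α : Type*} [Finite α] [DecidableEq α] {x : Perm α} {a b p q : α}
    (h : ¬ SameCycle x a b) (hpq : SameCycle x p q) : SameCycle (x * swap a b) p q := by
  have hab := sameCycle_mul_swap h
  refine sameCycle_of_forall_apply (fun v => ?_) hpq
  by_cases hva : v = a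
  · subst hva
    refine hab.trans ⟨1, by simp⟩
  by_cases hvb : v = b
  · subst hvb
    exact hab.symm.trans ⟨1, by simp⟩
  exact ⟨1, by simp [swap_apply_of_ne_of_ne hva hvb]⟩

/-! ### Polygons in terms of cycles -/

theorem mem_Pol_iff {x : Perm (Fin (n + 1))} {P : Finset (Fin (n + 1))} :
    P ∈ Pol x ↔ ∃ a, x a ≠ a ∧ ∀ b, b ∈ P ↔ SameCycle x a b := by
  have key : ∀ a, x a ≠ a → ∀ b, b ∈ (x.cycleOf a).support ↔ SameCycle x a b := fun a ha b => by
    rw [mem_support_cycleOf_iff]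
    exact and_iff_left (mem_support.2 ha)
  simp only [Pol, Finset.mem_image]
  constructor
  · rintro ⟨f, hf, rfl⟩
    obtain ⟨a, ha⟩ := (mem_cycleFactorsFinset_iff.1 hf).1.nonempty_support
    have hx := mem_cycleFactorsFinset_support_le hf ha
    refine ⟨a, mem_support.1 hx, fun b => ?_⟩
    rw [cycle_is_cycleOf ha hf]
    exact key a (mem_support.1 hx) b
  · rintro ⟨a, ha, hP⟩
    refine ⟨x.cycleOf a, cycleOf_mem_cycleFactorsFinset_iff.2 (mem_support.2 ha), ?_⟩
    ext b
    rw [hP, key a ha]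

theorem sameCycle_of_mem_Pol {x : Perm (Fin (n + 1))} {P : Finset (Fin (n + 1))} (hP : P ∈ Pol x)
    {a : Fin (n + 1)} (ha : a ∈ P) (b : Fin (n + 1)) : b ∈ P ↔ SameCycle x a b := by
  obtain ⟨p, hp, h⟩ := mem_Pol_iff.1 hP
  rw [h]
  exact ⟨fun hb => ((h a).1 ha).symm.trans hb, fun hb => ((h a).1 ha).trans hb⟩

theorem exists_mem_Pol {x : Perm (Fin (n + 1))} {a : Fin (n + 1)} (ha : x a ≠ a) :
    ∃ P ∈ Pol x, a ∈ P :=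
  ⟨Finset.univ.filter fun b => SameCycle x a b, mem_Pol_iff.2 ⟨a, ha, by simp⟩, by simp [SameCycle.refl]⟩

theorem apply_ne_of_mem_Pol {x : Perm (Fin (n + 1))} {P : Finset (Fin (n + 1))} (hP : P ∈ Pol x)
    {a : Fin (n + 1)} (ha : a ∈ P) : x a ≠ a := by
  obtain ⟨p, hp, h⟩ := mem_Pol_iff.1 hP
  exact fun e => hp (((h a).1 ha).apply_eq_self_iff.2 e)

theorem apply_ne_of_sameCycle {α : Type*} {x : Perm α} {a b : α} (h : SameCycle x a b)
    (hab : a ≠ b) : x a ≠ a :=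
  fun e => hab (h.eq_of_left e)

theorem isInitial_iff {x : Perm (Fin (n + 1))} {k : Fin (n + 1)} :
    IsInitial x k ↔ x k ≠ k ∧ ∀ b, SameCycle x k b → k ≤ b := by
  constructor
  · rintro ⟨P, hP, hk, h⟩
    exact ⟨apply_ne_of_mem_Pol hP hk, fun b hb => h b ((sameCycle_of_mem_Pol hP hk b).2 hb)⟩
  · rintro ⟨hk, h⟩
    obtain ⟨P, hP, hkP⟩ := exists_mem_Pol hk
    exact ⟨P, hP, hkP, fun b hb => h b ((sameCycle_of_mem_Pol hP hkP b).1 hb)⟩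

theorem isTerminal_iff {x : Perm (Fin (n + 1))} {k : Fin (n + 1)} :
    IsTerminal x k ↔ x k ≠ k ∧ ∀ b, SameCycle x k b → b ≤ k := by
  constructor
  · rintro ⟨P, hP, hk, h⟩
    exact ⟨apply_ne_of_mem_Pol hP hk, fun b hb => h b ((sameCycle_of_mem_Pol hP hk b).2 hb)⟩
  · rintro ⟨hk, h⟩
    obtain ⟨P, hP, hkP⟩ := exists_mem_Pol hk
    exact ⟨P, hP, hkP, fun b hb => h b ((sameCycle_of_mem_Pol hP hkP b).1 hb)⟩

theorem mem_U_iff {x : Perm (Fin (n + 1))} {k : Fin (n + 1)} :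
    k ∈ U x ↔ ∃ b < k, SameCycle x k b := by
  rw [U, Finset.mem_filter, isInitial_iff, mem_support]
  constructor
  · rintro ⟨hk, h⟩
    by_contra! hb
    exact h ⟨hk, fun b hs => not_lt.1 fun hlt => hb b hlt hs⟩
  · rintro ⟨b, hb, hs⟩
    exact ⟨apply_ne_of_sameCycle hs hb.ne', fun h => absurd hb (not_lt.2 (h.2 b hs))⟩

theorem mem_D_iff {x : Perm (Fin (n + 1))} {k : Fin (n + 1)} :
    k ∈ D x ↔ ∃ b > k, SameCycle x k b := by
  rw [D, Finset.mem_filter, isTerminal_iff, mem_support]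
  constructor
  · rintro ⟨hk, h⟩
    by_contra! hb
    exact h ⟨hk, fun b hs => not_lt.1 fun hlt => hb b hlt hs⟩
  · rintro ⟨b, hb, hs⟩
    exact ⟨apply_ne_of_sameCycle hs (ne_of_lt hb), fun h => absurd hb (not_lt.2 (h.2 b hs))⟩

theorem exists_lt_or_gt_sameCycle {x : Perm (Fin (n + 1))} {k : Fin (n + 1)} (hk : x k ≠ k) :
    k ∈ D x ∨ k ∈ U x := by
  rcases lt_or_gt_of_ne hk with h | h
  · exact .inr (mem_U_iff.2 ⟨x k, h, 1, by simp⟩)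
  · exact .inl (mem_D_iff.2 ⟨x k, h, 1, by simp⟩)

theorem isInitial_iff_mem {x : Perm (Fin (n + 1))} {k : Fin (n + 1)} :
    IsInitial x k ↔ k ∈ D x ∧ k ∉ U x := by
  constructor
  · intro h
    have hU : k ∉ U x := fun hU => (Finset.mem_filter.1 hU).2 h
    exact ⟨(exists_lt_or_gt_sameCycle (isInitial_iff.1 h).1).resolve_right hU, hU⟩
  · rintro ⟨hD, hU⟩
    by_contra h
    exact hU (Finset.mem_filter.2 ⟨(Finset.mem_filter.1 hD).1, h⟩)

theorem isTerminal_iff_mem {x : Perm (Fin (n + 1))} {k : Fin (n + 1)} :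
    IsTerminal x k ↔ k ∈ U x ∧ k ∉ D x := by
  constructor
  · intro h
    have hD : k ∉ D x := fun hD => (Finset.mem_filter.1 hD).2 h
    exact ⟨(exists_lt_or_gt_sameCycle (isTerminal_iff.1 h).1).resolve_left hD, hD⟩
  · rintro ⟨hU, hD⟩
    by_contra h
    exact hD (Finset.mem_filter.2 ⟨(Finset.mem_filter.1 hU).1, h⟩)

theorem mem_support_iff_mem_D_or_mem_U {x : Perm (Fin (n + 1))} {k : Fin (n + 1)} :
    k ∈ x.support ↔ k ∈ D x ∨ k ∈ U x := by
  refine ⟨fun h => exists_lt_or_gt_sameCycle (mem_support.1 h), ?_⟩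
  rintro (h | h) <;> exact (Finset.mem_filter.1 h).1

theorem D_inv (x : Perm (Fin (n + 1))) : D x⁻¹ = D x := by
  ext k
  simp only [mem_D_iff, sameCycle_inv]

theorem U_inv (x : Perm (Fin (n + 1))) : U x⁻¹ = U x := by
  ext k
  simp only [mem_U_iff, sameCycle_inv]

theorem U_eq_empty_iff {x : Perm (Fin (n + 1))} : U x = ∅ ↔ x = 1 := by
  constructor
  · intro h
    have hU : ∀ k, k ∉ U x := by simp [h]
    ext1 k
    by_contra hk
    rcases exists_lt_or_gt_sameCycle hk with hD | hk
    · obtain ⟨b, hb, hs⟩ := mem_D_iff.1 hD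
      exact hU b (mem_U_iff.2 ⟨k, hb, hs.symm⟩)
    · exact hU k hk
  · rintro rfl
    ext k
    simp only [mem_U_iff, sameCycle_one, Finset.notMem_empty, iff_false]
    rintro ⟨b, hb, rfl⟩
    exact lt_irrefl _ hb

/-! ### Reflection length -/

/-- `U x` holds all elements but the least of each nontrivial cycle. One transposition makes a
chosen `a` of `U x` a fixed point without joining cycles, so `U` shrinks. -/
theorem exists_prod_swap (x : Perm (Fin (n + 1))) :
    ∃ l : List (Perm (Fin (n + 1))), l.length ≤ (U x).card ∧ (∀ t ∈ l, t.IsSwap) ∧ l.prod = x := by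
  induction hm : (U x).card using Nat.strong_induction_on generalizing x with
  | _ m ih =>
    rcases (U x).eq_empty_or_nonempty with h | ⟨a, ha⟩
    · exact ⟨[], by simp, by simp, by simp [U_eq_empty_iff.1 h]⟩
    obtain ⟨b, hb, hs⟩ := mem_U_iff.1 ha
    have hxa : a ≠ x a := (apply_ne_of_sameCycle hs hb.ne').symm
    set y := swap a (x a) * x with hy
    have hya : y a = a := by simp [hy]
    have hyx : ∀ v, SameCycle x v (y v) := by
      intro v
      by_cases h1 : v = a
      · rw [h1, hya]
      by_cases h2 : x v = a
      · rw [hy, mul_apply, h2, swap_apply_left]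
        refine ⟨2, ?_⟩
        rw [← h2]; rfl
      · rw [hy, mul_apply, swap_apply_of_ne_of_ne h2 (x.injective.ne h1)]
        exact ⟨1, by simp⟩
    have hsub : U y ⊆ (U x).erase a := by
      intro k hk
      obtain ⟨v, hv, hs⟩ := mem_U_iff.1 hk
      refine Finset.mem_erase.2 ⟨?_, mem_U_iff.2 ⟨v, hv, sameCycle_of_forall_apply hyx hs⟩⟩
      rintro rfl
      exact hv.ne (hs.eq_of_left hya).symm
    have hcard := (Finset.card_le_card hsub).trans_eq (Finset.card_erase_of_mem ha)
    have hpos := Finset.card_pos.2 ⟨a, ha⟩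
    obtain ⟨l, hl, hsw, hprod⟩ := ih _ (by omega) y rfl
    refine ⟨swap a (x a) :: l, ?_, ?_, ?_⟩
    · rw [List.length_cons]; omega
    · intro t ht
      rcases List.mem_cons.1 ht with rfl | ht
      · exact ⟨a, x a, hxa, rfl⟩
      · exact hsw t ht
    · rw [List.prod_cons, hprod, hy, swap_mul_self_mul]

theorem reflLength_le {x : Perm (Fin (n + 1))} {l : List (Perm (Fin (n + 1)))}
    (h : ∀ t ∈ l, t.IsSwap) (hx : l.prod = x) : reflLength x ≤ l.length :=
  Nat.sInf_le ⟨l, rfl, h, hx⟩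

theorem exists_reflLength_eq (x : Perm (Fin (n + 1))) :
    ∃ l : List (Perm (Fin (n + 1))), l.length = reflLength x ∧ (∀ t ∈ l, t.IsSwap) ∧ l.prod = x := by
  obtain ⟨l, -, h⟩ := exists_prod_swap x
  exact Nat.sInf_mem (s := {k | ∃ l : List (Perm (Fin (n + 1))), l.length = k ∧
    (∀ t ∈ l, t.IsSwap) ∧ l.prod = x}) ⟨l.length, l, rfl, h⟩

theorem reflLength_le_card_U (x : Perm (Fin (n + 1))) : reflLength x ≤ (U x).card := by
  obtain ⟨l, hl, h, hx⟩ := exists_prod_swap x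
  exact (reflLength_le h hx).trans hl

theorem reflLength_mul_le (x y : Perm (Fin (n + 1))) :
    reflLength (x * y) ≤ reflLength x + reflLength y := by
  obtain ⟨l, hl, h, hx⟩ := exists_reflLength_eq x
  obtain ⟨m, hm, h', hy⟩ := exists_reflLength_eq y
  rw [← hl, ← hm, ← List.length_append]
  refine reflLength_le (fun t ht => ?_) (by rw [List.prod_append, hx, hy])
  exact (List.mem_append.1 ht).elim (h t) (h' t)

theorem card_U_le (x : Perm (Fin (n + 1))) : (U x).card ≤ n := by
  have : U x ⊆ Finset.univ.erase 0 := by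
    intro k hk
    obtain ⟨b, hb, -⟩ := mem_U_iff.1 hk
    simpa using ((Fin.zero_le b).trans_lt hb).ne'
  simpa using Finset.card_le_card this

/-- The graph whose edges are the transpositions of a list. -/
def swapGraph (l : List (Perm (Fin (n + 1)))) : SimpleGraph (Fin (n + 1)) where
  Adj a b := a ≠ b ∧ swap a b ∈ l
  symm := ⟨fun a b h => ⟨h.1.symm, swap_comm a b ▸ h.2⟩⟩
  loopless := ⟨fun _ h => h.1 rfl⟩

theorem reachable_prod_apply {l m : List (Perm (Fin (n + 1)))} (h : ∀ t ∈ l, t.IsSwap)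
    (hlm : ∀ t ∈ l, t ∈ m) (a : Fin (n + 1)) : (swapGraph m).Reachable a (l.prod a) := by
  induction l with
  | nil => exact .refl _
  | cons t l ih =>
    rw [List.prod_cons, mul_apply]
    refine (ih (fun t ht => h t (by simp [ht])) fun t ht => hlm t (by simp [ht])).trans ?_
    obtain ⟨p, q, hpq, rfl⟩ := h t (by simp)
    have hadj : (swapGraph m).Adj p q := ⟨hpq, hlm _ (by simp)⟩
    generalize l.prod a = v
    by_cases h1 : v = p
    · rw [h1, swap_apply_left]; exact hadj.reachable
    by_cases h2 : v = q
    · rw [h2, swap_apply_right]; exact hadj.symm.reachable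
    · rw [swap_apply_of_ne_of_ne h1 h2]

theorem reachable_of_sameCycle {l m : List (Perm (Fin (n + 1)))} (h : ∀ t ∈ l, t.IsSwap)
    (hlm : ∀ t ∈ l, t ∈ m) {a b : Fin (n + 1)} (hab : SameCycle l.prod a b) :
    (swapGraph m).Reachable a b := by
  obtain ⟨k, rfl⟩ := hab.exists_nat_pow_eq
  clear hab
  induction k with
  | zero => exact .refl _
  | succ k ih => rw [pow_succ', mul_apply]; exact ih.trans (reachable_prod_apply h hlm _)

/-- A connected graph on n + 1 vertices has at least n edges, and distinct edges are distinct
transpositions of the list. -/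
theorem le_length_of_reachable (l : List (Perm (Fin (n + 1))))
    (h : ∀ a b, (swapGraph l).Reachable a b) : n ≤ l.length := by
  classical
  have hconn : (swapGraph l).Connected := ⟨h⟩
  have h1 := hconn.card_vert_le_card_edgeSet_add_one
  rw [Nat.card_eq_fintype_card, Fintype.card_fin] at h1
  have h2 : Nat.card (swapGraph l).edgeSet ≤ l.toFinset.card := by
    rw [← Nat.card_eq_finsetCard]
    let f : Sym2 (Fin (n + 1)) → Perm (Fin (n + 1)) :=
      Sym2.lift ⟨fun a b => swap a b, fun a b => swap_comm a b⟩
    have hf : ∀ e ∈ (swapGraph l).edgeSet, f e ∈ l.toFinset := by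
      intro e
      induction e with
      | _ a b => intro h; simpa [f] using h.2
    refine Nat.card_le_card_of_injective (fun e => ⟨f e.1, hf e.1 e.2⟩) ?_
    rintro ⟨e, he⟩ ⟨e', he'⟩ h
    have h : f e = f e' := congrArg Subtype.val h
    refine Subtype.ext ?_
    induction e with
    | _ a b =>
      induction e' with
      | _ a' b' =>
        have hab : a ≠ b := he.1
        have hab' : a' ≠ b' := he'.1
        simp only [f, Sym2.lift_mk] at h
        have h1 : ({a, b} : Finset (Fin (n + 1))) = {a', b'} := by
          rw [← support_swap hab, ← support_swap hab', h]
        simp only [Sym2.eq_iff]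
        have ha : a ∈ ({a', b'} : Finset (Fin (n + 1))) := by rw [← h1]; simp
        have hb : b ∈ ({a', b'} : Finset (Fin (n + 1))) := by rw [← h1]; simp
        simp only [Finset.mem_insert, Finset.mem_singleton] at ha hb
        rcases ha with rfl | rfl <;> rcases hb with rfl | rfl <;> simp_all
  have h3 := l.toFinset_card_le
  omega

/-! ### The absolute order and noncrossing permutations -/

theorem IsCircular.pow_apply_zero {c : Perm (Fin (n + 1))} {t : Fin (n + 1) → ℕ}
    (h : IsCircular c t) {k : ℕ} (hk : k ≤ n) : t ((c ^ k) 0) = k := by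
  induction k with
  | zero => simpa using h.zero
  | succ k ih =>
    rw [pow_succ', mul_apply, h.step, ih (by omega), if_neg (by omega)]

theorem IsCircular.pow_eq {c : Perm (Fin (n + 1))} {t : Fin (n + 1) → ℕ}
    (h : IsCircular c t) (a : Fin (n + 1)) : (c ^ t a) 0 = a :=
  h.injective (h.pow_apply_zero (h.le a))

theorem IsCircular.sameCycle {c : Perm (Fin (n + 1))} {t : Fin (n + 1) → ℕ}
    (h : IsCircular c t) (a b : Fin (n + 1)) : SameCycle c a b := by
  have key : ∀ a, SameCycle c 0 a := fun a => ⟨t a, by rw [zpow_natCast, h.pow_eq]⟩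
  exact (key a).symm.trans (key b)

/-- The two cycles merge, and the larger of their two minima becomes a non-minimal element. -/
theorem card_U_lt_card_U_mul_swap {x : Perm (Fin (n + 1))} {a b : Fin (n + 1)}
    (hab : ¬ SameCycle x a b) : (U x).card < (U (x * swap a b)).card := by
  classical
  have hmin : ∀ a, ∃ m, SameCycle x a m ∧ m ∉ U x := by
    intro a
    obtain ⟨m, hm, hmin⟩ := (Finset.univ.filter fun v => SameCycle x a v).exists_minimal
      ⟨a, by simp [SameCycle.refl]⟩
    simp only [Finset.mem_filter, Finset.mem_univ, true_and] at hm hmin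
    refine ⟨m, hm, fun hU => ?_⟩
    obtain ⟨b, hb, hs⟩ := mem_U_iff.1 hU
    exact absurd hb (not_lt.2 (hmin (hm.trans hs) hb.le))
  obtain ⟨p, hp, hpU⟩ := hmin a
  obtain ⟨q, hq, hqU⟩ := hmin b
  have hpq : SameCycle (x * swap a b) p q :=
    ((sameCycle_mul_swap_of_sameCycle hab hp).symm.trans (sameCycle_mul_swap hab)).trans
      (sameCycle_mul_swap_of_sameCycle hab hq)
  have hne : p ≠ q := by
    rintro rfl
    exact hab (hp.trans hq.symm)
  refine Finset.card_lt_card (Finset.ssubset_iff_exists_cons_subset.2 ?_)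
  have hsub : U x ⊆ U (x * swap a b) := fun k hk => by
    obtain ⟨v, hv, hs⟩ := mem_U_iff.1 hk
    exact mem_U_iff.2 ⟨v, hv, sameCycle_mul_swap_of_sameCycle hab hs⟩
  rcases lt_or_gt_of_ne hne with h | h
  · refine ⟨q, hqU, ?_⟩
    rw [Finset.cons_eq_insert]
    exact Finset.insert_subset (mem_U_iff.2 ⟨p, h, hpq.symm⟩) hsub
  · refine ⟨p, hpU, ?_⟩
    rw [Finset.cons_eq_insert]
    exact Finset.insert_subset (mem_U_iff.2 ⟨q, h, hpq⟩) hsub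

/-- If `x a ≠ c a`, the next point `c a` on the circle lies under the edge from `a` to `x a`, hence
in another cycle. No point lies between `a` and `c a`, so the two cycles can be merged. -/
theorem NonCrossing.exists_merge {c : Perm (Fin (n + 1))} {t : Fin (n + 1) → ℕ}
    (hc : IsCircular c t) {x : Perm (Fin (n + 1))} (hx : NonCrossing t x) (hxc : x ≠ c) :
    ∃ a b, ¬ SameCycle x a b ∧ NonCrossing t (x * swap a b) := by
  obtain ⟨a, ha⟩ : ∃ a, x a ≠ c a := by
    by_contra! h
    exact hxc (Equiv.ext h)
  have h1 := hc.step a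
  have h2 := hc.le (x a)
  have h3 := hc.le a
  have h4 : t (x a) ≠ t (c a) := fun e => ha (hc.injective e)
  have h5 := hc.le (c a)
  have hin : InArc t a (c a) (x a) := by
    unfold InArc
    split_ifs at h1 <;> omega
  have hns : ¬ SameCycle x a (c a) := fun hs => hx.not_inArc hs hin
  refine ⟨a, x.symm (c a), fun hs => hns ?_, ?_⟩
  · simpa using sameCycle_apply_right.2 hs
  · rw [Equiv.mul_swap_eq_swap_mul, apply_symm_apply]
    refine hx.swap_mul hc.injective (fun e => hns ?_) (fun v hv => ?_) ha
    · exact e ▸ SameCycle.refl x a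
    · exfalso
      have := hc.le v
      unfold InArc at hv
      split_ifs at h1 <;> omega

/-- Merging cycles until `c` is reached costs one transposition per step, while the size of `U`
strictly grows and never exceeds n. -/
theorem NonCrossing.reflLength_inv_mul_add_le {c : Perm (Fin (n + 1))} {t : Fin (n + 1) → ℕ}
    (hc : IsCircular c t) {x : Perm (Fin (n + 1))} (hx : NonCrossing t x) :
    reflLength (x⁻¹ * c) + (U x).card ≤ n := by
  induction hm : n - (U x).card using Nat.strong_induction_on generalizing x with
  | _ m ih =>
    by_cases hxc : x = c
    · have : reflLength (1 : Perm (Fin (n + 1))) = 0 :=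
        Nat.le_zero.1 (reflLength_le (l := []) (by simp) rfl)
      rw [hxc, inv_mul_cancel, this, zero_add]
      exact card_U_le c
    obtain ⟨a, b, hab, hy⟩ := hx.exists_merge hc hxc
    have h1 := card_U_lt_card_U_mul_swap hab
    have h2 := card_U_le (x * swap a b)
    have h3 := ih _ (by omega) hy rfl
    have h4 : x⁻¹ * c = swap a b * ((x * swap a b)⁻¹ * c) := by
      rw [mul_inv_rev, swap_inv, mul_assoc, swap_mul_self_mul]
    have hne : a ≠ b := fun e => hab (e ▸ SameCycle.refl x a)
    have h5 := reflLength_mul_le (swap a b) ((x * swap a b)⁻¹ * c)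
    have h6 : reflLength (swap a b) ≤ 1 :=
      reflLength_le (l := [swap a b]) (by simpa using ⟨a, b, hne, rfl⟩) (by simp)
    rw [← h4] at h5
    omega

theorem IsCircular.reflLength_eq {c : Perm (Fin (n + 1))} {t : Fin (n + 1) → ℕ}
    (hc : IsCircular c t) : reflLength c = n := by
  refine le_antisymm ((reflLength_le_card_U c).trans (card_U_le c)) ?_
  obtain ⟨l, hl, h, hx⟩ := exists_reflLength_eq c
  rw [← hl]
  refine le_length_of_reachable l fun a b => reachable_of_sameCycle h (fun _ h => h) ?_
  rw [hx]
  exact hc.sameCycle a b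

/-- Starting from `c`, the factors are stripped from the right end of a minimal factorization; each
removal splits a cycle. -/
theorem nonCrossing_of_prod_eq {c : Perm (Fin (n + 1))} {t : Fin (n + 1) → ℕ}
    (hc : IsCircular c t) (m : List (Perm (Fin (n + 1)))) :
    ∀ l : List (Perm (Fin (n + 1))), (∀ s ∈ l ++ m, s.IsSwap) → (l ++ m).prod = c →
      (l ++ m).length = n → NonCrossing t l.prod := by
  induction m with
  | nil =>
    intro l _ h _
    rw [List.append_nil] at h
    rw [h]
    exact nonCrossing_of_isCircular hc
  | cons s m ih =>
    intro l hsw hprod hlen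
    have e : l ++ s :: m = l ++ [s] ++ m := by simp
    have hy := ih (l ++ [s]) (e ▸ hsw) (e ▸ hprod) (e ▸ hlen)
    obtain ⟨a, b, hab, rfl⟩ := hsw s (by simp)
    rw [List.prod_append, List.prod_singleton] at hy
    -- If `a` and `b` already shared a cycle, the edge between them would be redundant: the other n
    -- - 1 factors would still connect all n + 1 points.
    have hns : ¬ SameCycle l.prod a b := by
      intro hs
      have hlsw : ∀ t ∈ l, t.IsSwap := fun t ht => hsw t (by simp [ht])
      have hr := reachable_of_sameCycle (m := l ++ m) hlsw (fun t ht => by simp [ht]) hs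
      have hn := le_length_of_reachable (l ++ m) fun p q => by
        have hpq := reachable_of_sameCycle hsw (fun _ h => h)
          (hprod.symm ▸ hc.sameCycle p q : SameCycle (l ++ swap a b :: m).prod p q)
        obtain ⟨w⟩ := hpq
        induction w with
        | nil => exact .refl _
        | cons hadj _ ih =>
          refine .trans ?_ ih
          obtain ⟨hne, hmem⟩ := hadj
          rw [List.mem_append, List.mem_cons] at hmem
          rcases hmem with h | h | h
          · exact SimpleGraph.Adj.reachable ⟨hne, by simp [h]⟩
          -- Equal transpositions have equal supports, so this step of the walk uses the edge `a`,
          -- `b`, and `hr` provides a detour.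
          · have h' := congrArg support h
            rw [support_swap hne, support_swap hab] at h'
            rename_i u v _ _
            have hu : u ∈ ({a, b} : Finset (Fin (n + 1))) := by rw [← h']; simp
            have hv : v ∈ ({a, b} : Finset (Fin (n + 1))) := by rw [← h']; simp
            simp only [Finset.mem_insert, Finset.mem_singleton] at hu hv
            rcases hu with rfl | rfl <;> rcases hv with rfl | rfl
            · exact absurd rfl hne
            · exact hr
            · exact hr.symm
            · exact absurd rfl hne
          · exact SimpleGraph.Adj.reachable ⟨hne, by simp [h]⟩
      simp only [List.length_append, List.length_cons] at hlen hn
      omega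
    have hs := sameCycle_mul_swap hns
    have := hy.mul_swap hc.injective hab hs
    rwa [mul_assoc, swap_mul_self, mul_one] at this

/-- The noncrossing partitions for `c` are the noncrossing permutations of the circle labelled
by `c`. -/
theorem mem_NC_iff {c : Perm (Fin (n + 1))} {t : Fin (n + 1) → ℕ} (hc : IsCircular c t)
    {x : Perm (Fin (n + 1))} : x ∈ NC c ↔ NonCrossing t x := by
  constructor
  · intro h
    have h : reflLength x + reflLength (x⁻¹ * c) = reflLength c := h
    rw [hc.reflLength_eq] at h
    obtain ⟨l, hl, hlsw, hx⟩ := exists_reflLength_eq x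
    obtain ⟨m, hm, hmsw, hy⟩ := exists_reflLength_eq (x⁻¹ * c)
    have := nonCrossing_of_prod_eq hc m l (fun s hs => ?_) ?_ ?_
    · rwa [hx] at this
    · exact (List.mem_append.1 hs).elim (hlsw s) (hmsw s)
    · rw [List.prod_append, hx, hy, mul_inv_cancel_left]
    · rw [List.length_append, hl, hm, h]
  · intro h
    have h1 := h.reflLength_inv_mul_add_le hc
    have h2 := reflLength_le_card_U x
    have h3 := reflLength_mul_le x (x⁻¹ * c)
    rw [mul_inv_cancel_left] at h3
    have h4 := hc.reflLength_eq
    change reflLength x + reflLength (x⁻¹ * c) = reflLength c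
    omega

/-! ### Noncrossing permutations and pairs of sequences -/

/-- When running through the circle, the points are met in a unimodal order: each point `k` is
met between the smaller and the larger points, on one of the two sides. -/
structure IsUnimodal (t : Fin (n + 1) → ℕ) : Prop where
  injective : Function.Injective t
  le : ∀ a, t a ≤ n
  sides : ∀ k, (∀ a b, a < k → k < b → InArc t a k b) ∨ (∀ a b, a < k → k < b → InArc t b k a)

theorem inArc_rev {t : Fin (n + 1) → ℕ} (ht : ∀ a, t a ≤ n) (a b q : Fin (n + 1)) :
    InArc (fun a => n - t a) a b q ↔ InArc t q b a := by
  have := ht a; have := ht b; have := ht q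
  simp only [InArc]
  omega

theorem IsUnimodal.rev {t : Fin (n + 1) → ℕ} (ht : IsUnimodal t) :
    IsUnimodal fun a => n - t a where
  injective := fun a b h => ht.injective (by
    have := ht.le a; have := ht.le b
    simp only at h
    omega)
  le := fun a => Nat.sub_le _ _
  sides := fun k => by
    simp only [inArc_rev ht.le]
    exact (ht.sides k).symm

theorem sameCycle_bypass {α : Type*} [Finite α] [DecidableEq α] {x : Perm α} {d u : α}
    (hxd : x d = u) (a b : α) :
    SameCycle (swap d u * x) a b ↔ (a ≠ d ∧ b ≠ d ∧ SameCycle x a b) ∨ a = b := by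
  have hd : (swap d u * x) d = d := by rw [mul_apply, hxd, swap_apply_right]
  constructor
  · intro h
    by_cases ha : a = d
    · subst ha
      exact .inr (h.eq_of_left hd)
    by_cases hb : b = d
    · subst hb
      exact .inr (h.eq_of_right hd)
    refine .inl ⟨ha, hb, sameCycle_of_forall_apply (fun v => ?_) h⟩
    by_cases hv : v = d
    · rw [hv, hd]
    by_cases hxv : x v = d
    · rw [mul_apply, hxv, swap_apply_left, ← hxd, ← hxv]
      exact ⟨2, rfl⟩
    · rw [mul_apply, swap_apply_of_ne_of_ne hxv fun e => hv (x.injective (e.trans hxd.symm))]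
      exact ⟨1, by simp⟩
  · rintro (⟨ha, hb, h⟩ | rfl)
    swap
    · exact .refl _ _
    obtain ⟨k, rfl⟩ := h.exists_nat_pow_eq
    have key : ∀ k : ℕ, ((x ^ k) a ≠ d ∧ SameCycle (swap d u * x) a ((x ^ k) a)) ∨
        ((x ^ k) a = d ∧ SameCycle (swap d u * x) a u) := by
      intro k
      induction k with
      | zero => exact .inl ⟨ha, .refl _ _⟩
      | succ k ih =>
        rw [pow_succ', mul_apply]
        rcases ih with ⟨h1, h2⟩ | ⟨h1, h2⟩
        · by_cases h3 : x ((x ^ k) a) = d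
          · exact .inr ⟨h3, h2.trans ⟨1, by simp [h3]⟩⟩
          · refine .inl ⟨h3, h2.trans ⟨1, ?_⟩⟩
            rw [zpow_one, mul_apply, swap_apply_of_ne_of_ne h3]
            exact fun e => h1 (x.injective (e.trans hxd.symm))
        · rw [h1, hxd]
          by_cases hud : u = d
          · exact .inr ⟨hud, h2⟩
          · exact .inl ⟨hud, h2⟩
    rcases key k with h | h
    · exact h.2
    · exact absurd h.1 hb

/-- The new permutation cuts d out of its cycle. As u is the next smallest element there, u becomes
the minimum, and no other element changes status. -/
theorem D_U_bypass {x : Perm (Fin (n + 1))} {d u : Fin (n + 1)} (hxd : x d = u) (hdu : d < u)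
    (hmin : ∀ b, SameCycle x d b → b = d ∨ u ≤ b) :
    D (swap d u * x) = (D x).erase d ∧ U (swap d u * x) = (U x).erase u ∧ d ∈ D x ∧ u ∈ U x := by
  have hdsu : SameCycle x d u := ⟨1, by simpa using hxd⟩
  refine ⟨?_, ?_, mem_D_iff.2 ⟨u, hdu, hdsu⟩, mem_U_iff.2 ⟨d, hdu, hdsu.symm⟩⟩
  · ext k
    simp only [mem_D_iff, Finset.mem_erase, sameCycle_bypass hxd]
    constructor
    · rintro ⟨b, hb, ⟨h1, h2, h3⟩ | rfl⟩
      · exact ⟨h1, b, hb, h3⟩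
      · exact absurd hb (lt_irrefl _)
    · rintro ⟨h1, b, hb, h3⟩
      refine ⟨b, hb, .inl ⟨h1, ?_, h3⟩⟩
      rintro rfl
      rcases hmin k h3.symm with h | h
      · exact h1 h
      · exact absurd (hdu.trans_le h) (not_lt.2 (le_of_lt hb))
  · ext k
    simp only [mem_U_iff, Finset.mem_erase, sameCycle_bypass hxd]
    constructor
    · rintro ⟨b, hb, ⟨h1, h2, h3⟩ | rfl⟩
      · refine ⟨?_, b, hb, h3⟩
        rintro rfl
        rcases hmin b (hdsu.trans h3) with h | h
        · exact h2 h
        · exact absurd hb (not_lt.2 h)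
      · exact absurd hb (lt_irrefl _)
    · rintro ⟨h1, b, hb, h3⟩
      have hkd : k ≠ d := by
        rintro rfl
        rcases hmin b h3 with h | h
        · exact hb.ne h
        · exact absurd (hdu.trans_le h) (not_lt.2 hb.le)
      by_cases hbd : b = d
      · subst hbd
        refine ⟨u, ?_, .inl ⟨hkd, hdu.ne', h3.trans hdsu⟩⟩
        exact lt_of_le_of_ne ((hmin k h3.symm).resolve_left hkd) (Ne.symm h1)
      · exact ⟨b, hb, .inl ⟨hkd, hbd, h3⟩⟩

/-! ### Recursion at the least element of `U`. -/

/-- Minimality of u leaves a single smaller point d in its cycle, and clockwise orientation makes u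
the image of d. An element v of D below u has a mate at least u; if v lay under the edge from d to
u, so would this mate, but points above u come after u. -/
theorem NonCrossing.exists_partner {t : Fin (n + 1) → ℕ} {x : Perm (Fin (n + 1))}
    (hx : NonCrossing t x) {u : Fin (n + 1)} (hu : u ∈ U x) (hmin : ∀ v ∈ U x, u ≤ v)
    (hside : ∀ a b, a < u → u < b → InArc t a u b) :
    ∃ d, x d = u ∧ d < u ∧ (∀ b, SameCycle x d b → b = d ∨ u ≤ b) ∧
      ∀ v ∈ D x, v < u → ¬ InArc t d v u := by
  obtain ⟨d, hdu, hs⟩ := mem_U_iff.1 hu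
  have hb : ∀ b, SameCycle x d b → b = d ∨ u ≤ b := by
    intro b hb
    by_contra! h
    rcases lt_or_gt_of_ne h.1 with h1 | h1
    · exact absurd hdu (not_lt.2 (hmin d (mem_U_iff.2 ⟨b, h1, hb⟩)))
    · exact absurd h.2 (not_lt.2 (hmin b (mem_U_iff.2 ⟨d, h1, hb.symm⟩)))
  have hxd : x d = u := by
    by_contra hne
    have hsx : SameCycle x d (x d) := ⟨1, by simp⟩
    rcases hb _ hsx with h | h
    · exact hdu.ne (hs.symm.eq_of_left h)
    · exact hx.not_inArc hs.symm (hside d (x d) hdu (lt_of_le_of_ne h (Ne.symm hne)))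
  refine ⟨d, hxd, hdu, hb, fun v hv hvu hin => ?_⟩
  obtain ⟨w, hw, hvw⟩ := mem_D_iff.1 hv
  have h1 := hmin w (mem_U_iff.2 ⟨v, hw, hvw.symm⟩)
  rw [← hxd] at hin
  have h2 := hx.sameCycle hin hvw
  rw [hxd] at h2
  rcases h1.eq_or_lt with rfl | h1
  · unfold InArc at h2; omega
  · have h3 := hside d w hdu h1
    unfold InArc at h2 h3
    omega

theorem NonCrossing.bypass {t : Fin (n + 1) → ℕ} (ht : Function.Injective t)
    {x : Perm (Fin (n + 1))} (hx : NonCrossing t x) {d u : Fin (n + 1)} (hxd : x d = u)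
    (hdu : d ≠ u) : NonCrossing t (swap d u * x) := by
  have h := hx.mul_swap ht (a := x.symm d) (b := d) ?_ ?_
  · rwa [Equiv.mul_swap_eq_swap_mul, apply_symm_apply, hxd] at h
  · intro e
    rw [Equiv.symm_apply_eq, hxd] at e
    exact hdu e
  · simpa using SameCycle.refl x d

/-- The partner of the least u is the same for `x` and `y`: in both it is the element of D below u
nearest before u on the circle. Cutting it off reduces the size of `U`. -/
theorem NonCrossing.ext_D_U {x y : Perm (Fin (n + 1))} {t : Fin (n + 1) → ℕ} (ht : IsUnimodal t)
    (hx : NonCrossing t x) (hy : NonCrossing t y) (hD : D x = D y) (hU : U x = U y) : x = y := by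
  induction hm : (U x).card using Nat.strong_induction_on generalizing x y t with
  | _ m ih =>
    rcases (U x).eq_empty_or_nonempty with h | hne
    · exact (U_eq_empty_iff.1 h).trans (U_eq_empty_iff.1 (hU.symm.trans h)).symm
    obtain ⟨u, hu, hmin⟩ : ∃ u ∈ U x, ∀ v ∈ U x, u ≤ v :=
      ⟨_, (U x).min'_mem hne, fun v hv => (U x).min'_le v hv⟩
    have step : ∀ {x y : Perm (Fin (n + 1))} {t : Fin (n + 1) → ℕ}, IsUnimodal t →
        NonCrossing t x → NonCrossing t y → D x = D y → U x = U y → (U x).card = m → u ∈ U x →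
        (∀ v ∈ U x, u ≤ v) → (∀ a b, a < u → u < b → InArc t a u b) → x = y := by
      intro x y t ht hx hy hD hU hm hu hmin hside
      obtain ⟨d, h1, h2, h3, h4⟩ := hx.exists_partner hu hmin hside
      obtain ⟨e, h1', h2', h3', h4'⟩ := hy.exists_partner (hU ▸ hu) (hU ▸ hmin) hside
      obtain ⟨k1, k2, k3, k4⟩ := D_U_bypass h1 h2 h3
      obtain ⟨l1, l2, l3, l4⟩ := D_U_bypass h1' h2' h3'
      have hde : d = e := by
        refine ht.injective ?_
        have a1 := h4 e (hD ▸ l3) h2'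
        have a2 := h4' d (hD ▸ k3) h2
        have a3 : t d ≠ t u := fun e => h2.ne (ht.injective e)
        have a4 : t e ≠ t u := fun e => h2'.ne (ht.injective e)
        unfold InArc at a1 a2
        omega
      subst hde
      have hcard := Finset.card_erase_of_mem hu
      have hpos := Finset.card_pos.2 ⟨u, hu⟩
      have := ih _ (by rw [k2]; omega) ht (hx.bypass ht.injective h1 h2.ne)
        (hy.bypass ht.injective h1' h2.ne) (by rw [k1, l1, hD]) (by rw [k2, l2, hU]) rfl
      exact mul_left_cancel this
    rcases ht.sides u with hside | hside
    · exact step ht hx hy hD hU hm hu hmin hside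
    -- When u lies on the other side, inverses on the reversed circle have the same D and U and
    -- bring u to the side already treated.
    · refine inv_injective (step (x := x⁻¹) (y := y⁻¹) ht.rev (hx.inv ht.le) (hy.inv ht.le) ?_ ?_
        ?_ ?_ ?_ ?_)
      · rw [D_inv, D_inv, hD]
      · rw [U_inv, U_inv, hU]
      · rw [U_inv, hm]
      · rwa [U_inv]
      · rwa [U_inv]
      · intro a b ha hb
        rw [inArc_rev ht.le]
        exact hside a b ha hb

theorem NonCrossing.psi1_mem {x : Perm (Fin (n + 1))} {t : Fin (n + 1) → ℕ} (ht : IsUnimodal t)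
    (hx : NonCrossing t x) : psi1 x ∈ seqPairs n := by
  induction hm : (U x).card using Nat.strong_induction_on generalizing x t with
  | _ m ih =>
    rcases (U x).eq_empty_or_nonempty with h | hne
    · rw [psi1, h, mem_seqPairs_empty, U_eq_empty_iff.1 h]
      ext k
      simp only [mem_D_iff, sameCycle_one, Finset.notMem_empty, iff_false]
      rintro ⟨b, hb, rfl⟩
      exact lt_irrefl _ hb
    obtain ⟨u, hu, hmin⟩ : ∃ u ∈ U x, ∀ v ∈ U x, u ≤ v :=
      ⟨_, (U x).min'_mem hne, fun v hv => (U x).min'_le v hv⟩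
    have step : ∀ {x : Perm (Fin (n + 1))} {t : Fin (n + 1) → ℕ}, IsUnimodal t →
        NonCrossing t x → (U x).card = m → u ∈ U x →
        (∀ v ∈ U x, u ≤ v) → (∀ a b, a < u → u < b → InArc t a u b) → psi1 x ∈ seqPairs n := by
      intro x t ht hx hm hu hmin hside
      obtain ⟨d, h1, h2, h3, h4⟩ := hx.exists_partner hu hmin hside
      obtain ⟨k1, k2, k3, k4⟩ := D_U_bypass h1 h2 h3
      have hcard := Finset.card_erase_of_mem hu
      have hpos := Finset.card_pos.2 ⟨u, hu⟩
      have := ih _ (by rw [k2]; omega) ht (hx.bypass ht.injective h1 h2.ne) rfl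
      rw [psi1, k1, k2] at this
      exact (mem_seqPairs_erase_iff k3 k4 h2 hmin).2 this
    rcases ht.sides u with hside | hside
    · exact step ht hx hm hu hmin hside
    · have := step (x := x⁻¹) ht.rev (hx.inv ht.le) (by rw [U_inv, hm]) (by rwa [U_inv])
        (by rwa [U_inv]) (fun a b ha hb => by rw [inArc_rev ht.le]; exact hside a b ha hb)
      rwa [psi1, D_inv, U_inv] at this

theorem exists_closest_before {t : Fin (n + 1) → ℕ} (ht : Function.Injective t)
    (hn : ∀ a, t a ≤ n) {S : Finset (Fin (n + 1))}
    (hS : S.Nonempty) {u : Fin (n + 1)} (hu : u ∉ S) :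
    ∃ d ∈ S, ∀ v ∈ S, ¬ InArc t d v u := by
  obtain ⟨d, hd, h⟩ := S.exists_min_image
    (fun v => if t v < t u then t u - t v else t u + (n + 1) - t v) hS
  refine ⟨d, hd, fun v hv hin => ?_⟩
  have h1 := h v hv
  have h2 := hn d
  have h3 := hn v
  have h4 : t d ≠ t u := fun e => hu (ht e ▸ hd)
  have h5 : t v ≠ t u := fun e => hu (ht e ▸ hv)
  unfold InArc at hin
  split_ifs at h1 <;> omega

theorem exists_nonCrossing_of_mem_seqPairs {t : Fin (n + 1) → ℕ} (ht : IsUnimodal t)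
    {A B : Finset (Fin (n + 1))} (h : (A, B) ∈ seqPairs n) :
    ∃ x, NonCrossing t x ∧ D x = A ∧ U x = B := by
  induction hm : B.card using Nat.strong_induction_on generalizing A B t with
  | _ m ih =>
    rcases B.eq_empty_or_nonempty with rfl | hne
    · obtain rfl := mem_seqPairs_empty.1 h
      refine ⟨1, fun a b hab => hab, ?_, U_eq_empty_iff.2 rfl⟩
      ext k
      simp only [mem_D_iff, sameCycle_one, Finset.notMem_empty, iff_false]
      rintro ⟨b, hb, rfl⟩
      exact lt_irrefl _ hb
    obtain ⟨u, hu, hmin⟩ : ∃ u ∈ B, ∀ v ∈ B, u ≤ v :=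
      ⟨_, B.min'_mem hne, fun v hv => B.min'_le v hv⟩
    have step : ∀ {t : Fin (n + 1) → ℕ}, IsUnimodal t →
        (∀ a b, a < u → u < b → InArc t a u b) → ∃ x, NonCrossing t x ∧ D x = A ∧ U x = B := by
      intro t ht hside
      obtain ⟨d₀, hd₀, hd₀u⟩ := exists_lt_of_mem_seqPairs h hu
      obtain ⟨d, hd, hclose⟩ := exists_closest_before ht.injective ht.le (S := A.filter (· < u))
        ⟨d₀, Finset.mem_filter.2 ⟨hd₀, hd₀u⟩⟩ (u := u) (by simp)
      obtain ⟨hdA, hdu⟩ := Finset.mem_filter.1 hd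
      have hcard := Finset.card_erase_of_mem hu
      have hpos := Finset.card_pos.2 ⟨u, hu⟩
      obtain ⟨y, hy, hyD, hyU⟩ := ih _ (by omega) ht
        ((mem_seqPairs_erase_iff hdA hu hdu hmin).1 h) rfl
      have hyfix : ∀ v, v ∉ A.erase d → v ∉ B.erase u → y v = v := by
        intro v h1 h2
        by_contra hv
        rcases exists_lt_or_gt_sameCycle hv with h | h
        · exact h1 (hyD ▸ h)
        · exact h2 (hyU ▸ h)
      have hB : ∀ v, v < u → v ∉ B.erase u := fun v hv hvB =>
        absurd hv (not_lt.2 (hmin v (Finset.mem_of_mem_erase hvB)))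
      have hyd : y d = d := hyfix d (by simp) (hB d hdu)
      -- A point between d and u is smaller than u, as larger points come after u. It is not in B by
      -- minimality, nor in A without d by the choice of d, so `y` fixes it and u is visible from d.
      have hx : NonCrossing t (swap d u * y) := by
        have := hy.swap_mul ht.injective hdu.ne (fun v hv => ?_) (by rw [hyd]; exact hdu.ne)
        · rwa [hyd] at this
        have hvu : v < u := by
          rcases lt_trichotomy v u with h | h | h
          · exact h
          · rw [h] at hv; unfold InArc at hv; omega
          · have := hside d v hdu h
            unfold InArc at hv this
            omega
        refine hyfix v (fun hvA => ?_) (hB v hvu)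
        exact hclose v (Finset.mem_filter.2 ⟨Finset.mem_of_mem_erase hvA, hvu⟩) hv
      have hxd : (swap d u * y) d = u := by rw [mul_apply, hyd, swap_apply_left]
      have hyx : y = swap d u * (swap d u * y) := by rw [swap_mul_self_mul]
      obtain ⟨k1, k2, k3, k4⟩ := D_U_bypass hxd hdu fun b hb => by
        by_contra! hbd
        have h1 : SameCycle y u b := by
          rw [hyx, sameCycle_bypass hxd]
          refine .inl ⟨hdu.ne', hbd.1, ?_⟩
          have := sameCycle_apply_left.2 hb
          rwa [hxd] at this
        have h2 : u ∈ U y := mem_U_iff.2 ⟨b, hbd.2, h1⟩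
        rw [hyU] at h2
        simp at h2
      rw [← hyx] at k1 k2
      refine ⟨_, hx, ?_, ?_⟩
      · rw [← Finset.insert_erase k3, ← k1, hyD, Finset.insert_erase hdA]
      · rw [← Finset.insert_erase k4, ← k2, hyU, Finset.insert_erase hu]
    rcases ht.sides u with hside | hside
    · exact step ht hside
    · obtain ⟨x, hx, h1, h2⟩ := step ht.rev
        (fun a b ha hb => by rw [inArc_rev ht.le]; exact hside a b ha hb)
      refine ⟨x⁻¹, ?_, by rw [D_inv, h1], by rw [U_inv, h2]⟩
      have := hx.inv ht.rev.le
      have e : (fun a => n - (n - t a)) = t := funext fun a => by have := ht.le a; omega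
      simp only [e] at this
      exact this

/-! ### The circle of a standard Coxeter element -/

/-- `c` runs once through the points up to `m`, in the order given by the positions `t`, first
increasing up to `m` and then decreasing, and fixes the other points. -/
structure IsUnimodalCycle (c : Perm (Fin (n + 1))) (m : ℕ) (t : Fin (n + 1) → ℕ) : Prop where
  inj : ∀ a b : Fin (n + 1), (a : ℕ) ≤ m → (b : ℕ) ≤ m → t a = t b → a = b
  zero : t 0 = 0
  le : ∀ a : Fin (n + 1), (a : ℕ) ≤ m → t a ≤ m
  fix : ∀ a : Fin (n + 1), m < (a : ℕ) → c a = a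
  step : ∀ a : Fin (n + 1), (a : ℕ) ≤ m → t (c a) = if t a = m then 0 else t a + 1
  up : ∀ p a b : Fin (n + 1), (p : ℕ) = m → a < b → (b : ℕ) ≤ m → t a ≤ t p → t b ≤ t p →
    t a < t b
  down : ∀ p a b : Fin (n + 1), (p : ℕ) = m → a < b → (b : ℕ) ≤ m → t p ≤ t a → t p ≤ t b →
    t b < t a

theorem IsUnimodalCycle.apply_le {c : Perm (Fin (n + 1))} {m : ℕ} {t : Fin (n + 1) → ℕ}
    (h : IsUnimodalCycle c m t) {a : Fin (n + 1)} (ha : (a : ℕ) ≤ m) : (c a : ℕ) ≤ m := by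
  by_contra hlt
  have := c.injective (h.fix (c a) (by omega))
  rw [this] at hlt
  exact hlt ha

/-- Multiplication on the right inserts the new maximum q just after the old maximum p, which puts p
on the increasing side. -/
theorem IsUnimodalCycle.mul_simpleRefl {c : Perm (Fin (n + 1))} {m : ℕ} {t : Fin (n + 1) → ℕ}
    (h : IsUnimodalCycle c m t) (hm : m < n) :
    ∃ t', IsUnimodalCycle (c * simpleRefl ⟨m, hm⟩) (m + 1) t' := by
  obtain ⟨p, hp⟩ : ∃ p : Fin (n + 1), (p : ℕ) = m := ⟨⟨m, by omega⟩, rfl⟩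
  obtain ⟨q, hq⟩ : ∃ q : Fin (n + 1), (q : ℕ) = m + 1 := ⟨⟨m + 1, by omega⟩, rfl⟩
  have htp := h.le p hp.le
  have hval : ∀ v : Fin (n + 1), simpleRefl ⟨m, hm⟩ v = if v = p then q else if v = q then p
      else v := by
    intro v
    ext
    rw [simpleRefl_apply_val]
    split_ifs <;> simp_all [Fin.ext_iff]
  have hpq : q ≠ p := by intro e; rw [Fin.ext_iff] at e; omega
  have hle : ∀ v : Fin (n + 1), (v : ℕ) ≤ m + 1 → v ≠ q → (v : ℕ) ≤ m := by
    intro v h1 h2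
    rw [ne_eq, Fin.ext_iff] at h2
    omega
  refine ⟨fun a => if a = q then t p + 1 else if t a ≤ t p then t a else t a + 1, ?_⟩
  constructor
  · intro a b ha hb hab
    by_cases haq : a = q <;> by_cases hbq : b = q
    · rw [haq, hbq]
    · rw [if_pos haq, if_neg hbq] at hab
      split_ifs at hab <;> omega
    · rw [if_neg haq, if_pos hbq] at hab
      split_ifs at hab <;> omega
    · rw [if_neg haq, if_neg hbq] at hab
      refine h.inj a b (hle a ha haq) (hle b hb hbq) ?_
      split_ifs at hab <;> omega
  · have h0 : (0 : Fin (n + 1)) ≠ q := by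
      intro e; rw [Fin.ext_iff, hq] at e; simp at e
    simp [h0, h.zero]
  · intro a ha
    by_cases haq : a = q
    · rw [if_pos haq]; omega
    · have := h.le a (hle a ha haq)
      rw [if_neg haq]
      split_ifs <;> omega
  · intro a ha
    have h1 : a ≠ p := by rintro rfl; omega
    have h2 : a ≠ q := by rintro rfl; omega
    rw [mul_apply, hval, if_neg h1, if_neg h2, h.fix a (by omega)]
  · intro a ha
    rw [mul_apply, hval]
    by_cases hap : a = p
    · subst hap
      rw [if_pos rfl, h.fix q (by omega)]
      simp only [if_true, hpq.symm, if_false, le_refl]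
      rw [if_neg (by omega)]
    rw [if_neg hap]
    by_cases haq : a = q
    · subst haq
      have h1 := h.step p hp.le
      have h2 : c p ≠ a := by
        have := h.apply_le hp.le
        rintro e; rw [e] at this; omega
      simp only [if_true, h2, if_false]
      split_ifs at h1 ⊢ <;> omega
    rw [if_neg haq]
    have ha' := hle a ha haq
    have h1 := h.step a ha'
    have h2 : c a ≠ q := by
      have := h.apply_le ha'
      rintro e; rw [e] at this; omega
    have h3 : t a ≠ t p := fun e => hap (h.inj a p ha' hp.le e)
    have h4 := h.le a ha'
    simp only [haq, h2, if_false]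
    split_ifs at h1 ⊢ <;> omega
  · intro r a b hr hab hb h1 h2
    obtain rfl : r = q := Fin.ext (by omega)
    have ha' : (a : ℕ) ≤ m := by rw [Fin.lt_def] at hab; omega
    have haq : a ≠ r := by rintro rfl; omega
    simp only [haq, if_true, if_false] at h1 h2 ⊢
    by_cases hbq : b = r
    · simp only [hbq, if_true] at h2 ⊢
      split_ifs at h1 ⊢ <;> omega
    · have := h.up p a b hp hab (hle b hb hbq)
      simp only [hbq, if_false] at h2 ⊢
      split_ifs at h1 h2 ⊢ <;> omega
  · intro r a b hr hab hb h1 h2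
    obtain rfl : r = q := Fin.ext (by omega)
    have ha' : (a : ℕ) ≤ m := by rw [Fin.lt_def] at hab; omega
    have haq : a ≠ r := by rintro rfl; omega
    simp only [haq, if_true, if_false] at h1 h2 ⊢
    by_cases hbq : b = r
    · simp only [hbq, if_true] at h2 ⊢
      split_ifs at h1 ⊢ <;> omega
    · have := h.down p a b hp hab (hle b hb hbq)
      simp only [hbq, if_false] at h2 ⊢
      split_ifs at h1 h2 ⊢ <;> omega

/-- Multiplication on the left inserts the new maximum q just before p, which puts p on the
decreasing side. For m = 0 this would displace the point 0 from position 0. -/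
theorem IsUnimodalCycle.simpleRefl_mul {c : Perm (Fin (n + 1))} {m : ℕ} {t : Fin (n + 1) → ℕ}
    (h : IsUnimodalCycle c m t) (hm : m < n) (hm0 : 0 < m) :
    ∃ t', IsUnimodalCycle (simpleRefl ⟨m, hm⟩ * c) (m + 1) t' := by
  obtain ⟨p, hp⟩ : ∃ p : Fin (n + 1), (p : ℕ) = m := ⟨⟨m, by omega⟩, rfl⟩
  obtain ⟨q, hq⟩ : ∃ q : Fin (n + 1), (q : ℕ) = m + 1 := ⟨⟨m + 1, by omega⟩, rfl⟩
  have htp := h.le p hp.le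
  have htp0 : t p ≠ 0 := by
    intro e
    have := h.inj p 0 hp.le (by simp) (e.trans h.zero.symm)
    rw [this] at hp
    simp at hp
    omega
  have hval : ∀ v : Fin (n + 1), simpleRefl ⟨m, hm⟩ v = if v = p then q else if v = q then p
      else v := by
    intro v
    ext
    rw [simpleRefl_apply_val]
    split_ifs <;> simp_all [Fin.ext_iff]
  have hpq : q ≠ p := by intro e; rw [Fin.ext_iff] at e; omega
  have hle : ∀ v : Fin (n + 1), (v : ℕ) ≤ m + 1 → v ≠ q → (v : ℕ) ≤ m := by
    intro v h1 h2
    rw [ne_eq, Fin.ext_iff] at h2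
    omega
  refine ⟨fun a => if a = q then t p else if t a < t p then t a else t a + 1, ?_⟩
  constructor
  · intro a b ha hb hab
    by_cases haq : a = q <;> by_cases hbq : b = q
    · rw [haq, hbq]
    · rw [if_pos haq, if_neg hbq] at hab
      split_ifs at hab <;> omega
    · rw [if_neg haq, if_pos hbq] at hab
      split_ifs at hab <;> omega
    · rw [if_neg haq, if_neg hbq] at hab
      refine h.inj a b (hle a ha haq) (hle b hb hbq) ?_
      split_ifs at hab <;> omega
  · have h0 : (0 : Fin (n + 1)) ≠ q := by
      intro e; rw [Fin.ext_iff, hq] at e; simp at e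
    simp [h0, h.zero, htp0, Nat.pos_iff_ne_zero]
  · intro a ha
    by_cases haq : a = q
    · rw [if_pos haq]; omega
    · have := h.le a (hle a ha haq)
      rw [if_neg haq]
      split_ifs <;> omega
  · intro a ha
    have h1 : a ≠ p := by rintro rfl; omega
    have h2 : a ≠ q := by rintro rfl; omega
    rw [mul_apply, h.fix a (by omega), hval, if_neg h1, if_neg h2]
  · intro a ha
    rw [mul_apply, hval]
    by_cases haq : a = q
    · subst haq
      rw [h.fix a (by omega), if_neg hpq, if_pos rfl]
      simp only [hpq.symm, if_false, lt_irrefl, if_true]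
      rw [if_neg (by omega)]
    have ha' := hle a ha haq
    have h1 := h.step a ha'
    have h4 := h.le a ha'
    have h2 : c a ≠ q := by
      have := h.apply_le ha'
      rintro e; rw [e] at this; omega
    by_cases hca : c a = p
    · rw [if_pos hca]
      rw [hca] at h1
      simp only [if_true, haq, if_false]
      split_ifs at h1 ⊢ <;> omega
    rw [if_neg hca, if_neg h2]
    have h3 : t (c a) ≠ t p := fun e => hca (h.inj _ p (h.apply_le ha') hp.le e)
    simp only [haq, h2, if_false]
    split_ifs at h1 ⊢ <;> omega
  · intro r a b hr hab hb h1 h2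
    obtain rfl : r = q := Fin.ext (by omega)
    have ha' : (a : ℕ) ≤ m := by rw [Fin.lt_def] at hab; omega
    have haq : a ≠ r := by rintro rfl; omega
    simp only [haq, if_true, if_false] at h1 h2 ⊢
    by_cases hbq : b = r
    · simp only [hbq, if_true] at h2 ⊢
      split_ifs at h1 ⊢ <;> omega
    · have := h.up p a b hp hab (hle b hb hbq)
      simp only [hbq, if_false] at h2 ⊢
      split_ifs at h1 h2 ⊢ <;> omega
  · intro r a b hr hab hb h1 h2
    obtain rfl : r = q := Fin.ext (by omega)
    have ha' : (a : ℕ) ≤ m := by rw [Fin.lt_def] at hab; omega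
    have haq : a ≠ r := by rintro rfl; omega
    simp only [haq, if_true, if_false] at h1 h2 ⊢
    by_cases hbq : b = r
    · simp only [hbq, if_true] at h2 ⊢
      split_ifs at h1 ⊢ <;> omega
    · have := h.down p a b hp hab (hle b hb hbq)
      simp only [hbq, if_false] at h2 ⊢
      split_ifs at h1 h2 ⊢ <;> omega

theorem exists_isUnimodalCycle (m : ℕ) (hm : m ≤ n) (l : List (Fin n)) (hl : l.Nodup)
    (hmem : ∀ i, i ∈ l ↔ (i : ℕ) < m) : ∃ t, IsUnimodalCycle (wordProd l) m t := by
  induction m generalizing l with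
  | zero =>
    obtain rfl : l = [] := List.eq_nil_iff_forall_not_mem.2 fun i hi => by
      have := (hmem i).1 hi; omega
    have h0 : ∀ a : Fin (n + 1), (a : ℕ) ≤ 0 → a = 0 := fun a ha => Fin.ext (by simpa using ha)
    refine ⟨fun _ => 0, ?_, rfl, fun _ _ => le_rfl, fun _ _ => rfl, fun _ _ => rfl, ?_, ?_⟩
    · intro a b ha hb _; rw [h0 a ha, h0 b hb]
    · intro p a b _ hab hb; rw [Fin.lt_def] at hab; omega
    · intro p a b _ hab hb; rw [Fin.lt_def] at hab; omega
  | succ m ih =>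
    have hml : (⟨m, hm⟩ : Fin n) ∈ l := (hmem _).2 (Nat.lt_succ_self m)
    obtain ⟨l₁, l₂, rfl⟩ := List.append_of_mem hml
    have hperm : (l₁ ++ ⟨m, hm⟩ :: l₂).Perm (⟨m, hm⟩ :: (l₁ ++ l₂)) := List.perm_middle
    have hnd := List.nodup_cons.1 (hperm.nodup_iff.1 hl)
    have hmem' : ∀ i, i ∈ l₁ ++ l₂ ↔ (i : ℕ) < m := by
      intro i
      have h1 := hmem i
      rw [hperm.mem_iff, List.mem_cons] at h1
      constructor
      · intro hi
        have := h1.1 (.inr hi)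
        have hne : i ≠ ⟨m, hm⟩ := by rintro rfl; exact hnd.1 hi
        rw [ne_eq, Fin.ext_iff] at hne
        simp only at hne
        omega
      · intro hi
        refine (h1.2 (by omega)).resolve_left ?_
        rintro rfl
        simp at hi
    obtain ⟨t, ht⟩ := ih (by omega) _ hnd.2 hmem'
    -- Among the remaining letters, s_m fails to commute only with s_{m-1}, so it can be moved to
    -- the end on its own side of that letter. For m = 0 the right end is chosen.
    by_cases hfirst : 0 < m ∧ ∀ i ∈ l₁, (i : ℕ) + 1 ≠ m
    · have e : wordProd (l₁ ++ ⟨m, hm⟩ :: l₂) = simpleRefl ⟨m, hm⟩ * wordProd (l₁ ++ l₂) := by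
        rw [← wordProd_cons]
        refine (CommEquiv.wordProd_eq (CommEquiv.cons_append (fun i hi => ?_) l₂)).symm
        have h1 := (hmem' i).1 (by simp [hi])
        have h2 := hfirst.2 i hi
        simp only
        omega
      rw [e]
      exact ht.simpleRefl_mul hm hfirst.1
    · have e : wordProd (l₁ ++ ⟨m, hm⟩ :: l₂) = wordProd (l₁ ++ l₂) * simpleRefl ⟨m, hm⟩ := by
        have h3 := CommEquiv.wordProd_eq
          (CommEquiv.cons_append (i := ⟨m, hm⟩) (l := l₂) (fun i hi => ?_) [])
        · rw [List.append_nil] at h3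
          rw [wordProd_append, h3, wordProd_append, wordProd_append, mul_assoc]
          simp [wordProd]
        have h1 := (hmem' i).1 (by simp [hi])
        simp only
        by_contra hlt
        refine hfirst ⟨by omega, fun j hj hjm => ?_⟩
        have : i = j := Fin.ext (by omega)
        subst this
        exact List.disjoint_of_nodup_append hnd.2 hj hi
      rw [e]
      exact ht.mul_simpleRefl hm

theorem IsCircular.mem_R_iff {c : Perm (Fin (n + 1))} {t : Fin (n + 1) → ℕ}
    (h : IsCircular c t) (k : Fin (n + 1)) : k ∈ R c ↔ t k ≤ t (Fin.last n) := by
  simp only [R, arc, Finset.mem_filter, Finset.mem_univ, true_and]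
  constructor
  · rintro ⟨j, rfl, hj⟩
    rw [h.pow_apply_zero (by omega)]
    by_contra hlt
    have hlt' : t (Fin.last n) < n + 1 := by have := h.le (Fin.last n); omega
    exact hj ⟨t (Fin.last n), hlt'⟩ (Fin.lt_def.2 (by simp only; omega)) (h.pow_eq _)
  · intro hk
    refine ⟨⟨t k, by have := h.le k; omega⟩, (h.pow_eq k).symm, fun m hm e => ?_⟩
    rw [Fin.lt_def] at hm
    simp only at hm
    rw [← e, h.pow_apply_zero (by omega)] at hk
    omega

theorem IsCircular.mem_L_iff {c : Perm (Fin (n + 1))} {t : Fin (n + 1) → ℕ}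
    (h : IsCircular c t) (k : Fin (n + 1)) : k ∈ L c ↔ t (Fin.last n) ≤ t k ∨ k = 0 := by
  have hlast := h.le (Fin.last n)
  have hpow : ∀ m : ℕ, (c ^ m) (Fin.last n) = (c ^ (m + t (Fin.last n))) 0 := fun m => by
    rw [pow_add, mul_apply, h.pow_eq]
  have hfull : (c ^ (n + 1)) 0 = 0 := by
    refine h.injective ?_
    rw [pow_succ', mul_apply, h.step, h.pow_apply_zero le_rfl, if_pos rfl, h.zero]
  have h0 : t (Fin.last n) = 0 → n = 0 := fun e => by
    have := h.injective (e.trans h.zero.symm)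
    rw [Fin.ext_iff] at this
    simpa using this
  simp only [L, arc, Finset.mem_filter, Finset.mem_univ, true_and]
  constructor
  · rintro ⟨j, rfl, hj⟩
    by_cases hjn : (j : ℕ) + t (Fin.last n) ≤ n
    · left
      rw [hpow, h.pow_apply_zero hjn]
      omega
    -- The walk from the last point has passed position n; the first-visit condition stops it at 0,
    -- which it meets after `n + 1 - t (Fin.last n)` steps.
    · right
      have : (j : ℕ) + t (Fin.last n) = n + 1 := by
        by_contra hne
        refine hj ⟨n + 1 - t (Fin.last n), by omega⟩ (Fin.lt_def.2 (by simp only; omega)) ?_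
        rw [hpow]
        simp only
        rw [Nat.sub_add_cancel (by omega), hfull]
      rw [hpow, this, hfull]
  · intro hk
    by_cases hle : t (Fin.last n) ≤ t k
    · have hkn := h.le k
      refine ⟨⟨t k - t (Fin.last n), by omega⟩, ?_, fun m hm e => ?_⟩
      · rw [hpow]
        simp only
        rw [Nat.sub_add_cancel hle, h.pow_eq]
      · rw [Fin.lt_def] at hm
        simp only at hm
        have := congrArg t e
        rw [hpow, h.pow_apply_zero (by omega), h.zero] at this
        have := h0 (by omega)
        omega
    · obtain rfl := hk.resolve_left hle
      rw [h.zero] at hle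
      refine ⟨⟨n + 1 - t (Fin.last n), by omega⟩, ?_, fun m hm e => ?_⟩
      · rw [hpow]
        simp only
        rw [Nat.sub_add_cancel (by omega), hfull]
      · rw [Fin.lt_def] at hm
        simp only at hm
        have := congrArg t e
        rw [hpow, h.pow_apply_zero (by omega), h.zero] at this
        omega

/-- Positions follow increasing labels up to n + 1 and decreasing labels afterwards. Hence an
intermediate label on the left is met when passing clockwise from a larger label to a smaller one,
and on the right from a smaller to a larger. -/
theorem IsStdCoxeter.exists_circle {c : Perm (Fin (n + 1))} (hc : IsStdCoxeter c) :
    ∃ t, IsCircular c t ∧ IsUnimodal t ∧ (∀ k, k ∈ R c ∨ k ∈ L c) ∧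
      (∀ k, k ∈ R c → k ∈ L c → k = 0 ∨ k = Fin.last n) ∧
      ∀ k ∈ L c, ∀ a b, a < k → k < b → InArc t b k a := by
  obtain ⟨l, hl, hmem, rfl⟩ := hc
  obtain ⟨t, ht⟩ := exists_isUnimodalCycle n le_rfl l hl fun i => by simp [hmem i]
  have hn : ∀ a : Fin (n + 1), (a : ℕ) ≤ n := fun a => by omega
  have hcirc : IsCircular (wordProd l) t :=
    ⟨fun a b => ht.inj a b (hn a) (hn b), ht.zero, fun a => ht.le a (hn a),
      fun a => ht.step a (hn a)⟩
  have hup := fun a b hab => ht.up (Fin.last n) a b rfl hab (hn b)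
  have hdown := fun a b hab => ht.down (Fin.last n) a b rfl hab (hn b)
  have hlt : ∀ k b, k < b → t k ≠ t (Fin.last n) := fun k b hkb e =>
    absurd (hcirc.injective e ▸ hkb) (not_lt.2 (Fin.le_last b))
  have hL : ∀ k, t (Fin.last n) ≤ t k → ∀ a b, a < k → k < b → InArc t b k a := by
    intro k hk a b ha hb
    have h1 := hup a b (ha.trans hb)
    have h2 := hdown a k ha
    have h3 := hdown k b hb
    have h4 := hlt k b hb
    have h5 := hlt a k ha
    unfold InArc
    omega
  have hR : ∀ k, t k ≤ t (Fin.last n) → ∀ a b, a < k → k < b → InArc t a k b := by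
    intro k hk a b ha hb
    have h1 := hup a k ha
    have h2 := hdown a b (ha.trans hb)
    have h3 := hup k b hb
    have h4 := hlt k b hb
    have h5 := hlt a k ha
    unfold InArc
    omega
  refine ⟨t, hcirc, ⟨hcirc.injective, hcirc.le, fun k => ?_⟩, fun k => ?_, fun k h1 h2 => ?_,
    fun k hk a b ha hb => ?_⟩
  · exact (le_total (t k) (t (Fin.last n))).imp (hR k) (hL k)
  · rw [hcirc.mem_R_iff, hcirc.mem_L_iff]
    exact (le_total _ _).imp id .inl
  · rw [hcirc.mem_R_iff] at h1
    rw [hcirc.mem_L_iff] at h2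
    rcases h2 with h2 | h2
    · exact .inr (hcirc.injective (le_antisymm h1 h2))
    · exact .inl h2
  · rw [hcirc.mem_L_iff] at hk
    refine hL k (hk.resolve_right ?_) a b ha hb
    rintro rfl
    exact absurd ha (not_lt.2 (Fin.zero_le a))

/-! ### Crossing polygons -/

theorem IsCircular.pow_apply {c : Perm (Fin (n + 1))} {t : Fin (n + 1) → ℕ}
    (h : IsCircular c t) (a : Fin (n + 1)) {k : ℕ} (hk : k ≤ n) :
    t ((c ^ k) a) = if t a + k ≤ n then t a + k else t a + k - (n + 1) := by
  have ha := h.le a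
  induction k with
  | zero => rw [pow_zero, one_apply]; split_ifs <;> omega
  | succ k ih =>
    rw [pow_succ', mul_apply, h.step, ih (by omega)]
    split_ifs <;> omega

theorem IsCircular.exists_pow_eq {c : Perm (Fin (n + 1))} {t : Fin (n + 1) → ℕ}
    (h : IsCircular c t) (a b : Fin (n + 1)) : ∃ p : Fin (n + 1), (c ^ (p : ℕ)) a = b ∧
      (p : ℕ) = if t a ≤ t b then t b - t a else t b + (n + 1) - t a := by
  have ha := h.le a
  have hb := h.le b
  refine ⟨⟨if t a ≤ t b then t b - t a else t b + (n + 1) - t a, by split_ifs <;> omega⟩, ?_, rfl⟩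
  refine h.injective ?_
  rw [h.pow_apply a (by simp only; split_ifs <;> omega)]
  simp only
  split_ifs <;> omega

theorem IsCircular.crossing_iff {c : Perm (Fin (n + 1))} {t : Fin (n + 1) → ℕ}
    (h : IsCircular c t) {A B : Finset (Fin (n + 1))} :
    Crossing c A B ↔ ∃ a ∈ A, ∃ a' ∈ A, ∃ b ∈ B, ∃ b' ∈ B, a ≠ a' ∧
      InArc t a b a' ∧ InArc t a' b' a := by
  constructor
  · rintro ⟨a, ha, p, q, r, hp, hpq, hqr, hb, ha', hb'⟩
    have h0 := h.le a
    have h1 := h.pow_apply a (k := p) (by omega)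
    have h2 := h.pow_apply a (k := q) (by omega)
    have h3 := h.pow_apply a (k := r) (by omega)
    rw [Fin.lt_def] at hp hpq hqr
    rw [Fin.val_zero] at hp
    have hr : (r : ℕ) ≤ n := by omega
    refine ⟨a, ha, _, ha', _, hb, _, hb', fun e => ?_, ?_, ?_⟩
    · rw [← e] at h2
      split_ifs at h2 <;> omega
    · unfold InArc
      split_ifs at h1 h2 <;> omega
    · unfold InArc
      split_ifs at h3 h2 <;> omega
  · rintro ⟨a, ha, a', ha', b, hb, b', hb', hne, h1, h2⟩
    have hne' : t a ≠ t a' := fun e => hne (h.injective e)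
    obtain ⟨p, hp, hp'⟩ := h.exists_pow_eq a b
    obtain ⟨q, hq, hq'⟩ := h.exists_pow_eq a a'
    obtain ⟨r, hr, hr'⟩ := h.exists_pow_eq a b'
    have l1 := h.le a; have l2 := h.le a'; have l3 := h.le b; have l4 := h.le b'
    refine ⟨a, ha, p, q, r, ?_, ?_, ?_, hp ▸ hb, hq ▸ ha', hr ▸ hb'⟩
    · rw [Fin.lt_def, Fin.val_zero, hp']
      unfold InArc at h1 h2
      split_ifs <;> omega
    · rw [Fin.lt_def, hp', hq']
      unfold InArc at h1 h2
      split_ifs <;> omega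
    · rw [Fin.lt_def, hq', hr']
      unfold InArc at h1 h2
      split_ifs <;> omega

theorem IsCircular.crossing_symm {c : Perm (Fin (n + 1))} {t : Fin (n + 1) → ℕ}
    (h : IsCircular c t) {A B : Finset (Fin (n + 1))} (hAB : Crossing c A B) :
    Crossing c B A := by
  rw [h.crossing_iff] at *
  obtain ⟨a, ha, a', ha', b, hb, b', hb', hne, h1, h2⟩ := hAB
  have hne' : t a ≠ t a' := fun e => hne (h.injective e)
  refine ⟨b, hb, b', hb', a', ha', a, ha, ?_, ?_, ?_⟩
  · rintro rfl
    unfold InArc at h1 h2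
    omega
  · unfold InArc at *
    omega
  · unfold InArc at *
    omega

theorem IsCircular.crossing_mono {c : Perm (Fin (n + 1))} {t : Fin (n + 1) → ℕ}
    (h : IsCircular c t) {A B A' B' : Finset (Fin (n + 1))} (hA : A ⊆ A') (hB : B ⊆ B')
    (hAB : Crossing c A B) : Crossing c A' B' := by
  rw [h.crossing_iff] at *
  obtain ⟨a, ha, a', ha', b, hb, b', hb', h⟩ := hAB
  exact ⟨a, hA ha, a', hA ha', b, hB hb, b', hB hb', h⟩

theorem exists_closest_after {t : Fin (n + 1) → ℕ} (ht : Function.Injective t)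
    (hn : ∀ a, t a ≤ n) {S : Finset (Fin (n + 1))}
    (hS : S.Nonempty) {u : Fin (n + 1)} (hu : u ∉ S) :
    ∃ d ∈ S, ∀ v ∈ S, ¬ InArc t u v d := by
  obtain ⟨d, hd, h⟩ := exists_closest_before (t := fun a => n - t a) (fun a b hab => ht (by
    have := hn a; have := hn b
    simp only at hab
    omega)) (fun a => Nat.sub_le _ _) hS hu
  refine ⟨d, hd, fun v hv => ?_⟩
  rw [← inArc_rev hn]
  exact h v hv

theorem NonCrossing.not_crossing {c : Perm (Fin (n + 1))} {t : Fin (n + 1) → ℕ}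
    (hc : IsCircular c t) {x : Perm (Fin (n + 1))} (hx : NonCrossing t x)
    {P Q : Finset (Fin (n + 1))} (hP : P ∈ Pol x) (hQ : Q ∈ Pol x) (hPQ : Disjoint P Q) :
    ¬ Crossing c P Q := by
  rw [hc.crossing_iff]
  rintro ⟨a, ha, a', ha', b, hb, b', hb', hne, h1, h2⟩
  have hbP : b ∉ P := fun h => Finset.disjoint_left.1 hPQ h hb
  obtain ⟨d, hd, h⟩ := exists_closest_before hc.injective hc.le ⟨a, ha⟩ hbP
  have hsame := sameCycle_of_mem_Pol hP hd
  have hxd : x d ∈ P := (hsame _).2 ⟨1, by simp⟩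
  have e1 := h _ hxd
  have e2 : t (x d) ≠ t b := fun e => hbP (hc.injective e ▸ hxd)
  have e3 : t (x d) ≠ t d := fun e => apply_ne_of_mem_Pol hP hd (hc.injective e)
  have e4 : t d ≠ t b := fun e => hbP (hc.injective e ▸ hd)
  -- As d is the last vertex of P before b, the point b lies under the edge from d to `x d`, and all
  -- of Q with it. The vertices a and a' are outside this open arc and cannot separate b from b'.
  have e5 : InArc t d b (x d) := by
    unfold InArc at *
    omega
  have e6 := hx.sameCycle e5 ((sameCycle_of_mem_Pol hQ hb b').1 hb')
  have e7 := hx.not_inArc ((hsame a).1 ha)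
  have e8 := hx.not_inArc ((hsame a').1 ha')
  have e9 : t a ≠ t a' := fun e => hne (hc.injective e)
  clear e1
  unfold InArc at *
  omega

theorem disjoint_of_mem_Pol {x : Perm (Fin (n + 1))} {P Q : Finset (Fin (n + 1))}
    (hP : P ∈ Pol x) (hQ : Q ∈ Pol x) (hPQ : P ≠ Q) : Disjoint P Q := by
  rw [Finset.disjoint_left]
  intro a ha hb
  refine hPQ ?_
  ext v
  rw [sameCycle_of_mem_Pol hP ha, sameCycle_of_mem_Pol hQ hb]

/-! ### The permutation represented by a system of polygons -/

theorem formPerm_spec {t : Fin (n + 1) → ℕ} {l : List (Fin (n + 1))}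
    (hl : l.Pairwise fun a b => t a < t b) {a : Fin (n + 1)} (ha : a ∈ l) :
    l.formPerm a ∈ l ∧ ∀ b ∈ l, ¬ InArc t a b (l.formPerm a) := by
  have hnd : l.Nodup := hl.imp (S := (· ≠ ·)) fun {a b} hab e => by
    subst e; exact lt_irrefl _ hab
  refine ⟨List.formPerm_apply_mem_of_mem ha, fun b hb => ?_⟩
  obtain ⟨i, hi, rfl⟩ := List.getElem_of_mem ha
  obtain ⟨j, hj, rfl⟩ := List.getElem_of_mem hb
  rw [List.formPerm_apply_getElem l hnd i hi]
  have hmono : ∀ i j (hi : i < l.length) (hj : j < l.length), i < j → t l[i] < t l[j] :=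
    fun i j hi hj h => List.pairwise_iff_getElem.1 hl i j hi hj h
  have hmono' : ∀ i j (hi : i < l.length) (hj : j < l.length), i ≤ j → t l[i] ≤ t l[j] :=
    fun i j hi hj h => by
      rcases h.eq_or_lt with rfl | h
      · exact le_rfl
      · exact (hmono i j hi hj h).le
  by_cases hlast : i + 1 < l.length
  · simp only [Nat.mod_eq_of_lt hlast]
    have h1 := hmono i (i + 1) hi hlast (by omega)
    have h2 : j ≤ i ∨ i + 1 ≤ j := by omega
    rcases h2 with h2 | h2
    · have := hmono' j i hj hi h2
      unfold InArc; omega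
    · have := hmono' (i + 1) j hlast hj h2
      unfold InArc; omega
  · have hli : i + 1 = l.length := by omega
    simp only [hli, Nat.mod_self]
    have h1 := hmono' 0 j (by omega) hj (by omega)
    have h2 := hmono' j i hj hi (by omega)
    unfold InArc; omega

theorem IsCircular.polygonCycle_spec {c : Perm (Fin (n + 1))} {t : Fin (n + 1) → ℕ}
    (h : IsCircular c t) (P : Finset (Fin (n + 1))) :
    (∀ a ∉ P, polygonCycle c P a = a) ∧
      ∀ a ∈ P, polygonCycle c P a ∈ P ∧ ∀ b ∈ P, ¬ InArc t a b (polygonCycle c P a) := by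
  have hmem : ∀ a, a ∈ ((List.range (n + 1)).map (fun j => (c ^ j) 0)).filter (fun i => i ∈ P) ↔
      a ∈ P := by
    intro a
    simp only [List.mem_filter, List.mem_map, List.mem_range, decide_eq_true_eq,
      and_iff_right_iff_imp]
    exact fun _ => ⟨t a, by have := h.le a; omega, h.pow_eq a⟩
  have hpw : (((List.range (n + 1)).map (fun j => (c ^ j) 0)).filter
      (fun i => i ∈ P)).Pairwise fun a b => t a < t b := by
    refine List.Pairwise.filter _ (List.pairwise_map.2 ?_)
    refine List.Pairwise.imp_of_mem ?_ List.pairwise_lt_range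
    intro i j hi hj hij
    rw [List.mem_range] at hi hj
    rwa [h.pow_apply_zero (by omega), h.pow_apply_zero (by omega)]
  refine ⟨fun a ha => List.formPerm_apply_of_notMem fun hm => ha ((hmem a).1 hm), fun a ha => ?_⟩
  obtain ⟨h1, h2⟩ := formPerm_spec hpw ((hmem a).2 ha)
  exact ⟨(hmem _).1 h1, fun b hb => h2 b ((hmem b).2 hb)⟩

theorem prod_map_apply_of_disjoint {α : Type*} [DecidableEq α] {f : Finset α → Perm α}
    (hf : ∀ P, ∀ a ∉ P, f P a = a) (hf' : ∀ P, ∀ a ∈ P, f P a ∈ P) (l : List (Finset α))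
    (hl : l.Pairwise fun P Q : Finset α => Disjoint P Q) :
    (∀ a, (∀ P ∈ l, a ∉ P) → (l.map f).prod a = a) ∧
      ∀ P ∈ l, ∀ a ∈ P, (l.map f).prod a = f P a := by
  induction l with
  | nil => simp
  | cons Q l ih =>
    rw [List.pairwise_cons] at hl
    obtain ⟨h1, h2⟩ := ih hl.2
    rw [List.map_cons, List.prod_cons]
    refine ⟨fun a ha => ?_, fun P hP a ha => ?_⟩
    · rw [mul_apply, h1 a fun P hP => ha P (List.mem_cons_of_mem _ hP), hf _ _ (ha Q (by simp))]
    · rcases List.mem_cons.1 hP with rfl | hP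
      · rw [mul_apply, h1 a fun R hR haR => Finset.disjoint_left.1 (hl.1 R hR) ha haR]
      · rw [mul_apply, h2 P hP a ha, hf]
        exact fun hQ => Finset.disjoint_left.1 (hl.1 P hP) hQ (hf' P a ha)

theorem IsCircular.diagramPerm_spec {c : Perm (Fin (n + 1))} {t : Fin (n + 1) → ℕ}
    (h : IsCircular c t) {S : Finset (Finset (Fin (n + 1)))}
    (hS : ∀ P ∈ S, ∀ Q ∈ S, P ≠ Q → Disjoint P Q) :
    (∀ a, (∀ P ∈ S, a ∉ P) → diagramPerm c S a = a) ∧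
      ∀ P ∈ S, ∀ a ∈ P, diagramPerm c S a ∈ P ∧
        ∀ b ∈ P, ¬ InArc t a b (diagramPerm c S a) := by
  obtain ⟨h1, h2⟩ := prod_map_apply_of_disjoint (f := polygonCycle c)
    (fun P => (h.polygonCycle_spec P).1) (fun P a ha => ((h.polygonCycle_spec P).2 a ha).1)
    S.toList (by
      refine List.Pairwise.imp_of_mem ?_ S.nodup_toList
      intro P Q hP hQ hne
      exact hS P (by simpa using hP) Q (by simpa using hQ) hne)
  refine ⟨fun a ha => h1 a fun P hP => ha P (by simpa using hP), fun P hP a ha => ?_⟩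
  have := h2 P (by simpa using hP) a ha
  rw [diagramPerm, this]
  exact (h.polygonCycle_spec P).2 a ha

theorem IsCircular.nonCrossing_diagramPerm {c : Perm (Fin (n + 1))} {t : Fin (n + 1) → ℕ}
    (h : IsCircular c t) {S : Finset (Finset (Fin (n + 1)))}
    (hS : ∀ P ∈ S, ∀ Q ∈ S, P ≠ Q → Disjoint P Q ∧ ¬ Crossing c P Q) :
    NonCrossing t (diagramPerm c S) := by
  obtain ⟨h1, h2⟩ := h.diagramPerm_spec fun P hP Q hQ hne => (hS P hP Q hQ hne).1
  set y := diagramPerm c S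
  intro a b hab
  have hba : b ≠ a := by
    rintro rfl
    unfold InArc at hab
    omega
  have hyne : t (y b) ≠ t (y a) := fun e => hba (y.injective (h.injective e))
  by_cases hya : y a = a
  · rw [hya] at hyne ⊢
    unfold InArc
    omega
  obtain ⟨P, hP, haP⟩ : ∃ P ∈ S, a ∈ P := by
    by_contra! hno
    exact hya (h1 a hno)
  obtain ⟨hyP, hP2⟩ := h2 P hP a haP
  have hbP : b ∉ P := fun hb => hP2 b hb hab
  by_cases hyb : y b = b
  · rwa [hyb]
  obtain ⟨Q, hQ, hbQ⟩ : ∃ Q ∈ S, b ∈ Q := by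
    by_contra! hno
    exact hyb (h1 b hno)
  have hPQ : P ≠ Q := by rintro rfl; exact hbP hbQ
  obtain ⟨hdisj, hcross⟩ := hS P hP Q hQ hPQ
  have hyQ := (h2 Q hQ b hbQ).1
  have hyba : t (y b) ≠ t a := fun e =>
    Finset.disjoint_left.1 hdisj haP (h.injective e ▸ hyQ)
  have hyaa : t (y a) ≠ t a := fun e => hya (h.injective e)
  by_contra hno
  refine hcross (h.crossing_iff.2 ⟨a, haP, y a, hyP, b, hbQ, y b, hyQ, Ne.symm hya, hab, ?_⟩)
  unfold InArc at *
  omega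

/-- The point is that an orbit visits its whole polygon. If it missed b, its point d nearest before
b would have to step over b, while edges skip no vertex. -/
theorem IsCircular.sameCycle_diagramPerm_iff {c : Perm (Fin (n + 1))} {t : Fin (n + 1) → ℕ}
    (h : IsCircular c t) {S : Finset (Finset (Fin (n + 1)))}
    (hS : ∀ P ∈ S, ∀ Q ∈ S, P ≠ Q → Disjoint P Q) (a b : Fin (n + 1)) :
    SameCycle (diagramPerm c S) a b ↔ a = b ∨ ∃ P ∈ S, a ∈ P ∧ b ∈ P := by
  classical
  obtain ⟨h1, h2⟩ := h.diagramPerm_spec hS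
  set y := diagramPerm c S
  constructor
  · intro hab
    by_cases hP : ∃ P ∈ S, a ∈ P
    · obtain ⟨P, hP, haP⟩ := hP
      refine .inr ⟨P, hP, haP, ?_⟩
      obtain ⟨k, rfl⟩ := hab.exists_nat_pow_eq
      clear hab
      induction k with
      | zero => exact haP
      | succ k ih => rw [pow_succ', mul_apply]; exact (h2 P hP _ ih).1
    · push Not at hP
      exact .inl (hab.eq_of_left (h1 a hP))
  · rintro (rfl | ⟨P, hP, ha, hb⟩)
    · exact .refl _ _
    by_contra hab
    obtain ⟨d, hd, hclose⟩ := exists_closest_before h.injective h.le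
      (S := P.filter fun v => SameCycle y a v) ⟨a, Finset.mem_filter.2 ⟨ha, .refl _ _⟩⟩ (u := b)
      fun hbS => hab (Finset.mem_filter.1 hbS).2
    obtain ⟨hdP, had⟩ := Finset.mem_filter.1 hd
    obtain ⟨hyP, hno⟩ := h2 P hP d hdP
    have hyd : SameCycle y a (y d) := sameCycle_apply_right.2 had
    have e1 := hclose (y d) (Finset.mem_filter.2 ⟨hyP, hyd⟩)
    have e2 := hno b hb
    have e3 : t (y d) ≠ t b := fun e => hab (h.injective e ▸ hyd)
    have e4 : t d ≠ t b := fun e => hab (h.injective e ▸ had)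
    unfold InArc at *
    omega

/-! ### Enlarging polygons -/

/-- Among the polygons in which k is nested, the right one owns the first vertex p met clockwise
after k. The map `F` allows the statement to be used on a partly enlarged diagram. -/
theorem IsCircular.exists_enlargeable {c : Perm (Fin (n + 1))} {t : Fin (n + 1) → ℕ}
    (h : IsCircular c t) {S : Finset (Finset (Fin (n + 1)))}
    {F : Finset (Fin (n + 1)) → Finset (Fin (n + 1))}
    (hS : ∀ P ∈ S, ∀ Q ∈ S, P ≠ Q → Disjoint (F P) (F Q) ∧ ¬ Crossing c (F P) (F Q))
    {k : Fin (n + 1)} (hk : ∀ a b, a < k → k < b → InArc t b k a) (hkS : ∀ P ∈ S, k ∉ F P)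
    (hex : ∃ P ∈ S, Nested k (F P)) :
    ∃ P ∈ S, Nested k (F P) ∧ ∀ Q ∈ S, Q ≠ P → ¬ Crossing c (insert k (F P)) (F Q) := by
  classical
  obtain ⟨p, hp, hclose⟩ := exists_closest_after h.injective h.le
    (S := Finset.univ.filter fun v => ∃ P ∈ S, Nested k (F P) ∧ v ∈ F P) (u := k) (by
      obtain ⟨P, hP, hN⟩ := hex
      obtain ⟨a, ha, -⟩ := hN.2.1
      exact ⟨a, by simp only [Finset.mem_filter, Finset.mem_univ, true_and]; exact ⟨P, hP, hN, ha⟩⟩)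
    (by
      simp only [Finset.mem_filter, Finset.mem_univ, true_and]
      rintro ⟨P, hP, -, hkP⟩
      exact hkS P hP hkP)
  simp only [Finset.mem_filter, Finset.mem_univ, true_and] at hp hclose
  obtain ⟨P, hP, hN, hpP⟩ := hp
  refine ⟨P, hP, hN, fun Q hQ hQP hcr => ?_⟩
  obtain ⟨hdisj, hncr⟩ := hS P hP Q hQ hQP.symm
  have key : ∀ a' ∈ F P, ∀ b ∈ F Q, ∀ b' ∈ F Q, InArc t k b a' → InArc t a' b' k → False := by
    intro a' ha' b hb b' hb' h1 h2
    have hne : ∀ {v}, v ∈ F P → ∀ {w}, w ∈ F Q → t v ≠ t w := fun hv _ hw e =>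
      Finset.disjoint_left.1 hdisj hv (h.injective e ▸ hw)
    have hkP : ∀ {v}, v ∈ F P → t v ≠ t k := fun hv e => hkS P hP (h.injective e ▸ hv)
    have hkQ : ∀ {v}, v ∈ F Q → v ≠ k := fun hv e => hkS Q hQ (e ▸ hv)
    obtain ⟨-, ⟨l, hl, hlk⟩, ⟨u, hu, hku⟩⟩ := hN
    have n1 := hkP ha'
    have n2 := hkP hpP
    have n3 := hne hpP hb
    have n4 := hne ha' hb
    have n5 := hne ha' hb'
    have n6 := hne hpP hb'
    -- If b comes after p, the chord from p to a' already crosses Q.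
    have conclude : InArc t k p b → False := fun hkpb => by
      refine hncr (h.crossing_iff.2 ⟨p, hpP, a', ha', b, hb, b', hb', ?_, ?_, ?_⟩)
      · rintro rfl
        unfold InArc at *
        omega
      · clear hclose
        unfold InArc at *
        omega
      · clear hclose
        unfold InArc at *
        omega
    by_cases hNQ : Nested k (F Q)
    · have := hclose b ⟨Q, hQ, hNQ, hb⟩
      refine conclude ?_
      clear conclude
      unfold InArc at *
      omega
    -- After k one meets smaller labels before larger ones, and P has a vertex below k.
    have hpk : p < k := by
      by_contra hpk
      have hpk' : k < p := lt_of_le_of_ne (not_lt.1 hpk) fun e => n2 (by rw [e])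
      have e1 := hclose l ⟨P, hP, ⟨hkS P hP, ⟨l, hl, hlk⟩, ⟨u, hu, hku⟩⟩, hl⟩
      have e2 := hk l p hlk hpk'
      have e3 := hkP hl
      have e4 : t l ≠ t p := fun e => (hlk.trans hpk').ne (h.injective e)
      unfold InArc at e1 e2
      omega
    -- Not surrounding k, the polygon Q has all its labels below or all above k. Below, a' and a
    -- larger vertex u of P separate b from b'; above, b comes after p.
    rcases lt_or_gt_of_ne (hkQ hb) with hbk | hbk
    · rcases lt_or_gt_of_ne (hkQ hb') with hbk' | hbk'
      · have e1 := hk b' u hbk' hku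
        have n7 := hne hu hb
        have n8 := hne hu hb'
        refine hncr (h.crossing_iff.2 ⟨a', ha', u, hu, b', hb', b, hb, ?_, ?_, ?_⟩)
        · rintro rfl
          unfold InArc at h1 h2 e1
          omega
        · clear hclose conclude
          unfold InArc at *
          omega
        · clear hclose conclude
          unfold InArc at *
          omega
      · exact hNQ ⟨hkS Q hQ, ⟨b, hb, hbk⟩, ⟨b', hb', hbk'⟩⟩
    · refine conclude ?_
      have := hk p b hpk hbk
      unfold InArc at this ⊢
      omega
  obtain ⟨a, ha, a', ha', b, hb, b', hb', hne, h1, h2⟩ := h.crossing_iff.1 hcr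
  rcases Finset.mem_insert.1 ha with rfl | haP
  · exact key a' ((Finset.mem_insert.1 ha').resolve_left hne.symm) b hb b' hb' h1 h2
  · rcases Finset.mem_insert.1 ha' with rfl | haP'
    · exact key a haP b' hb' b hb h2 h1
    · exact hncr (h.crossing_iff.2 ⟨a, haP, a', haP', b, hb, b', hb', hne, h1, h2⟩)

/-- Take a vertex of each polygon below k. The chord from k to the one met later separates the one
met first from a larger vertex of the same polygon. -/
theorem IsCircular.enlargeable_unique {c : Perm (Fin (n + 1))} {t : Fin (n + 1) → ℕ}
    (h : IsCircular c t) {P Q : Finset (Fin (n + 1))} {k : Fin (n + 1)}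
    (hk : ∀ a b, a < k → k < b → InArc t b k a) (hdisj : Disjoint P Q) (hP : Nested k P)
    (hQ : Nested k Q) (hPQ : ¬ Crossing c (insert k P) Q) (hQP : ¬ Crossing c (insert k Q) P) :
    False := by
  obtain ⟨hkP, ⟨a, ha, hak⟩, ⟨a', ha', hka⟩⟩ := hP
  obtain ⟨hkQ, ⟨b, hb, hbk⟩, ⟨b', hb', hkb⟩⟩ := hQ
  have n1 : t a ≠ t b := fun e => Finset.disjoint_left.1 hdisj ha (h.injective e ▸ hb)
  have h1 := hk a a' hak hka
  have h2 := hk a b' hak hkb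
  have h3 := hk b a' hbk hka
  have h4 := hk b b' hbk hkb
  have n2 : t a ≠ t a' := fun e => (hak.trans hka).ne (h.injective e)
  have n3 : t a ≠ t b' := fun e => (hak.trans hkb).ne (h.injective e)
  have n4 : t b ≠ t a' := fun e => (hbk.trans hka).ne (h.injective e)
  have n5 : t b ≠ t b' := fun e => (hbk.trans hkb).ne (h.injective e)
  by_cases hab : InArc t k a b
  · refine hQP (h.crossing_iff.2 ⟨k, by simp, b, by simp [hb], a, ha, a', ha', ?_, hab, ?_⟩)
    · rintro rfl; exact hkQ hb
    · unfold InArc at *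
      omega
  · refine hPQ (h.crossing_iff.2 ⟨k, by simp, a, by simp [ha], b, hb, b', hb', ?_, ?_, ?_⟩)
    · rintro rfl; exact hkP ha
    · unfold InArc at *
      omega
    · unfold InArc at *
      omega

/-! ### The diagram of `invol c x` -/

/-- The polygon `P` of `x` enlarged by the points of `K` which enlarge it. -/
def enlargeBy (c x : Perm (Fin (n + 1))) (K P : Finset (Fin (n + 1))) : Finset (Fin (n + 1)) :=
  P ∪ K.filter fun k => Enlarges c x P k

/-- The polygon of `invol c x` which replaces the polygon `P` of `x`. -/
def invPolygon (c x : Perm (Fin (n + 1))) (P : Finset (Fin (n + 1))) : Finset (Fin (n + 1)) :=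
  enlargeBy c x (N c x) P \ M c x

theorem mem_enlargeBy {c x : Perm (Fin (n + 1))} {K P : Finset (Fin (n + 1))} {a : Fin (n + 1)} :
    a ∈ enlargeBy c x K P ↔ a ∈ P ∨ (a ∈ K ∧ Enlarges c x P a) := by
  rw [enlargeBy, Finset.mem_union, Finset.mem_filter]

theorem mem_invPol_iff {c x : Perm (Fin (n + 1))} {Q : Finset (Fin (n + 1))} :
    Q ∈ invPol c x ↔ ∃ P ∈ Pol x, invPolygon c x P = Q := by
  simp only [invPol, enlargedPol, Finset.mem_image, exists_exists_and_eq_and]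
  rfl

theorem mem_N_iff {c x : Perm (Fin (n + 1))} {k : Fin (n + 1)} :
    k ∈ N c x ↔ k ∈ L c ∧ k ∉ x.support ∧ ∃ P ∈ Pol x, Nested k P := by
  rw [N, Finset.mem_filter]

theorem mem_M_iff {c x : Perm (Fin (n + 1))} {k : Fin (n + 1)} :
    k ∈ M c x ↔ (k ∈ D x ∧ k ∈ U x) ∧ k ∈ L c := by
  rw [M, Finset.mem_inter, Finset.mem_inter]

theorem mem_support_of_mem_Pol {x : Perm (Fin (n + 1))} {P : Finset (Fin (n + 1))} (hP : P ∈ Pol x)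
    {a : Fin (n + 1)} (ha : a ∈ P) : a ∈ x.support :=
  mem_support.2 (apply_ne_of_mem_Pol hP ha)

/-- `c` is the circle with positions `t`, and from a point `k` of `L c` one meets first the smaller
and then the larger points. -/
structure IsLabelled (c : Perm (Fin (n + 1))) (t : Fin (n + 1) → ℕ) : Prop where
  circular : IsCircular c t
  left : ∀ k ∈ L c, ∀ a b, a < k → k < b → InArc t b k a

/-- The points are added one at a time, which keeps the diagram noncrossing. The simultaneous
enlargement of the definition gives the same diagram because the host of each point is unique. -/
theorem IsLabelled.disjoint_crossing_enlargeBy {c x : Perm (Fin (n + 1))} {t : Fin (n + 1) → ℕ}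
    (h : IsLabelled c t) (hx : NonCrossing t x) {K : Finset (Fin (n + 1))} (hK : K ⊆ N c x) :
    ∀ P ∈ Pol x, ∀ Q ∈ Pol x, P ≠ Q → Disjoint (enlargeBy c x K P) (enlargeBy c x K Q) ∧
      ¬ Crossing c (enlargeBy c x K P) (enlargeBy c x K Q) := by
  have huniq : ∀ k ∈ N c x, ∀ P ∈ Pol x, ∀ Q ∈ Pol x, P ≠ Q → Enlarges c x P k →
      Enlarges c x Q k → False := by
    intro k hk P hP Q hQ hne hkP hkQ
    exact h.circular.enlargeable_unique (h.left k (mem_N_iff.1 hk).1)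
      (disjoint_of_mem_Pol hP hQ hne) hkP.1 hkQ.1 (hkP.2 Q hQ hne.symm) (hkQ.2 P hP hne)
  have hdisj : ∀ K ⊆ N c x, ∀ P ∈ Pol x, ∀ Q ∈ Pol x, P ≠ Q →
      Disjoint (enlargeBy c x K P) (enlargeBy c x K Q) := by
    intro K hK P hP Q hQ hne
    rw [Finset.disjoint_left]
    intro a haP haQ
    rw [mem_enlargeBy] at haP haQ
    rcases haP with haP | ⟨haK, haP⟩
    · rcases haQ with haQ | ⟨haK, -⟩
      · exact Finset.disjoint_left.1 (disjoint_of_mem_Pol hP hQ hne) haP haQ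
      · exact (mem_N_iff.1 (hK haK)).2.1 (mem_support_of_mem_Pol hP haP)
    · rcases haQ with haQ | ⟨-, haQ⟩
      · exact (mem_N_iff.1 (hK haK)).2.1 (mem_support_of_mem_Pol hQ haQ)
      · exact huniq a (hK haK) P hP Q hQ hne haP haQ
  induction K using Finset.induction_on with
  | empty =>
    intro P hP Q hQ hne
    have e : ∀ P, enlargeBy c x ∅ P = P := fun P => by simp [enlargeBy]
    rw [e, e]
    exact ⟨disjoint_of_mem_Pol hP hQ hne,
      hx.not_crossing h.circular hP hQ (disjoint_of_mem_Pol hP hQ hne)⟩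
  | insert k K hkK ih =>
    have hkN : k ∈ N c x := hK (Finset.mem_insert_self k K)
    have hKN : K ⊆ N c x := (Finset.subset_insert k K).trans hK
    have ih := ih hKN
    obtain ⟨hkL, hkx, P₁, hP₁, hkP₁⟩ := mem_N_iff.1 hkN
    have hsub : ∀ P, P ⊆ enlargeBy c x K P := fun P => Finset.subset_union_left
    have hknot : ∀ P ∈ Pol x, k ∉ enlargeBy c x K P := fun P hP hk =>
      (mem_enlargeBy.1 hk).elim (fun hk => hkx (mem_support_of_mem_Pol hP hk))
        fun hk => hkK hk.1
    obtain ⟨P₀, hP₀, hN, hno⟩ := h.circular.exists_enlargeable ih (h.left k hkL) hknot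
      ⟨P₁, hP₁, hknot P₁ hP₁, hkP₁.2.1.imp fun a ha => ⟨hsub _ ha.1, ha.2⟩,
        hkP₁.2.2.imp fun a ha => ⟨hsub _ ha.1, ha.2⟩⟩
    -- Being addable to the partly enlarged polygon implies being addable to the original one:
    -- shrinking polygons creates no crossing, and the added points lie strictly between the
    -- extremes.
    have henl : Enlarges c x P₀ k := by
      refine ⟨⟨fun hk => hknot P₀ hP₀ (hsub _ hk), ?_, ?_⟩, fun Q hQ hne hcr => ?_⟩
      · obtain ⟨a, ha, hak⟩ := hN.2.1
        rcases mem_enlargeBy.1 ha with ha | ⟨-, ha⟩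
        · exact ⟨a, ha, hak⟩
        · obtain ⟨b, hb, hba⟩ := ha.1.2.1
          exact ⟨b, hb, hba.trans hak⟩
      · obtain ⟨a, ha, hak⟩ := hN.2.2
        rcases mem_enlargeBy.1 ha with ha | ⟨-, ha⟩
        · exact ⟨a, ha, hak⟩
        · obtain ⟨b, hb, hba⟩ := ha.1.2.2
          exact ⟨b, hb, hak.trans hba⟩
      · exact hno Q hQ hne (h.circular.crossing_mono (Finset.insert_subset_insert k (hsub _))
          (hsub _) hcr)
    have h₀ : enlargeBy c x (insert k K) P₀ ⊆ insert k (enlargeBy c x K P₀) := by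
      intro a ha
      rw [mem_enlargeBy, Finset.mem_insert] at ha
      rw [Finset.mem_insert, mem_enlargeBy]
      tauto
    have h₁ : ∀ P ∈ Pol x, P ≠ P₀ → enlargeBy c x (insert k K) P ⊆ enlargeBy c x K P := by
      intro P hP hne a ha
      rw [mem_enlargeBy, Finset.mem_insert] at ha
      rw [mem_enlargeBy]
      rcases ha with ha | ⟨rfl | ha, hP'⟩
      · exact .inl ha
      · exact (huniq a hkN P hP P₀ hP₀ hne hP' henl).elim
      · exact .inr ⟨ha, hP'⟩
    intro P hP Q hQ hne
    refine ⟨hdisj _ hK P hP Q hQ hne, fun hcr => ?_⟩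
    by_cases hPP : P = P₀
    · subst hPP
      exact hno Q hQ hne.symm (h.circular.crossing_mono h₀ (h₁ Q hQ hne.symm) hcr)
    by_cases hQP : Q = P₀
    · subst hQP
      exact hno P hP hne (h.circular.crossing_mono h₀ (h₁ P hP hne) (h.circular.crossing_symm hcr))
    · exact (ih P hP Q hQ hne).2 (h.circular.crossing_mono (h₁ P hP hPP) (h₁ Q hQ hQP) hcr)

theorem IsLabelled.disjoint_crossing_invPolygon {c x : Perm (Fin (n + 1))} {t : Fin (n + 1) → ℕ}
    (h : IsLabelled c t) (hx : NonCrossing t x) {P Q : Finset (Fin (n + 1))} (hP : P ∈ Pol x)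
    (hQ : Q ∈ Pol x) (hPQ : P ≠ Q) : Disjoint (invPolygon c x P) (invPolygon c x Q) ∧
      ¬ Crossing c (invPolygon c x P) (invPolygon c x Q) := by
  obtain ⟨h1, h2⟩ := h.disjoint_crossing_enlargeBy hx (Finset.Subset.refl _) P hP Q hQ hPQ
  exact ⟨h1.mono Finset.sdiff_subset Finset.sdiff_subset, fun hcr =>
    h2 (h.circular.crossing_mono Finset.sdiff_subset Finset.sdiff_subset hcr)⟩

theorem IsLabelled.invPol_pairwise {c x : Perm (Fin (n + 1))} {t : Fin (n + 1) → ℕ}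
    (h : IsLabelled c t) (hx : NonCrossing t x) :
    ∀ P ∈ invPol c x, ∀ Q ∈ invPol c x, P ≠ Q → Disjoint P Q ∧ ¬ Crossing c P Q := by
  intro P hP Q hQ hne
  obtain ⟨P, hP', rfl⟩ := mem_invPol_iff.1 hP
  obtain ⟨Q, hQ', rfl⟩ := mem_invPol_iff.1 hQ
  exact h.disjoint_crossing_invPolygon hx hP' hQ' fun e => hne (by rw [e])

theorem IsLabelled.nonCrossing_invol {c x : Perm (Fin (n + 1))} {t : Fin (n + 1) → ℕ}
    (h : IsLabelled c t) (hx : NonCrossing t x) : NonCrossing t (invol c x) :=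
  h.circular.nonCrossing_diagramPerm (h.invPol_pairwise hx)

theorem IsLabelled.sameCycle_invol_iff {c x : Perm (Fin (n + 1))} {t : Fin (n + 1) → ℕ}
    (h : IsLabelled c t) (hx : NonCrossing t x) (a b : Fin (n + 1)) :
    SameCycle (invol c x) a b ↔
      a = b ∨ ∃ P ∈ Pol x, a ∈ invPolygon c x P ∧ b ∈ invPolygon c x P := by
  rw [invol, h.circular.sameCycle_diagramPerm_iff fun P hP Q hQ hne =>
    (h.invPol_pairwise hx P hP Q hQ hne).1]
  simp only [mem_invPol_iff, exists_exists_and_eq_and]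

theorem mem_invPolygon {c x : Perm (Fin (n + 1))} {P : Finset (Fin (n + 1))} {a : Fin (n + 1)} :
    a ∈ invPolygon c x P ↔ (a ∈ P ∨ (a ∈ N c x ∧ Enlarges c x P a)) ∧ a ∉ M c x := by
  rw [invPolygon, Finset.mem_sdiff, mem_enlargeBy]

/-! ### The effect of `inv_c` on initial, terminal and interior vertices. -/

/-- The extremes of P are not interior, so they are never removed, and added points are nested, so
they never become extremes. -/
theorem exists_extremes_invPolygon {x : Perm (Fin (n + 1))} (c : Perm (Fin (n + 1)))
    {P : Finset (Fin (n + 1))} (hP : P ∈ Pol x) :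
    ∃ p q, p < q ∧ p ∈ P ∧ q ∈ P ∧ p ∈ invPolygon c x P ∧ q ∈ invPolygon c x P ∧
      (∀ a ∈ P, p ≤ a ∧ a ≤ q) ∧ ∀ a ∈ invPolygon c x P, p ≤ a ∧ a ≤ q := by
  obtain ⟨a, ha, hPa⟩ := mem_Pol_iff.1 hP
  have haP : a ∈ P := (hPa a).2 (.refl _ _)
  have hxaP : x a ∈ P := (hPa _).2 ⟨1, by simp⟩
  have hne : P.Nonempty := ⟨a, haP⟩
  obtain ⟨p, hp, hmin⟩ : ∃ p ∈ P, ∀ b ∈ P, p ≤ b :=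
    ⟨_, P.min'_mem hne, fun b hb => P.min'_le b hb⟩
  obtain ⟨q, hq, hmax⟩ : ∃ q ∈ P, ∀ b ∈ P, b ≤ q :=
    ⟨_, P.max'_mem hne, fun b hb => P.le_max' b hb⟩
  have hpU : p ∉ U x := fun hU => by
    obtain ⟨b, hb, hs⟩ := mem_U_iff.1 hU
    exact absurd hb (not_lt.2 (hmin b ((sameCycle_of_mem_Pol hP hp b).2 hs)))
  have hqD : q ∉ D x := fun hD => by
    obtain ⟨b, hb, hs⟩ := mem_D_iff.1 hD
    exact absurd hb (not_lt.2 (hmax b ((sameCycle_of_mem_Pol hP hq b).2 hs)))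
  refine ⟨p, q, ?_, hp, hq, ?_, ?_, fun a ha => ⟨hmin a ha, hmax a ha⟩, fun a ha => ?_⟩
  · refine lt_of_le_of_ne (hmin q hq) ?_
    rintro rfl
    exact ha ((le_antisymm (hmax _ hxaP) (hmin _ hxaP)).trans
      (le_antisymm (hmin _ haP) (hmax _ haP)))
  · exact mem_invPolygon.2 ⟨.inl hp, fun hM => hpU (mem_M_iff.1 hM).1.2⟩
  · exact mem_invPolygon.2 ⟨.inl hq, fun hM => hqD (mem_M_iff.1 hM).1.1⟩
  · rcases (mem_invPolygon.1 ha).1 with ha | ⟨-, ha⟩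
    · exact ⟨hmin a ha, hmax a ha⟩
    · obtain ⟨b, hb, hba⟩ := ha.1.2.1
      obtain ⟨b', hb', hba'⟩ := ha.1.2.2
      exact ⟨(hmin b hb).trans hba.le, hba'.le.trans (hmax b' hb')⟩

/-- `k` lies strictly between two points of a cycle of `x`. -/
def Straddled (x : Perm (Fin (n + 1))) (k : Fin (n + 1)) : Prop :=
  ∃ a b, SameCycle x a b ∧ a < k ∧ k < b

theorem exists_nested_iff {x : Perm (Fin (n + 1))} {k : Fin (n + 1)} (hk : k ∉ x.support) :
    (∃ P ∈ Pol x, Nested k P) ↔ Straddled x k := by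
  constructor
  · rintro ⟨P, hP, -, ⟨a, ha, hak⟩, ⟨b, hb, hkb⟩⟩
    exact ⟨a, b, (sameCycle_of_mem_Pol hP ha b).1 hb, hak, hkb⟩
  · rintro ⟨a, b, hab, hak, hkb⟩
    obtain ⟨P, hP, ha⟩ := exists_mem_Pol (apply_ne_of_sameCycle hab (hak.trans hkb).ne)
    exact ⟨P, hP, fun hkP => hk (mem_support_of_mem_Pol hP hkP), ⟨a, ha, hak⟩,
      ⟨b, (sameCycle_of_mem_Pol hP ha b).2 hab, hkb⟩⟩

theorem IsLabelled.straddled_invol_iff {c x : Perm (Fin (n + 1))} {t : Fin (n + 1) → ℕ}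
    (h : IsLabelled c t) (hx : NonCrossing t x) (k : Fin (n + 1)) :
    Straddled (invol c x) k ↔ Straddled x k := by
  constructor
  · rintro ⟨a, b, hab, hak, hkb⟩
    obtain ⟨P, hP, ha, hb⟩ := ((h.sameCycle_invol_iff hx a b).1 hab).resolve_left
      (hak.trans hkb).ne
    obtain ⟨p, q, hpq, hp, hq, hp', hq', h1, h2⟩ := exists_extremes_invPolygon c hP
    exact ⟨p, q, (sameCycle_of_mem_Pol hP hp q).1 hq, (h2 a ha).1.trans_lt hak,
      hkb.trans_le (h2 b hb).2⟩
  · rintro ⟨a, b, hab, hak, hkb⟩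
    obtain ⟨P, hP, ha⟩ := exists_mem_Pol (apply_ne_of_sameCycle hab (hak.trans hkb).ne)
    have hb := (sameCycle_of_mem_Pol hP ha b).2 hab
    obtain ⟨p, q, hpq, hp, hq, hp', hq', h1, h2⟩ := exists_extremes_invPolygon c hP
    exact ⟨p, q, (h.sameCycle_invol_iff hx p q).2 (.inr ⟨P, hP, hp', hq'⟩),
      (h1 a ha).1.trans_lt hak, hkb.trans_le (h1 b hb).2⟩

theorem IsLabelled.eq_of_mem_invPolygon {c x : Perm (Fin (n + 1))} {t : Fin (n + 1) → ℕ}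
    (h : IsLabelled c t) (hx : NonCrossing t x) {P Q : Finset (Fin (n + 1))} (hP : P ∈ Pol x)
    (hQ : Q ∈ Pol x) {a : Fin (n + 1)} (haP : a ∈ invPolygon c x P)
    (haQ : a ∈ invPolygon c x Q) : P = Q := by
  by_contra hne
  exact Finset.disjoint_left.1 (h.disjoint_crossing_invPolygon hx hP hQ hne).1 haP haQ

theorem IsLabelled.isInitial_invol_iff {c x : Perm (Fin (n + 1))} {t : Fin (n + 1) → ℕ}
    (h : IsLabelled c t) (hx : NonCrossing t x) (k : Fin (n + 1)) :
    IsInitial (invol c x) k ↔ IsInitial x k := by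
  constructor
  · intro hk
    obtain ⟨hk1, hk2⟩ := isInitial_iff.1 hk
    obtain ⟨P, hP, hkP, -⟩ := ((h.sameCycle_invol_iff hx k (invol c x k)).1
      ⟨1, by simp⟩).resolve_left (Ne.symm hk1)
    obtain ⟨p, q, hpq, hp, hq, hp', hq', h1, h2⟩ := exists_extremes_invPolygon c hP
    have hkp := hk2 p ((h.sameCycle_invol_iff hx k p).2 (.inr ⟨P, hP, hkP, hp'⟩))
    obtain rfl := le_antisymm hkp (h2 k hkP).1
    exact ⟨P, hP, hp, fun a ha => (h1 a ha).1⟩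
  · rintro ⟨P, hP, hkP, hk⟩
    obtain ⟨p, q, hpq, hp, hq, hp', hq', h1, h2⟩ := exists_extremes_invPolygon c hP
    obtain rfl := le_antisymm (hk p hp) (h1 k hkP).1
    refine isInitial_iff.2 ⟨apply_ne_of_sameCycle ((h.sameCycle_invol_iff hx k q).2
      (.inr ⟨P, hP, hp', hq'⟩)) hpq.ne, fun b hb => ?_⟩
    rcases (h.sameCycle_invol_iff hx k b).1 hb with rfl | ⟨Q, hQ, hkQ, hbQ⟩
    · exact le_rfl
    · obtain rfl := h.eq_of_mem_invPolygon hx hP hQ hp' hkQ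
      exact (h2 b hbQ).1

theorem IsLabelled.isTerminal_invol_iff {c x : Perm (Fin (n + 1))} {t : Fin (n + 1) → ℕ}
    (h : IsLabelled c t) (hx : NonCrossing t x) (k : Fin (n + 1)) :
    IsTerminal (invol c x) k ↔ IsTerminal x k := by
  constructor
  · intro hk
    obtain ⟨hk1, hk2⟩ := isTerminal_iff.1 hk
    obtain ⟨P, hP, hkP, -⟩ := ((h.sameCycle_invol_iff hx k (invol c x k)).1
      ⟨1, by simp⟩).resolve_left (Ne.symm hk1)
    obtain ⟨p, q, hpq, hp, hq, hp', hq', h1, h2⟩ := exists_extremes_invPolygon c hP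
    have hkq := hk2 q ((h.sameCycle_invol_iff hx k q).2 (.inr ⟨P, hP, hkP, hq'⟩))
    obtain rfl := le_antisymm (h2 k hkP).2 hkq
    exact ⟨P, hP, hq, fun a ha => (h1 a ha).2⟩
  · rintro ⟨P, hP, hkP, hk⟩
    obtain ⟨p, q, hpq, hp, hq, hp', hq', h1, h2⟩ := exists_extremes_invPolygon c hP
    obtain rfl := le_antisymm (h1 k hkP).2 (hk q hq)
    refine isTerminal_iff.2 ⟨apply_ne_of_sameCycle ((h.sameCycle_invol_iff hx k p).2
      (.inr ⟨P, hP, hq', hp'⟩)) hpq.ne', fun b hb => ?_⟩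
    rcases (h.sameCycle_invol_iff hx k b).1 hb with rfl | ⟨Q, hQ, hkQ, hbQ⟩
    · exact le_rfl
    · obtain rfl := h.eq_of_mem_invPolygon hx hP hQ hq' hkQ
      exact (h2 b hbQ).2

/-- Outside L nothing changes. On L the old interior vertices are deleted, and the new ones are the
added points; a straddled non-vertex always finds a polygon to join. -/
theorem IsLabelled.mem_D_inter_U_invol_iff {c x : Perm (Fin (n + 1))} {t : Fin (n + 1) → ℕ}
    (h : IsLabelled c t) (hx : NonCrossing t x) (k : Fin (n + 1)) :
    (k ∈ D (invol c x) ∧ k ∈ U (invol c x)) ↔ (k ∉ L c ∧ k ∈ D x ∧ k ∈ U x) ∨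
      (k ∈ L c ∧ k ∉ x.support ∧ Straddled x k) := by
  have back : ∀ P ∈ Pol x, k ∈ invPolygon c x P → (∃ a ∈ P, a < k) → (∃ b ∈ P, k < b) →
      k ∈ D (invol c x) ∧ k ∈ U (invol c x) := by
    rintro P hP hkP ⟨a, ha, hak⟩ ⟨b, hb, hkb⟩
    obtain ⟨p, q, hpq, hp, hq, hp', hq', h1, h2⟩ := exists_extremes_invPolygon c hP
    exact ⟨mem_D_iff.2 ⟨q, hkb.trans_le (h1 b hb).2,
        (h.sameCycle_invol_iff hx k q).2 (.inr ⟨P, hP, hkP, hq'⟩)⟩,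
      mem_U_iff.2 ⟨p, (h1 a ha).1.trans_lt hak,
        (h.sameCycle_invol_iff hx k p).2 (.inr ⟨P, hP, hkP, hp'⟩)⟩⟩
  constructor
  · rintro ⟨hD, hU⟩
    obtain ⟨b, hb, hkb⟩ := mem_D_iff.1 hD
    obtain ⟨a, ha, hka⟩ := mem_U_iff.1 hU
    obtain ⟨P, hP, hkP, hbP⟩ := ((h.sameCycle_invol_iff hx k b).1 hkb).resolve_left (ne_of_lt hb)
    obtain ⟨Q, hQ, hkQ, haQ⟩ := ((h.sameCycle_invol_iff hx k a).1 hka).resolve_left ha.ne'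
    obtain rfl := h.eq_of_mem_invPolygon hx hP hQ hkP hkQ
    obtain ⟨p, q, hpq, hp, hq, hp', hq', h1, h2⟩ := exists_extremes_invPolygon c hP
    obtain ⟨hkP', hkM⟩ := mem_invPolygon.1 hkP
    rcases hkP' with hkP' | ⟨hkN, -⟩
    · have hDx : k ∈ D x := mem_D_iff.2 ⟨q, lt_of_lt_of_le hb (h2 b hbP).2,
        (sameCycle_of_mem_Pol hP hkP' q).1 hq⟩
      have hUx : k ∈ U x := mem_U_iff.2 ⟨p, (h2 a haQ).1.trans_lt ha,
        (sameCycle_of_mem_Pol hP hkP' p).1 hp⟩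
      exact .inl ⟨fun hL => hkM (mem_M_iff.2 ⟨⟨hDx, hUx⟩, hL⟩), hDx, hUx⟩
    · obtain ⟨h3, h4, h5⟩ := mem_N_iff.1 hkN
      exact .inr ⟨h3, h4, (exists_nested_iff h4).1 h5⟩
  · rintro (⟨hL, hD, hU⟩ | ⟨hL, hk, hS⟩)
    · obtain ⟨b, hb, hkb⟩ := mem_D_iff.1 hD
      obtain ⟨a, ha, hka⟩ := mem_U_iff.1 hU
      obtain ⟨P, hP, hkP⟩ := exists_mem_Pol (apply_ne_of_sameCycle hka ha.ne')
      exact back P hP (mem_invPolygon.2 ⟨.inl hkP, fun hM => hL (mem_M_iff.1 hM).2⟩)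
        ⟨a, (sameCycle_of_mem_Pol hP hkP a).2 hka, ha⟩
        ⟨b, (sameCycle_of_mem_Pol hP hkP b).2 hkb, hb⟩
    · have hN := (exists_nested_iff hk).2 hS
      obtain ⟨P, hP, hkP, hno⟩ := h.circular.exists_enlargeable (S := Pol x) (F := id)
        (fun P hP Q hQ hne => ⟨disjoint_of_mem_Pol hP hQ hne,
          hx.not_crossing h.circular hP hQ (disjoint_of_mem_Pol hP hQ hne)⟩)
        (h.left k hL) (fun P hP hkP => hk (mem_support_of_mem_Pol hP hkP)) hN
      refine back P hP (mem_invPolygon.2 ⟨.inr ⟨mem_N_iff.2 ⟨hL, hk, hN⟩, hkP, hno⟩, fun hM => ?_⟩)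
        hkP.2.1 hkP.2.2
      exact hk (mem_support_iff_mem_D_or_mem_U.2 (.inl (mem_M_iff.1 hM).1.1))

theorem straddled_of_mem {x : Perm (Fin (n + 1))} {k : Fin (n + 1)} (hD : k ∈ D x)
    (hU : k ∈ U x) : Straddled x k := by
  obtain ⟨b, hb, hkb⟩ := mem_D_iff.1 hD
  obtain ⟨a, ha, hka⟩ := mem_U_iff.1 hU
  exact ⟨a, b, hka.symm.trans hkb, ha, hb⟩

/-- The exchange rule read backwards: initial, terminal and straddled points are unchanged, so on L
the interior vertices of `x` are the straddled points missing from the image. -/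
theorem IsLabelled.mem_D_and_mem_U_iff {c x : Perm (Fin (n + 1))} {t : Fin (n + 1) → ℕ}
    (h : IsLabelled c t) (hx : NonCrossing t x) (k : Fin (n + 1)) :
    (k ∈ D x ∧ k ∈ U x) ↔ (k ∉ L c ∧ k ∈ D (invol c x) ∧ k ∈ U (invol c x)) ∨
      (k ∈ L c ∧ k ∉ (invol c x).support ∧ Straddled (invol c x) k) := by
  have h1 := h.mem_D_inter_U_invol_iff hx k
  have h2 := h.isInitial_invol_iff hx k
  have h3 := h.isTerminal_invol_iff hx k
  have h4 := straddled_of_mem (x := x) (k := k)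
  rw [h.straddled_invol_iff hx]
  rw [isInitial_iff_mem, isInitial_iff_mem] at h2
  rw [isTerminal_iff_mem, isTerminal_iff_mem] at h3
  rw [mem_support_iff_mem_D_or_mem_U] at h1 ⊢
  grind

/-- The image determines D and U of `x`, hence `x`; it is not necessary to know that applying `invol
c` twice gives the identity. -/
theorem IsLabelled.injOn_invol {c : Perm (Fin (n + 1))} {t : Fin (n + 1) → ℕ}
    (h : IsLabelled c t) (ht : IsUnimodal t) {x y : Perm (Fin (n + 1))} (hx : NonCrossing t x)
    (hy : NonCrossing t y) (e : invol c x = invol c y) : x = y := by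
  have hDU : ∀ k, (k ∈ D x ↔ k ∈ D y) ∧ (k ∈ U x ↔ k ∈ U y) := by
    intro k
    have a1 := h.mem_D_and_mem_U_iff hx k
    have b1 := h.mem_D_and_mem_U_iff hy k
    have a2 := h.isInitial_invol_iff hx k
    have a3 := h.isTerminal_invol_iff hx k
    have b2 := h.isInitial_invol_iff hy k
    have b3 := h.isTerminal_invol_iff hy k
    rw [e] at a1 a2 a3
    have c1 := a1.trans b1.symm
    have c2 := a2.symm.trans b2
    have c3 := a3.symm.trans b3
    rw [isInitial_iff_mem, isInitial_iff_mem] at c2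
    rw [isTerminal_iff_mem, isTerminal_iff_mem] at c3
    clear a1 b1 a2 a3 b2 b3
    grind
  exact hx.ext_D_U ht hy (Finset.ext fun k => (hDU k).1) (Finset.ext fun k => (hDU k).2)

/-! ### Assembling the bijection and reading off I and J. -/

theorem IsStdCoxeter.exists_label {c : Perm (Fin (n + 1))} (hc : IsStdCoxeter c) :
    ∃ t, IsLabelled c t ∧ IsUnimodal t ∧ (∀ k, k ∈ R c ∨ k ∈ L c) ∧
      ∀ k, k ∈ R c → k ∈ L c → k = 0 ∨ k = Fin.last n := by
  obtain ⟨t, h1, h2, h3, h4, h5⟩ := hc.exists_circle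
  exact ⟨t, ⟨h1, h5⟩, h2, h3, h4⟩

theorem zero_notMem_U (x : Perm (Fin (n + 1))) : 0 ∉ U x := fun h => by
  obtain ⟨b, hb, -⟩ := mem_U_iff.1 h
  exact absurd hb (not_lt.2 (Fin.zero_le b))

theorem last_notMem_D (x : Perm (Fin (n + 1))) : Fin.last n ∉ D x := fun h => by
  obtain ⟨b, hb, -⟩ := mem_D_iff.1 h
  exact absurd hb (not_lt.2 (Fin.le_last b))

theorem bijOn_phi {c : Perm (Fin (n + 1))} {t : Fin (n + 1) → ℕ} (h : IsLabelled c t)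
    (ht : IsUnimodal t) : Set.BijOn (phi c) (NC c) (FC n) := by
  have hmaps : Set.MapsTo (invol c) (NC c) (NC c) := fun x hx =>
    (mem_NC_iff h.circular).2 (h.nonCrossing_invol ((mem_NC_iff h.circular).1 hx))
  have hinj : Set.InjOn (invol c) (NC c) := fun x hx y hy e =>
    h.injOn_invol ht ((mem_NC_iff h.circular).1 hx) ((mem_NC_iff h.circular).1 hy) e
  have hinv : Set.BijOn (invol c) (NC c) (NC c) :=
    -- An injective self-map of a finite set is onto.
    ⟨hmaps, hinj, (Set.eq_of_subset_of_ncard_le hmaps.image_subset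
      (hinj.ncard_image).ge).ge⟩
  have hpsi : Set.BijOn (psi1 (n := n)) (NC c) (seqPairs n) := by
    refine ⟨fun x hx => ((mem_NC_iff h.circular).1 hx).psi1_mem ht, fun x hx y hy e => ?_,
      fun p hp => ?_⟩
    · exact ((mem_NC_iff h.circular).1 hx).ext_D_U ht ((mem_NC_iff h.circular).1 hy)
        (congrArg Prod.fst e) (congrArg Prod.snd e)
    · obtain ⟨x, hx, h1, h2⟩ := exists_nonCrossing_of_mem_seqPairs ht (A := p.1) (B := p.2) hp
      exact ⟨x, (mem_NC_iff h.circular).2 hx, Prod.ext h1 h2⟩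
  exact bijOn_g.comp (hpsi.comp hinv)

end NCFC

theorem mainTheorem4 (n : ℕ) (c : Equiv.Perm (Fin (n + 1))) (hc : NCFC.IsStdCoxeter c) :
    -- the maps composing `φ = g ∘ ψ₁ ∘ inv_c` have the stated domains and codomains
    Set.MapsTo (NCFC.invol c) (NCFC.NC c) (NCFC.NC c) ∧
    Set.MapsTo (NCFC.psi2 c) (NCFC.NC c) (NCFC.seqPairs n) ∧
    Set.BijOn (NCFC.phi c) (NCFC.NC c) (NCFC.FC n) ∧
    ∀ x ∈ NCFC.NC c,
      -- the normal form of `φ x`, through which `I` and `J` are defined, exists and is unique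
      (∃! p : List (Fin n) × List (Fin n), NCFC.IsNormalForm (NCFC.phi c x) p.1 p.2) ∧
      ∀ k : Fin (n + 1),
        ((∃ j ∈ NCFC.J (NCFC.phi c x), j.castSucc = k) ↔
          (k ∈ NCFC.R c ∧ k ∈ NCFC.D x) ∨
          (k ∈ NCFC.L c ∧ NCFC.IsInitial x k) ∨
          (k ∈ NCFC.L c ∧ k ∉ x.support ∧ ∃ P ∈ NCFC.Pol x, NCFC.Nested k P)) ∧
        ((∃ i ∈ NCFC.I (NCFC.phi c x), i.succ = k) ↔
          (k ∈ NCFC.R c ∧ k ∈ NCFC.U x) ∨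
          (k ∈ NCFC.L c ∧ NCFC.IsTerminal x k) ∨
          (k ∈ NCFC.L c ∧ k ∉ x.support ∧ ∃ P ∈ NCFC.Pol x, NCFC.Nested k P)) := by
  obtain ⟨t, h, ht, hRL, hRL'⟩ := hc.exists_label
  have hmaps : Set.MapsTo (NCFC.invol c) (NCFC.NC c) (NCFC.NC c) := fun x hx =>
    (NCFC.mem_NC_iff h.circular).2 (h.nonCrossing_invol ((NCFC.mem_NC_iff h.circular).1 hx))
  have hmaps2 : Set.MapsTo (NCFC.psi2 c) (NCFC.NC c) (NCFC.seqPairs n) := fun x hx =>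
    ((NCFC.mem_NC_iff h.circular).1 (hmaps hx)).psi1_mem ht
  refine ⟨hmaps, hmaps2, NCFC.bijOn_phi h ht, fun x hx =>
    ⟨NCFC.existsUnique_normalForm (hmaps2 hx), fun k => ?_⟩⟩
  have hx' := (NCFC.mem_NC_iff h.circular).1 hx
  have h1 := h.mem_D_inter_U_invol_iff hx' k
  have h2 := h.isInitial_invol_iff hx' k
  have h3 := h.isTerminal_invol_iff hx' k
  have h4 := hRL k
  -- The two sides share only the labels 1 and n + 1, which are never interior vertices, so the
  -- clauses for R and L agree where they overlap.
  have h5 : k ∈ NCFC.R c → k ∈ NCFC.L c → ¬ (k ∈ NCFC.D x ∧ k ∈ NCFC.U x) := by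
    rintro hR hL ⟨hD, hU⟩
    rcases hRL' k hR hL with rfl | rfl
    · exact NCFC.zero_notMem_U x hU
    · exact NCFC.last_notMem_D x hD
  have h6 : (k ∉ x.support ∧ ∃ P ∈ NCFC.Pol x, NCFC.Nested k P) ↔
      (k ∉ x.support ∧ NCFC.Straddled x k) :=
    and_congr_right fun hk => NCFC.exists_nested_iff hk
  rw [NCFC.phi, NCFC.exists_mem_J_g_iff (hmaps2 hx), NCFC.exists_mem_I_g_iff (hmaps2 hx),
    NCFC.psi2, NCFC.psi1, h6]
  rw [NCFC.isInitial_iff_mem, NCFC.isInitial_iff_mem] at h2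
  rw [NCFC.isTerminal_iff_mem, NCFC.isTerminal_iff_mem] at h3
  rw [NCFC.isInitial_iff_mem, NCFC.isTerminal_iff_mem]
  simp only
  clear hRL hRL' h6 hmaps hmaps2
  generalize (k ∉ x.support ∧ NCFC.Straddled x k) = S at *
  grind
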